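/- Let $d\ge 1$ and let $(D,\mathscr D(D))$ be a regular symmetric Dirichlet form on $L^2(\mathbb R^d,dx)$ with core $C_c^2(\mathbb R^d)$. Let $V\ge 0$ be a locally bounded measurable function on $\mathbb R^d$, and let $$D^V(f,f)=D(f,f)+\int f^2V\,dx,\qquad \mathscr D(D^V)=\overline{C_c^2(\mathbb R^d)}^{D^V_1},\qquad D^V_1(f,f)=D^V(f,f)+\|f\|_{L^2}^2 ,$$ with associated strongly continuous symmetric contraction semigroup $(T^V_t)_{t\ge0}$ on $L^2(\mathbb R^d,dx)$. Assume that $T^V_t$ is compact for every $t>0$, and that the ground state $\phi_1$ ($\|\phi_1\|_{L^2}=1$, $T_t^V\phi_1=e^{-\lambda_1t}\phi_1$, $\lambda_1>0$ the smallest eigenvalue) is bounded, continuous and strictly positive. The semigroup is called intrinsically ultracontractive if for every $t>0$ the operator $f\mapsto \frac{e^{\lambda_1 t}}{\phi_1}T^V_t(\phi_1 f)$ is bounded from $L^2(\phi_1^2dx)$ to $L^\infty(\phi_1^2dx)$. Assume * (A2) $|\{x: V(x)\le r\}|<\infty$ for every $r>0$; * (A4) there is $K>0$ such that $\Phi(R):=\inf\{V(x):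 |x|\ge R,\ V(x)>K\}\to\infty$ as $R\to\infty$. For this $K$ let $\Theta(R):=|\{x:|x|\ge R,\ V(x)\le K\}|$. Let $\varphi\ge0$ be a bounded measurable function such that 1. there are $r_0>0$ and a positive measurable function $\alpha$ on $(0,\infty)^2$ with $$\int_{B(0,r)}f^2dx\le sD^V(f,f)+\alpha(r,s)\Big(\int|f|\varphi\,dx\Big)^2,\qquad r\ge r_0,\ s>0,\ f\in\mathscr D(D^V);$$ 2. $\varphi\le C_0\phi_1$ on $\mathbb R^d$ for some constant $C_0>0$. Put $\Phi^{-1}(t):=\inf\{R\ge r_0:\Phi(R)\ge t\}$ and, for $s>0$, $$\beta(s):=C_0^2\,\alpha\big(\Phi^{-1}(2/s),s/2\big),\qquad \gamma(s):=\Theta\big(\Phi^{-1}(2/s)\big),\qquad s_0:=\frac{2}{\Phi(r_0)} .$$ For a rate function $b:(0,\infty)\to[0,\infty]$ (such as $\beta$) let $b^{-1}(y):=\inf\{s>0:b(s)\le y\}$, and let $\gamma^{-1}(y):=\inf\{s>0:\gamma(s)\ge y\}$ ($\inf\emptyset=\infty$). Then for all $s>0$, $f\in\mathscr D(D^V)$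 and $p\in(2,\infty]$, with $(p-2)/p:=1$ for $p=\infty$ and $0\cdot\infty:=0$, $$\int f^2dx\le sD^V(f,f)+\beta(s\wedge s_0)\Big(\int|f|\phi_1dx\Big)^2+\gamma(s\wedge s_0)^{(p-2)/p}\|f\|_{L^p}^2 .$$ Say that $\mathrm{SP}(b)$ holds if there is $r>0$ such that $$\int f^2dx\le sD^V(f,f)+b(s\wedge r)\Big(\int|f|\phi_1dx\Big)^2,\qquad s>0,\ f\in\mathscr D(D^V),$$ and that $b$ is integrable if $\inf b<\infty$ and $\int_t^\infty\frac{b^{-1}(y)}{y}\,dy<\infty$ for all real $t>\inf b$. Moreover: (i) If $V(x)\to\infty$ as $|x|\to\infty$, then $\mathrm{SP}(\beta)$ holds; consequently, if $\beta$ is integrable, then $(T^V_t)_{t\ge 0}$ is intrinsically ultracontractive. (ii) If for some $p\in(2,\infty]$ and $c_0>0$ $$\|f\|_{L^p}^2\le c_0\big[D^V(f,f)+\|f\|_{L^2}^2\big],\qquad f\in C_c^\infty(\mathbb R^d),$$ then $\mathrm{SP}(\hat\beta)$ holds with $\hat\beta(s):=2C_0^2\,\alpha\big(\Psi^{-1}(s/4),s/4\big)$,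 where $\Psi(R):=\frac1{\Phi(R)}+c_0\Theta(R)^{(p-2)/p}$ and $\Psi^{-1}(t):=\inf\{R>1:\Psi(R)\le t\}$; consequently, if $\hat\beta$ is integrable, then $(T^V_t)_{t\ge 0}$ is intrinsically ultracontractive. (iii) Let $c_1:=\|\phi_1\|_\infty^2$. If for some $\delta>1$, with $s_n:=\beta^{-1}(c_1\delta^n/2)$, $$\sum_{n\ge1}\gamma(s_n)\delta^n<\infty$$ (the finitely many $n$ with $s_n=\infty$ being disregarded), then $\mathrm{SP}(\tilde\beta)$ holds with $$\tilde\beta(s):=2\beta\Big(\gamma^{-1}\Big(\frac1{4\delta^{n_0(s)+1}}\Big)\Big),$$ where $n_0(s)$ is the least integer $N\ge1$ with $$N\ge\log_\delta\frac{2\beta(s_0)}{c_1},\qquad N\ge-\log_\delta\big(4\delta\gamma(s_0)\big),\qquad \frac{4\delta(\sqrt\delta+1)s_N}{\sqrt\delta-1}+2\gamma^{-1}\Big(\frac1{4\delta^{N+1}}\Big)\le s$$ (with $-\log_\delta 0:=\infty$), and $\tilde\beta(s):=\infty$ if there is no such $N$. Consequently, if $\tilde\beta$ is integrable, then $(T^V_t)_{t\ge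 0}$ is intrinsically ultracontractive. -/

import Mathlib

open MeasureTheory Filter Topology
open scoped NNReal ENNReal InnerProductSpace

/-- The Euclidean space `ℝ^d`. -/
abbrev RSpace (d : ℕ) : Type := EuclideanSpace ℝ (Fin d)

/-- The real Hilbert space `L²(ℝ^d, dx)`. -/
abbrev LTwo (d : ℕ) : Type := Lp ℝ 2 (volume : Measure (RSpace d))

/-- The elements of `L²(ℝ^d, dx)` represented by a function in `C_c^n(ℝ^d)`. -/
def ccClass (d : ℕ) (n : WithTop ℕ∞) : Set (LTwo d) :=
  {u | ∃ f : RSpace d → ℝ, ContDiff ℝ n f ∧ HasCompactSupport f ∧ u =ᵐ[volume] f}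

/-- A bilinear form on a linear subspace of `L²(ℝ^d, dx)`. -/
structure LTwoForm (d : ℕ) where
  /-- the domain of the form -/
  dom : Submodule ℝ (LTwo d)
  /-- the form -/
  form : LinearMap.BilinForm ℝ dom

/-- A regular symmetric Dirichlet form on `L²(ℝ^d, dx)` having `C_c^2(ℝ^d)` as a core.
(`C_c^2(ℝ^d)` is always uniformly dense in `C_c(ℝ^d)`, so that only its inclusion and density
in the domain have to be required.) -/
structure RegularDirichletForm (d : ℕ) extends LTwoForm d where
  symm : ∀ u v : dom, form u v = form v u
  nonneg : ∀ u : dom, 0 ≤ form u u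
  dense_dom : Dense (dom : Set (LTwo d))
  /-- the domain is complete for `D_1(u,u) = D(u,u) + ‖u‖²` -/
  closed : ∀ u : ℕ → dom,
    (∀ ε : ℝ, 0 < ε → ∃ N : ℕ, ∀ m n : ℕ, N ≤ m → N ≤ n →
      form (u m - u n) (u m - u n) + ‖(u m - u n : dom)‖ ^ 2 < ε) →
    ∃ v : dom, Tendsto (fun n => form (u n - v) (u n - v) + ‖(u n - v : dom)‖ ^ 2) atTop (𝓝 0)
  /-- the unit contraction operates -/
  markov : ∀ u : dom, ∃ v : dom,
    ((v : LTwo d) =ᵐ[volume] fun x => max 0 (min 1 ((u : LTwo d) x))) ∧ form v v ≤ form u u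
  core_subset : ∀ u ∈ ccClass d 2, u ∈ dom
  core_dense : ∀ u : dom, ∀ ε : ℝ, 0 < ε → ∃ g : dom, (g : LTwo d) ∈ ccClass d 2 ∧
    form (u - g) (u - g) + ‖(u - g : dom)‖ ^ 2 < ε

namespace RegularDirichletForm

variable {d : ℕ}

/-- `𝒟(D) ∩ L²(ℝ^d, V dx)`. -/
def preDom (D : RegularDirichletForm d) (V : RSpace d → ℝ≥0) : Submodule ℝ (LTwo d) where
  carrier := {u | u ∈ D.dom ∧ MemLp (fun x => √(V x : ℝ) * u x) 2 volume}
  zero_mem' := by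
    refine ⟨D.dom.zero_mem, ?_⟩
    refine (MemLp.zero' (ε := ℝ)).ae_eq ?_
    filter_upwards [Lp.coeFn_zero ℝ 2 (volume : Measure (RSpace d))] with x hx
    change (0 : ℝ) = √(V x : ℝ) * (0 : LTwo d) x
    rw [hx, Pi.zero_apply, mul_zero]
  add_mem' := by
    rintro u v ⟨hu, hu'⟩ ⟨hv, hv'⟩
    refine ⟨D.dom.add_mem hu hv, ?_⟩
    refine (hu'.add hv').ae_eq ?_
    filter_upwards [Lp.coeFn_add u v] with x hx
    change √(V x : ℝ) * u x + √(V x : ℝ) * v x = √(V x : ℝ) * (u + v : LTwo d) x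
    rw [hx, Pi.add_apply, mul_add]
  smul_mem' := by
    rintro c u ⟨hu, hu'⟩
    refine ⟨D.dom.smul_mem c hu, ?_⟩
    refine (hu'.const_smul c).ae_eq ?_
    filter_upwards [Lp.coeFn_smul c u] with x hx
    change c * (√(V x : ℝ) * u x) = √(V x : ℝ) * (c • u : LTwo d) x
    rw [hx, Pi.smul_apply, smul_eq_mul]
    ring

theorem integrable_pre (D : RegularDirichletForm d) (V : RSpace d → ℝ≥0)
    (u v : D.preDom V) :
    Integrable (fun x => (V x : ℝ) * ((u : LTwo d) x * (v : LTwo d) x)) volume := by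
  refine (u.2.2.integrable_mul v.2.2).congr (ae_of_all _ fun x => ?_)
  have h := Real.mul_self_sqrt (NNReal.coe_nonneg (V x))
  simp only [Pi.mul_apply]
  linear_combination ((u : LTwo d) x * (v : LTwo d) x) * h

/-- The form `D(u,v) + ∫ u v V dx` on `𝒟(D) ∩ L²(ℝ^d, V dx)`. -/
noncomputable def preForm (D : RegularDirichletForm d) (V : RSpace d → ℝ≥0) :
    LinearMap.BilinForm ℝ (D.preDom V) :=
  LinearMap.mk₂ ℝ
    (fun u v => D.form ⟨u, u.2.1⟩ ⟨v, v.2.1⟩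
      + ∫ x, (V x : ℝ) * ((u : LTwo d) x * (v : LTwo d) x))
    (by
      intro u u' v
      have h1 : (⟨((u + u' : D.preDom V) : LTwo d), (u + u').2.1⟩ : D.dom)
          = ⟨u, u.2.1⟩ + ⟨u', u'.2.1⟩ := rfl
      have h2 : ∫ x, (V x : ℝ) * (((u + u' : D.preDom V) : LTwo d) x * (v : LTwo d) x)
          = (∫ x, (V x : ℝ) * ((u : LTwo d) x * (v : LTwo d) x))
            + ∫ x, (V x : ℝ) * ((u' : LTwo d) x * (v : LTwo d) x) := by
        rw [← integral_add (D.integrable_pre V u v) (D.integrable_pre V u' v)]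
        refine integral_congr_ae ?_
        filter_upwards [Lp.coeFn_add (u : LTwo d) (u' : LTwo d)] with x hx
        rw [Submodule.coe_add, hx, Pi.add_apply]
        ring
      rw [h1, h2, map_add, LinearMap.add_apply]
      ring)
    (by
      intro c u v
      have h1 : (⟨((c • u : D.preDom V) : LTwo d), (c • u).2.1⟩ : D.dom)
          = c • ⟨u, u.2.1⟩ := rfl
      have h2 : ∫ x, (V x : ℝ) * (((c • u : D.preDom V) : LTwo d) x * (v : LTwo d) x)
          = c * ∫ x, (V x : ℝ) * ((u : LTwo d) x * (v : LTwo d) x) := by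
        rw [← integral_const_mul]
        refine integral_congr_ae ?_
        filter_upwards [Lp.coeFn_smul c (u : LTwo d)] with x hx
        rw [Submodule.coe_smul, hx, Pi.smul_apply, smul_eq_mul]
        ring
      rw [h1, h2, map_smul, LinearMap.smul_apply, smul_eq_mul, smul_eq_mul]
      ring)
    (by
      intro u v v'
      have h1 : (⟨((v + v' : D.preDom V) : LTwo d), (v + v').2.1⟩ : D.dom)
          = ⟨v, v.2.1⟩ + ⟨v', v'.2.1⟩ := rfl
      have h2 : ∫ x, (V x : ℝ) * ((u : LTwo d) x * ((v + v' : D.preDom V) : LTwo d) x)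
          = (∫ x, (V x : ℝ) * ((u : LTwo d) x * (v : LTwo d) x))
            + ∫ x, (V x : ℝ) * ((u : LTwo d) x * (v' : LTwo d) x) := by
        rw [← integral_add (D.integrable_pre V u v) (D.integrable_pre V u v')]
        refine integral_congr_ae ?_
        filter_upwards [Lp.coeFn_add (v : LTwo d) (v' : LTwo d)] with x hx
        rw [Submodule.coe_add, hx, Pi.add_apply]
        ring
      rw [h1, h2, map_add]
      ring)
    (by
      intro c u v
      have h1 : (⟨((c • v : D.preDom V) : LTwo d), (c • v).2.1⟩ : D.dom)
          = c • ⟨v, v.2.1⟩ := rfl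
      have h2 : ∫ x, (V x : ℝ) * ((u : LTwo d) x * ((c • v : D.preDom V) : LTwo d) x)
          = c * ∫ x, (V x : ℝ) * ((u : LTwo d) x * (v : LTwo d) x) := by
        rw [← integral_const_mul]
        refine integral_congr_ae ?_
        filter_upwards [Lp.coeFn_smul c (v : LTwo d)] with x hx
        rw [Submodule.coe_smul, hx, Pi.smul_apply, smul_eq_mul]
        ring
      rw [h1, h2, map_smul, smul_eq_mul, smul_eq_mul]
      ring)

theorem preForm_apply (D : RegularDirichletForm d) (V : RSpace d → ℝ≥0) (u v : D.preDom V) :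
    D.preForm V u v = D.form ⟨u, u.2.1⟩ ⟨v, v.2.1⟩
      + ∫ x, (V x : ℝ) * ((u : LTwo d) x * (v : LTwo d) x) := rfl

theorem preForm_nonneg (D : RegularDirichletForm d) (V : RSpace d → ℝ≥0) (u : D.preDom V) :
    0 ≤ D.preForm V u u := by
  rw [preForm_apply]
  refine add_nonneg (D.nonneg _) (integral_nonneg fun x => ?_)
  exact mul_nonneg (NNReal.coe_nonneg _) (mul_self_nonneg _)

theorem preForm_add_le (D : RegularDirichletForm d) (V : RSpace d → ℝ≥0) (u v : D.preDom V) :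
    D.preForm V (u + v) (u + v) + ‖u + v‖ ^ 2
      ≤ 2 * (D.preForm V u u + ‖u‖ ^ 2) + 2 * (D.preForm V v v + ‖v‖ ^ 2) := by
  have h := D.preForm_nonneg V (u - v)
  have hn : ‖u + v‖ ^ 2 ≤ 2 * ‖u‖ ^ 2 + 2 * ‖v‖ ^ 2 := by
    have h1 := norm_add_le u v
    nlinarith [norm_nonneg (u + v), sq_nonneg (‖u‖ - ‖v‖), norm_nonneg u, norm_nonneg v]
  simp only [map_add, map_sub, LinearMap.add_apply, LinearMap.sub_apply] at h ⊢
  linarith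

/-- `𝒟(D^V)`: the closure of `C_c^2(ℝ^d)` for `D_1^V(u,u) = D(u,u) + ∫ u² V dx + ‖u‖²`. -/
def killedPreDom (D : RegularDirichletForm d) (V : RSpace d → ℝ≥0) :
    Submodule ℝ (D.preDom V) where
  carrier := {u | ∀ ε : ℝ, 0 < ε → ∃ g : D.preDom V, (g : LTwo d) ∈ ccClass d 2 ∧
    D.preForm V (u - g) (u - g) + ‖u - g‖ ^ 2 < ε}
  zero_mem' := by
    intro ε hε
    refine ⟨0, ⟨0, contDiff_const, HasCompactSupport.zero, ?_⟩, by simpa using hε⟩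
    simpa using Lp.coeFn_zero ℝ 2 (volume : Measure (RSpace d))
  add_mem' := by
    intro u v hu hv ε hε
    obtain ⟨g, ⟨f, hf1, hf2, hf3⟩, hg⟩ := hu (ε / 4) (by positivity)
    obtain ⟨g', ⟨f', hf1', hf2', hf3'⟩, hg'⟩ := hv (ε / 4) (by positivity)
    refine ⟨g + g', ⟨f + f', hf1.add hf1', hf2.add hf2', ?_⟩, ?_⟩
    · filter_upwards [Lp.coeFn_add (g : LTwo d) (g' : LTwo d), hf3, hf3'] with x h1 h2 h3
      rw [Submodule.coe_add, h1, Pi.add_apply, Pi.add_apply, h2, h3]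
    · have h := D.preForm_add_le V (u - g) (v - g')
      have e : u + v - (g + g') = u - g + (v - g') := by abel
      rw [e]
      linarith
  smul_mem' := by
    intro c u hu ε hε
    have hc : 0 < c ^ 2 + 1 := by positivity
    obtain ⟨g, ⟨f, hf1, hf2, hf3⟩, hg⟩ := hu (ε / (c ^ 2 + 1)) (by positivity)
    refine ⟨c • g, ⟨c • f, contDiff_const.smul hf1, hf2.smul_left (f := fun _ => c), ?_⟩, ?_⟩
    · filter_upwards [Lp.coeFn_smul c (g : LTwo d), hf3] with x h1 h2
      rw [Submodule.coe_smul, h1, Pi.smul_apply, Pi.smul_apply, h2]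
    · rw [← smul_sub, norm_smul, mul_pow, Real.norm_eq_abs, sq_abs]
      simp only [map_smul, LinearMap.smul_apply, smul_eq_mul]
      rw [lt_div_iff₀ hc] at hg
      have h0 := D.preForm_nonneg V (u - g)
      nlinarith [sq_nonneg ‖u - g‖]

/-- The form with killing `(D^V, 𝒟(D^V))`. -/
noncomputable def killed (D : RegularDirichletForm d) (V : RSpace d → ℝ≥0) : LTwoForm d where
  dom := (D.killedPreDom V).map (D.preDom V).subtype
  form := (D.preForm V).compl₁₂
    (Submodule.inclusion (Submodule.map_subtype_le _ _))
    (Submodule.inclusion (Submodule.map_subtype_le _ _))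

end RegularDirichletForm

/-- `(T_t)_{t ≥ 0}` is the strongly continuous symmetric contraction semigroup on `L²(ℝ^d, dx)`
associated with the form `E`: its infinitesimal generator is the operator `L` given by
`u ∈ 𝒟(L)`, `L u = w` iff `u ∈ 𝒟(E)` and `E(u, v) = -⟨w, v⟩` for all `v ∈ 𝒟(E)`.
Only the values `T t` with `t ≥ 0` matter. -/
structure IsSemigroupOf {d : ℕ} (E : LTwoForm d) (T : ℝ → LTwo d →L[ℝ] LTwo d) : Prop where
  zero : T 0 = ContinuousLinearMap.id ℝ (LTwo d)
  add : ∀ s t : ℝ, 0 ≤ s → 0 ≤ t → T (s + t) = (T s).comp (T t)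
  contraction : ∀ t : ℝ, 0 ≤ t → ‖T t‖ ≤ 1
  symm : ∀ t : ℝ, 0 ≤ t → ∀ u v : LTwo d, ⟪T t u, v⟫_ℝ = ⟪u, T t v⟫_ℝ
  continuous : ∀ u : LTwo d, Tendsto (fun t => T t u) (𝓝[>] 0) (𝓝 u)
  generator : ∀ u w : LTwo d,
    (∃ hu : u ∈ E.dom, ∀ v : E.dom, E.form ⟨u, hu⟩ v = -⟪w, (v : LTwo d)⟫_ℝ) ↔
      Tendsto (fun t : ℝ => t⁻¹ • (T t u - u)) (𝓝[>] 0) (𝓝 w)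

/-- `φ₁` is a bounded, continuous, strictly positive version of a normalized eigenfunction of the
semigroup for the first (smallest) eigenvalue `l₁`: `T_t φ₁ = e^{-l₁ t} φ₁`. -/
structure IsGroundState {d : ℕ} (T : ℝ → LTwo d →L[ℝ] LTwo d) (φ₁ : RSpace d → ℝ) (l₁ : ℝ) :
    Prop where
  bounded : ∃ M : ℝ, ∀ x, φ₁ x ≤ M
  continuous : Continuous φ₁
  pos : ∀ x, 0 < φ₁ x
  eigen : ∃ u : LTwo d, u =ᵐ[volume] φ₁ ∧ ‖u‖ = 1 ∧
    ∀ t : ℝ, 0 ≤ t → T t u = Real.exp (-l₁ * t) • u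
  first : ∀ (l : ℝ) (w : LTwo d), w ≠ 0 →
    (∀ t : ℝ, 0 ≤ t → T t w = Real.exp (-l * t) • w) → l₁ ≤ l

/-- Intrinsic ultracontractivity: for every `t > 0` the operator
`f ↦ (e^{l₁ t} / φ₁) T_t (φ₁ f)` is bounded from `L²(φ₁² dx)` to `L^∞(φ₁² dx)`.
(`f ∈ L²(φ₁² dx)` is written as `φ₁ f ∈ L²(dx)`.) -/
def IntrinsicallyUltracontractive {d : ℕ} (T : ℝ → LTwo d →L[ℝ] LTwo d) (φ₁ : RSpace d → ℝ)
    (l₁ : ℝ) : Prop :=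
  ∀ t : ℝ, 0 < t → ∃ C : ℝ≥0, ∀ (f : RSpace d → ℝ)
    (hf : MemLp (fun x => φ₁ x * f x) 2 volume),
    eLpNorm (fun x => Real.exp (l₁ * t) / φ₁ x * T t (hf.toLp (fun x => φ₁ x * f x)) x) ∞
        (volume.withDensity fun x => ENNReal.ofReal (φ₁ x ^ 2))
      ≤ C * eLpNorm f 2 (volume.withDensity fun x => ENNReal.ofReal (φ₁ x ^ 2))

/-- `Φ(R) = inf_{|x| ≥ R, V(x) > K} V(x)`. -/
noncomputable def potInf {d : ℕ} (V : RSpace d → ℝ≥0) (K R : ℝ) : ℝ :=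
  sInf ((fun x => (V x : ℝ)) '' {x | R ≤ ‖x‖ ∧ K < V x})

/-- `Θ(R) = |{x : |x| ≥ R, V(x) ≤ K}|`. -/
noncomputable def lowVol {d : ℕ} (V : RSpace d → ℝ≥0) (K R : ℝ) : ℝ :=
  (volume {x : RSpace d | R ≤ ‖x‖ ∧ (V x : ℝ) ≤ K}).toReal

/-- The inverse of `Φ` on `[r₀, ∞)`: `Φ⁻¹(t) = inf {R ≥ r₀ : Φ(R) ≥ t}`. -/
noncomputable def potInfInv {d : ℕ} (V : RSpace d → ℝ≥0) (K r₀ t : ℝ) : ℝ :=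
  sInf {R | r₀ ≤ R ∧ t ≤ potInf V K R}

/-- `β(s) = C₀² α(Φ⁻¹(2/s), s/2)`. -/
noncomputable def rateBeta {d : ℕ} (V : RSpace d → ℝ≥0) (K r₀ C₀ : ℝ) (α : ℝ → ℝ → ℝ)
    (s : ℝ) : ℝ :=
  C₀ ^ 2 * α (potInfInv V K r₀ (2 / s)) (s / 2)

/-- `γ(s) = Θ(Φ⁻¹(2/s))`. -/
noncomputable def rateGamma {d : ℕ} (V : RSpace d → ℝ≥0) (K r₀ s : ℝ) : ℝ :=
  lowVol V K (potInfInv V K r₀ (2 / s))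

/-- The exponent `(p-2)/p`, equal to `1` for `p = ∞`. -/
noncomputable def lpExponent (p : ℝ≥0∞) : ℝ :=
  if p = ∞ then 1 else (p.toReal - 2) / p.toReal

/-- `Ψ(R) = 1/Φ(R) + c₀ Θ(R)^{(p-2)/p}`. -/
noncomputable def psiFun {d : ℕ} (V : RSpace d → ℝ≥0) (K c₀ : ℝ) (p : ℝ≥0∞) (R : ℝ) : ℝ :=
  1 / potInf V K R + c₀ * lowVol V K R ^ lpExponent p

/-- The inverse of the decreasing function `Ψ` on `(1, ∞)`: `Ψ⁻¹(t) = inf {R > 1 : Ψ(R) ≤ t}`. -/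
noncomputable def psiInv {d : ℕ} (V : RSpace d → ℝ≥0) (K c₀ : ℝ) (p : ℝ≥0∞) (t : ℝ) : ℝ :=
  sInf {R | 1 < R ∧ psiFun V K c₀ p R ≤ t}

/-- `β̂(s) = 2 C₀² α(Ψ⁻¹(s/4), s/4)`. -/
noncomputable def rateBetaHat {d : ℕ} (V : RSpace d → ℝ≥0) (K C₀ c₀ : ℝ) (p : ℝ≥0∞)
    (α : ℝ → ℝ → ℝ) (s : ℝ) : ℝ :=
  2 * C₀ ^ 2 * α (psiInv V K c₀ p (s / 4)) (s / 4)

/-- `s_n = β⁻¹(c₁ δ^n / 2)` for a rate `β`, with `β⁻¹(y) = inf {s > 0 : β(s) ≤ y}`. -/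
noncomputable def levelSeq (β : ℝ → ℝ) (c₁ δ : ℝ) (n : ℕ) : ℝ :=
  sInf {s | 0 < s ∧ β s ≤ c₁ * δ ^ n / 2}

/-- `g⁻¹(y) = inf {s > 0 : g(s) ≥ y}` for an increasing function `g` on `(0, ∞)`. -/
noncomputable def incInv (g : ℝ → ℝ) (y : ℝ) : ℝ := sInf {s | 0 < s ∧ y ≤ g s}

/-- The integers `N` over which the infimum `n₀(s)` is taken. The second and third conditions say
`N ≥ log_δ (2 β(s₀) / c₁)` and `N ≥ - log_δ (4 δ γ(s₀))`, the latter being read as `N ≥ ∞` if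
`γ(s₀) = 0`; the third one also makes the infimum defining `γ⁻¹(1 / (4 δ^(N+1)))` one of a
nonempty set. -/
def levelSet (β γ : ℝ → ℝ) (c₁ δ s₀ s : ℝ) : Set ℕ :=
  {N | 1 ≤ N ∧ β s₀ ≤ c₁ * δ ^ N / 2 ∧ 1 / (4 * δ ^ (N + 1)) ≤ γ s₀ ∧
    4 * δ * (√δ + 1) * levelSeq β c₁ δ N / (√δ - 1) + 2 * incInv γ (1 / (4 * δ ^ (N + 1))) ≤ s}

open Classical in
/-- `β̃(s) = 2 β(γ⁻¹(1 / (4 δ^(n₀(s)+1))))` with `n₀(s)` the least element of `levelSet`;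
`β̃(s) = ∞` if there is none, i.e. if `n₀(s) = inf ∅ = ∞`. -/
noncomputable def rateBetaTilde (β γ : ℝ → ℝ) (c₁ δ s₀ s : ℝ) : ℝ≥0∞ :=
  if (levelSet β γ c₁ δ s₀ s).Nonempty then
    ENNReal.ofReal (2 * β (incInv γ (1 / (4 * δ ^ (sInf (levelSet β γ c₁ δ s₀ s) + 1)))))
  else ∞

/-- `b⁻¹(y) = inf {s > 0 : b(s) ≤ y}` for a (decreasing) rate function `b` on `(0, ∞)`,
with `inf ∅ = ∞`. -/
noncomputable def rateInv (b : ℝ → ℝ≥0∞) (y : ℝ≥0∞) : ℝ≥0∞ :=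
  ⨅ s ∈ {s : ℝ | 0 < s ∧ b s ≤ y}, ENNReal.ofReal s

/-- `∫_t^∞ b⁻¹(y) / y dy < ∞` for all `t > inf b`, where `b` is not identically `∞`. -/
def RateIntegrable (b : ℝ → ℝ≥0∞) : Prop :=
  (⨅ s ∈ Set.Ioi (0 : ℝ), b s) < ∞ ∧
  ∀ t : ℝ, (⨅ s ∈ Set.Ioi (0 : ℝ), b s) < ENNReal.ofReal t →
    ∫⁻ y in Set.Ioi t, rateInv b (ENNReal.ofReal y) / ENNReal.ofReal y < ∞

/-- The super Poincaré inequality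
`∫ f² dx ≤ s E(f,f) + b(s ∧ r) (∫ |f| φ₁ dx)²` for all `s > 0` and `f ∈ 𝒟(E)`. -/
def SuperPoincare {d : ℕ} (E : LTwoForm d) (φ₁ : RSpace d → ℝ) (b : ℝ → ℝ≥0∞) (r : ℝ) : Prop :=
  ∀ s : ℝ, 0 < s → ∀ f : E.dom,
    ENNReal.ofReal (∫ x, (f : LTwo d) x ^ 2)
      ≤ ENNReal.ofReal (s * E.form f f)
        + b (min s r) * ENNReal.ofReal ((∫ x, |(f : LTwo d) x| * φ₁ x) ^ 2)

/-!
The potential controls a function where `V` is large: by Chebyshev's inequality the mass of `f²` on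
`{V ≥ t}` is at most `D^V(f,f) / t`. Splitting `ℝ^d` into a ball, on which the local super Poincaré
inequality applies, the part of its complement where `V > K`, and the part where `V ≤ K`, one
obtains for every `s`
`‖f‖² ≤ s D^V(f,f) + β(s) (∫ |f| φ₁)² + ∫_L f²`,
where `L` is a set of volume `γ(s)` (`LocalSuperPoincare.norm_sq_le`). Hölder's inequality on `L`
gives the mixed inequality, and `L` is empty for small `s` if `V → ∞`.

If a Sobolev inequality holds, it bounds the mass of `f²` outside a ball by a small multiple of
`D^V(f,f) + ‖f‖²`, which is absorbed. The Sobolev inequality is only given on `C_c^∞`; that this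
class is dense in the domain for the form norm follows because mollifications of a `C_c^2` function
have bounded energy: for fixed `f` the energy norm of `k ∗ f` is a lower semicontinuous seminorm of
`k ∈ L¹`, hence continuous by Baire's theorem (`exists_convolution_bound`).

If instead `∑ γ(s_n) δ^n < ∞`, the inequality without tail term is shown, for all small `t` and with
`t`, `β(t)` replaced by their doubles, for a normalized nonnegative bounded `f`
(`LocalSuperPoincare.one_le_of_levels`). When `f` is cut at levels `A_0 < A_1 < …`, the piece
between `A_j` and `A_(j+1)` lives on a set of volume at most `A_j^(-2)`, so that its weighted mass is
negligible at the scale `s_n` with `δ^n` a constant factor below `A_j²`; its tail term, at most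
`γ(s_n) A_(j+1)²`, is negligible too, as `∑ γ(s_n) δ^n` has small tails. Thus the pieces are
controlled by `t` times their energy. The energies of the pieces add up to at most the energy of
`f`, because normal contractions operate on the form (`LTwoForm.exists_levels`). To lose only constants close to one, the levels are
far apart, and they are placed, by the pigeonhole principle, where `f²` has little mass. Finally, if
the inequality failed, the part of `f` above `A_0` would need more than the available energy. No
monotonicity or regularity of `β` enters; `γ` is monotone and right-continuous.

That normal contractions operate on `D^V` is inherited from `D`. For `D` it is derived from the unit
contraction: the pieces of `u` between the levels `k h` and `(k+1) h` have nonnegative mutual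
energies, so that multiplying them by slopes in `[-1,1]` does not increase the energy
(`RegularDirichletForm.form_compLp_le`).

A super Poincaré inequality with integrable rate gives intrinsic ultracontractivity as follows. The
semigroup is positivity preserving, as `|·|` operates on the form, and so `∫ |T_t u| φ₁` decreases in
`t`. Hence `‖T_t u‖²` decays exponentially at the rate `2 / s` towards `b(s) (∫ |u| φ₁)²`. Running
along the scales `b⁻¹(2^k y)`, which are summable, bounds `‖T_t u‖` by a multiple of `∫ |u| φ₁`, and
by duality `|T_t g| ≤ C ‖g‖ φ₁`.
-/

/-! ### Closed forms and weak limits -/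

namespace LTwoForm

variable {d : ℕ}

/-- A symmetric nonnegative form on `L²(ℝ^d, dx)` whose domain is complete for
`E_1(u,u) = E(u,u) + ‖u‖²`. -/
structure IsClosedForm (E : LTwoForm d) : Prop where
  symm : ∀ u v : E.dom, E.form u v = E.form v u
  nonneg : ∀ u : E.dom, 0 ≤ E.form u u
  closed : ∀ u : ℕ → E.dom,
    (∀ ε : ℝ, 0 < ε → ∃ N : ℕ, ∀ m n : ℕ, N ≤ m → N ≤ n →
      E.form (u m - u n) (u m - u n) + ‖(u m - u n : E.dom)‖ ^ 2 < ε) →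
    ∃ v : E.dom,
      Tendsto (fun n => E.form (u n - v) (u n - v) + ‖(u n - v : E.dom)‖ ^ 2) atTop (𝓝 0)

namespace IsClosedForm

theorem parallelogram {E : LTwoForm d} (u v : E.dom) :
    E.form (u + v) (u + v) + E.form (u - v) (u - v) = 2 * E.form u u + 2 * E.form v v := by
  simp only [map_add, map_sub, LinearMap.add_apply, LinearMap.sub_apply]
  ring

theorem form_neg_self {E : LTwoForm d} (u : E.dom) : E.form (-u) (-u) = E.form u u := by
  simp only [map_neg, LinearMap.neg_apply, neg_neg]

theorem form_smul_self {E : LTwoForm d} (c : ℝ) (u : E.dom) :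
    E.form (c • u) (c • u) = c ^ 2 * E.form u u := by
  simp only [map_smul, LinearMap.smul_apply, smul_eq_mul]
  ring

theorem form_add_self {E : LTwoForm d} (hE : E.IsClosedForm) (u v : E.dom) :
    E.form (u + v) (u + v) = E.form u u + 2 * E.form u v + E.form v v := by
  simp only [map_add, LinearMap.add_apply, hE.symm v u]
  ring

theorem form_sub_self {E : LTwoForm d} (hE : E.IsClosedForm) (u v : E.dom) :
    E.form (u - v) (u - v) = E.form u u - 2 * E.form u v + E.form v v := by
  simp only [map_sub, LinearMap.sub_apply, hE.symm v u]
  ring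

theorem sq_form_le {E : LTwoForm d} (hE : E.IsClosedForm) (u v : E.dom) :
    E.form u v ^ 2 ≤ E.form u u * E.form v v :=
  LinearMap.BilinForm.apply_sq_le_of_symm _ hE.nonneg ⟨fun x y => hE.symm x y⟩ u v

theorem sqrt_form_add_le {E : LTwoForm d} (hE : E.IsClosedForm) (u v : E.dom) :
    √(E.form (u + v) (u + v)) ≤ √(E.form u u) + √(E.form v v) := by
  refine Real.sqrt_le_iff.2 ⟨by positivity, ?_⟩
  have h1 := Real.sq_sqrt (hE.nonneg u)
  have h2 := Real.sq_sqrt (hE.nonneg v)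
  have h3 : E.form u v ≤ √(E.form u u) * √(E.form v v) := by
    rw [← Real.sqrt_mul (hE.nonneg u)]
    exact Real.le_sqrt_of_sq_le (hE.sq_form_le u v)
  rw [hE.form_add_self]
  nlinarith

/-- Bounded sets of a closed form are weakly compact, in the following sense: if `u` is an `L²`
limit of elements of a midpoint-convex set `S` with energy at most `C`, then `u` lies in the domain,
its energy is at most `C`, and `u` is the limit of elements of `S` for the form norm.
Near-minimizers of the energy over the shrinking sets `{v ∈ S | ‖v - u‖ < ε}` form a Cauchy
sequence, by the parallelogram identity. -/
theorem mem_dom_of_bounded {E : LTwoForm d} (hE : E.IsClosedForm) (S : Set E.dom)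
    (hS : ∀ v ∈ S, ∀ w ∈ S, (2⁻¹ : ℝ) • (v + w) ∈ S) (u : LTwo d) (C : ℝ)
    (h : ∀ ε : ℝ, 0 < ε → ∃ v ∈ S, E.form v v ≤ C ∧ ‖(v : LTwo d) - u‖ < ε) :
    ∃ hu : u ∈ E.dom, E.form ⟨u, hu⟩ ⟨u, hu⟩ ≤ C ∧
      ∀ ε : ℝ, 0 < ε → ∃ v ∈ S,
        E.form (⟨u, hu⟩ - v) (⟨u, hu⟩ - v) + ‖(⟨u, hu⟩ - v : E.dom)‖ ^ 2 < ε := by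
  classical
  let A : ℕ → Set E.dom := fun n => {v | v ∈ S ∧ ‖(v : LTwo d) - u‖ < 1 / ((n : ℝ) + 1)}
  have hpos : ∀ n : ℕ, (0 : ℝ) < 1 / ((n : ℝ) + 1) := fun n => by positivity
  have hanti : ∀ m n : ℕ, m ≤ n → A n ⊆ A m := by
    intro m n hmn v hv
    refine ⟨hv.1, hv.2.trans_le ?_⟩
    exact one_div_le_one_div_of_le (by positivity) (by gcongr)
  let a : ℕ → ℝ := fun n => sInf ((fun v : E.dom => E.form v v) '' A n)
  have hbdd : ∀ n, BddBelow ((fun v : E.dom => E.form v v) '' A n) := fun n =>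
    ⟨0, by rintro _ ⟨v, -, rfl⟩; exact hE.nonneg v⟩
  have hne : ∀ n, ((fun v : E.dom => E.form v v) '' A n).Nonempty := fun n => by
    obtain ⟨v, hv, -, hv2⟩ := h _ (hpos n)
    exact ⟨_, v, ⟨hv, hv2⟩, rfl⟩
  have haC : ∀ n, a n ≤ C := fun n => by
    obtain ⟨v, hv, hv1, hv2⟩ := h _ (hpos n)
    exact (csInf_le (hbdd n) ⟨v, ⟨hv, hv2⟩, rfl⟩).trans hv1
  have hmono : Monotone a := fun m n hmn =>
    csInf_le_csInf (hbdd m) (hne n) (Set.image_mono (hanti m n hmn))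
  have hlim : Tendsto a atTop (𝓝 (⨆ n, a n)) :=
    tendsto_atTop_ciSup hmono ⟨C, by rintro _ ⟨n, rfl⟩; exact haC n⟩
  have hsup : ∀ n, a n ≤ ⨆ n, a n := fun n =>
    le_ciSup (f := a) ⟨C, by rintro _ ⟨n, rfl⟩; exact haC n⟩ n
  have hex : ∀ n, ∃ v ∈ A n, E.form v v < a n + 1 / ((n : ℝ) + 1) := fun n => by
    obtain ⟨_, ⟨v, hv, rfl⟩, hv'⟩ := exists_lt_of_csInf_lt (hne n)
      (show a n < a n + 1 / ((n : ℝ) + 1) by linarith [hpos n])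
    exact ⟨v, hv, hv'⟩
  choose v hvA hvE using hex
  have hinv : Tendsto (fun n : ℕ => 1 / ((n : ℝ) + 1)) atTop (𝓝 0) :=
    tendsto_one_div_add_atTop_nhds_zero_nat
  -- the parallelogram identity makes the near-minimizers a Cauchy sequence
  have hcauchy : ∀ N m n : ℕ, N ≤ m → N ≤ n →
      E.form (v m - v n) (v m - v n) + ‖(v m - v n : E.dom)‖ ^ 2
        ≤ 4 * ((⨆ n, a n) - a N) + 4 * (1 / ((N : ℝ) + 1)) + (2 * (1 / ((N : ℝ) + 1))) ^ 2 := by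
    intro N m n hm hn
    have hmid : (2⁻¹ : ℝ) • (v m + v n) ∈ A N := by
      have h1 := hanti N m hm (hvA m)
      have h2 := hanti N n hn (hvA n)
      refine ⟨hS _ h1.1 _ h2.1, ?_⟩
      have e : ((2⁻¹ : ℝ) • (v m + v n) : E.dom) - u
          = (2⁻¹ : ℝ) • (((v m : LTwo d) - u) + ((v n : LTwo d) - u)) := by
        rw [Submodule.coe_smul, Submodule.coe_add]
        module
      rw [e, norm_smul, Real.norm_eq_abs, abs_of_pos (by norm_num : (0 : ℝ) < 2⁻¹)]
      have := norm_add_le ((v m : LTwo d) - u) ((v n : LTwo d) - u)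
      linarith [h1.2, h2.2]
    have h1 : a N ≤ E.form ((2⁻¹ : ℝ) • (v m + v n)) ((2⁻¹ : ℝ) • (v m + v n)) :=
      csInf_le (hbdd N) ⟨_, hmid, rfl⟩
    rw [form_smul_self] at h1
    have h2 := parallelogram (v m) (v n)
    have hm' : 1 / ((m : ℝ) + 1) ≤ 1 / ((N : ℝ) + 1) :=
      one_div_le_one_div_of_le (by positivity) (by gcongr)
    have hn' : 1 / ((n : ℝ) + 1) ≤ 1 / ((N : ℝ) + 1) :=
      one_div_le_one_div_of_le (by positivity) (by gcongr)
    have h3 : ‖(v m - v n : E.dom)‖ ≤ 2 * (1 / ((N : ℝ) + 1)) := by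
      have e : ((v m - v n : E.dom) : LTwo d) = ((v m : LTwo d) - u) - ((v n : LTwo d) - u) := by
        rw [Submodule.coe_sub]; abel
      rw [Submodule.coe_norm, e]
      have := norm_sub_le ((v m : LTwo d) - u) ((v n : LTwo d) - u)
      linarith [(hvA m).2, (hvA n).2]
    have h4 := pow_le_pow_left₀ (norm_nonneg _) h3 2
    have := hvE m
    have := hvE n
    have := hsup m
    have := hsup n
    linarith
  have hbound : Tendsto (fun N : ℕ => 4 * ((⨆ n, a n) - a N) + 4 * (1 / ((N : ℝ) + 1))
      + (2 * (1 / ((N : ℝ) + 1))) ^ 2) atTop (𝓝 0) := by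
    have := (((hlim.const_sub (⨆ n, a n)).const_mul 4).add (hinv.const_mul 4)).add
      ((hinv.const_mul 2).pow 2)
    simpa using this
  obtain ⟨w, hw⟩ := hE.closed v (fun ε hε => by
    obtain ⟨N, hN⟩ := (hbound.eventually (gt_mem_nhds hε)).exists
    exact ⟨N, fun m n hm hn => (hcauchy N m n hm hn).trans_lt hN⟩)
  have hwn : Tendsto (fun n => ‖(v n - w : E.dom)‖ ^ 2) atTop (𝓝 0) :=
    squeeze_zero (fun n => by positivity) (fun n => by linarith [hE.nonneg (v n - w)]) hw
  have hwq : Tendsto (fun n => E.form (v n - w) (v n - w)) atTop (𝓝 0) :=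
    squeeze_zero (fun n => hE.nonneg _)
      (fun n => by linarith [sq_nonneg ‖(v n - w : E.dom)‖]) hw
  have hvw : Tendsto (fun n => (v n : LTwo d)) atTop (𝓝 (w : LTwo d)) := by
    rw [tendsto_iff_norm_sub_tendsto_zero]
    have := hwn.sqrt
    simpa [Real.sqrt_sq (norm_nonneg _), Submodule.coe_norm] using this
  have hvu : Tendsto (fun n => (v n : LTwo d)) atTop (𝓝 u) := by
    rw [tendsto_iff_norm_sub_tendsto_zero]
    exact squeeze_zero (fun n => norm_nonneg _) (fun n => (hvA n).2.le) hinv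
  have hwu : (w : LTwo d) = u := tendsto_nhds_unique hvw hvu
  subst hwu
  refine ⟨w.2, ?_, fun ε hε => ?_⟩
  · have h1 : ∀ n : ℕ, √(E.form w w) ≤ √(C + 1 / ((n : ℝ) + 1)) + √(E.form (v n - w) (v n - w)) := by
      intro n
      have e : w = v n + (w - v n) := by abel
      have e2 : E.form (w - v n) (w - v n) = E.form (v n - w) (v n - w) := by
        rw [← neg_sub (v n) w, form_neg_self]
      calc √(E.form w w) = √(E.form (v n + (w - v n)) (v n + (w - v n))) := by rw [← e]
        _ ≤ _ := hE.sqrt_form_add_le _ _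
        _ ≤ _ := by
          rw [e2]
          gcongr
          linarith [hvE n, haC n]
    have h2 : Tendsto (fun n : ℕ => √(C + 1 / ((n : ℝ) + 1)) + √(E.form (v n - w) (v n - w)))
        atTop (𝓝 (√(C + 0) + √0)) := (hinv.const_add C).sqrt.add hwq.sqrt
    have h3 := ge_of_tendsto' h2 h1
    have hC : 0 ≤ C := by
      obtain ⟨v, -, hv, -⟩ := h 1 one_pos
      exact (hE.nonneg v).trans hv
    rw [Real.sqrt_zero, add_zero, add_zero] at h3
    exact (Real.sqrt_le_sqrt_iff hC).1 h3
  · obtain ⟨n, hn⟩ := (hw.eventually (gt_mem_nhds hε)).exists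
    refine ⟨v n, (hvA n).1, ?_⟩
    have e : (⟨(w : LTwo d), w.2⟩ : E.dom) - v n = -(v n - w) := by
      rw [neg_sub]
    rw [e, form_neg_self, norm_neg]
    exact hn

/-- Lower semicontinuity of a closed form along `L²`-convergent sequences. -/
theorem mem_dom_of_tendsto {E : LTwoForm d} (hE : E.IsClosedForm) (u : ℕ → E.dom) (w : LTwo d)
    (C : ℝ) (hC : ∀ n, E.form (u n) (u n) ≤ C)
    (h : Tendsto (fun n => (u n : LTwo d)) atTop (𝓝 w)) :
    ∃ hw : w ∈ E.dom, E.form ⟨w, hw⟩ ⟨w, hw⟩ ≤ C := by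
  obtain ⟨hw, h1, -⟩ := hE.mem_dom_of_bounded Set.univ (fun _ _ _ _ => Set.mem_univ _) w C
    (fun ε hε => by
      obtain ⟨n, hn⟩ := (h.eventually (Metric.ball_mem_nhds w hε)).exists
      exact ⟨u n, Set.mem_univ _, hC n, by rwa [← dist_eq_norm]⟩)
  exact ⟨hw, h1⟩

end IsClosedForm
end LTwoForm

/-! ### Square integrable functions -/

namespace LTwo

variable {d : ℕ}

theorem memLp (u : LTwo d) : MemLp (fun x => u x) 2 volume := Lp.memLp u

theorem integrable_sq (u : LTwo d) : Integrable (fun x => u x ^ 2) volume :=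
  (memLp u).integrable_sq

theorem integrable_mul (u v : LTwo d) : Integrable (fun x => u x * v x) volume :=
  (memLp u).integrable_mul (memLp v)

theorem inner_eq_integral (u v : LTwo d) : ⟪u, v⟫_ℝ = ∫ x, u x * v x := by
  rw [L2.inner_def]
  refine integral_congr_ae (ae_of_all _ fun x => ?_)
  simp [mul_comm]

theorem norm_sq_eq_integral (u : LTwo d) : ‖u‖ ^ 2 = ∫ x, u x ^ 2 := by
  rw [← real_inner_self_eq_norm_sq, inner_eq_integral]
  simp only [sq]

theorem tendsto_of_dominated (u : ℕ → LTwo d) (w g : LTwo d)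
    (hb : ∀ n, ∀ᵐ x, |u n x| ≤ |g x|)
    (h : ∀ᵐ x, Tendsto (fun n => u n x) atTop (𝓝 (w x))) :
    Tendsto u atTop (𝓝 w) := by
  rw [tendsto_iff_norm_sub_tendsto_zero]
  have hwg : ∀ᵐ x, |w x| ≤ |g x| := by
    filter_upwards [h, ae_all_iff.2 hb] with x hx hbx
    exact le_of_tendsto' hx.abs hbx
  have h1 : Tendsto (fun n => ∫ x, (u n x - w x) ^ 2) atTop (𝓝 (∫ _ : RSpace d, (0 : ℝ))) := by
    refine tendsto_integral_of_dominated_convergence (fun x => 4 * g x ^ 2) (fun n => ?_)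
      ((integrable_sq g).const_mul 4) (fun n => ?_) ?_
    · exact (((memLp (u n)).sub (memLp w)).integrable_sq).aestronglyMeasurable
    · filter_upwards [hb n, hwg] with x hx hx'
      rw [Real.norm_eq_abs, abs_of_nonneg (sq_nonneg _), ← sq_abs (g x), ← sq_abs (_ - _)]
      have := abs_sub (u n x) (w x)
      nlinarith [abs_nonneg (u n x - w x), abs_nonneg (g x)]
    · filter_upwards [h] with x hx
      have := (hx.sub_const (w x)).pow 2
      simpa using this
  have h2 : ∀ n, ‖u n - w‖ ^ 2 = ∫ x, (u n x - w x) ^ 2 := by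
    intro n
    rw [norm_sq_eq_integral]
    refine integral_congr_ae ?_
    filter_upwards [Lp.coeFn_sub (u n) w] with x hx
    rw [hx, Pi.sub_apply]
  have h3 := h1.sqrt
  simp only [← h2, Real.sqrt_sq (norm_nonneg _), integral_zero, Real.sqrt_zero] at h3
  exact h3

end LTwo

/-! ### Normal contractions operate on a Dirichlet form -/

/-- The truncation `(0 ∨ t) ∧ b` (for `b ≥ 0`). -/
def clampTo (b t : ℝ) : ℝ := max 0 (min b t)

theorem clampTo_of_nonpos {b t : ℝ} (ht : t ≤ 0) : clampTo b t = 0 :=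
  max_eq_left ((min_le_right _ _).trans ht)

theorem clampTo_of_le {b t : ℝ} (ht : 0 ≤ t) (h : t ≤ b) : clampTo b t = t := by
  rw [clampTo, min_eq_right h, max_eq_right ht]

theorem clampTo_of_ge {b t : ℝ} (hb : 0 ≤ b) (h : b ≤ t) : clampTo b t = b := by
  rw [clampTo, min_eq_left h, max_eq_right hb]

/-- The value at `t` of the piecewise linear interpolation of `ψ` (vanishing at `0`) at the nodes
`0, h, …, M h`, constant beyond `M h` and on the negative half-line. -/
noncomputable def interpolant (ψ : ℝ → ℝ) (h : ℝ) (M : ℕ) (t : ℝ) : ℝ :=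
  ∑ k ∈ Finset.range M, (ψ ((k + 1) * h) - ψ (k * h)) / h *
    (clampTo ((k + 1) * h) t - clampTo (k * h) t)

theorem interpolant_of_nonpos (ψ : ℝ → ℝ) (h : ℝ) (M : ℕ) {t : ℝ} (ht : t ≤ 0) :
    interpolant ψ h M t = 0 :=
  Finset.sum_eq_zero fun k _ => by rw [clampTo_of_nonpos ht, clampTo_of_nonpos ht]; simp

theorem abs_slope_le_one {ψ : ℝ → ℝ} (hψ : LipschitzWith 1 ψ) {h : ℝ} (hh : 0 < h) (s : ℝ) :
    |(ψ (s + h) - ψ s) / h| ≤ 1 := by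
  have := hψ.dist_le_mul (s + h) s
  rw [Real.dist_eq, Real.dist_eq, NNReal.coe_one, one_mul, add_sub_cancel_left,
    abs_of_pos hh] at this
  rw [abs_div, abs_of_pos hh, div_le_one hh]
  exact this

theorem clampTo_sub_nonneg {a b t : ℝ} (hab : a ≤ b) : 0 ≤ clampTo b t - clampTo a t :=
  sub_nonneg.2 (max_le_max le_rfl (min_le_min hab le_rfl))

theorem abs_interpolant_le {ψ : ℝ → ℝ} (hψ : LipschitzWith 1 ψ) {h : ℝ} (hh : 0 < h) (M : ℕ)
    {t : ℝ} (ht : 0 ≤ t) : |interpolant ψ h M t| ≤ t := by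
  calc |interpolant ψ h M t| ≤ ∑ k ∈ Finset.range M,
        (clampTo (((k + 1 : ℕ) : ℝ) * h) t - clampTo ((k : ℝ) * h) t) := by
        refine (Finset.abs_sum_le_sum_abs _ _).trans (Finset.sum_le_sum fun k _ => ?_)
        have h1 := abs_slope_le_one hψ hh (k * h)
        have h2 := clampTo_sub_nonneg (a := k * h) (b := (k + 1) * h) (t := t) (by linarith)
        rw [show (k : ℝ) * h + h = (k + 1) * h by ring] at h1
        rw [abs_mul, abs_of_nonneg h2, Nat.cast_succ]
        nlinarith
    _ = clampTo (M * h) t - clampTo (((0 : ℕ) : ℝ) * h) t :=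
        Finset.sum_range_sub (fun k : ℕ => clampTo (k * h) t) M
    _ ≤ t := by
        have h1 : clampTo (M * h) t ≤ t := max_le ht (min_le_right _ _)
        have h2 : 0 ≤ clampTo (((0 : ℕ) : ℝ) * h) t := le_max_left _ _
        linarith

theorem abs_interpolant_sub_le {ψ : ℝ → ℝ} (hψ : LipschitzWith 1 ψ) (h0 : ψ 0 = 0) {h : ℝ}
    (hh : 0 < h) {t : ℝ} (ht : 0 ≤ t) (M : ℕ) :
    (M * h ≤ t → interpolant ψ h M t = ψ (M * h)) ∧
      (t ≤ M * h → |interpolant ψ h M t - ψ t| ≤ 2 * h) := by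
  induction M with
  | zero =>
    refine ⟨fun _ => by simp [interpolant, h0], fun ht' => ?_⟩
    have : t = 0 := le_antisymm (by simpa using ht') ht
    subst this
    simp [interpolant, h0, hh.le]
  | succ M ih =>
    have e : interpolant ψ h (M + 1) t = interpolant ψ h M t + (ψ ((M + 1) * h) - ψ (M * h)) / h *
        (clampTo ((M + 1) * h) t - clampTo (M * h) t) := Finset.sum_range_succ _ _
    have hM : 0 ≤ (M : ℝ) * h := by positivity
    have hM1 : 0 ≤ ((M : ℝ) + 1) * h := by positivity
    have hle : (M : ℝ) * h ≤ (M + 1) * h := by linarith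
    push_cast
    refine ⟨fun h1 => ?_, fun h1 => ?_⟩
    · rw [e, ih.1 (hle.trans h1), clampTo_of_ge hM1 h1, clampTo_of_ge hM (hle.trans h1)]
      field_simp
      ring
    · rcases le_total t (M * h) with h2 | h2
      · rw [e, clampTo_of_le ht h1, clampTo_of_le ht h2]
        simpa using ih.2 h2
      · rw [e, ih.1 h2, clampTo_of_le ht h1, clampTo_of_ge hM h2]
        have h3 := abs_slope_le_one hψ hh (M * h)
        rw [show (M : ℝ) * h + h = (M + 1) * h by ring] at h3
        have h4 := hψ.dist_le_mul (M * h) t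
        rw [Real.dist_eq, Real.dist_eq, NNReal.coe_one, one_mul, abs_sub_comm (_ * _),
          abs_of_nonneg (sub_nonneg.2 h2)] at h4
        have h5 : |(ψ ((M + 1) * h) - ψ (M * h)) / h * (t - M * h)| ≤ h := by
          rw [abs_mul, abs_of_nonneg (sub_nonneg.2 h2)]
          nlinarith [abs_nonneg ((ψ ((M + 1) * h) - ψ (M * h)) / h)]
        have h6 := abs_add_le (ψ (M * h) - ψ t) ((ψ ((M + 1) * h) - ψ (M * h)) / h * (t - M * h))
        rw [show ψ (M * h) + (ψ ((M + 1) * h) - ψ (M * h)) / h * (t - M * h) - ψ t =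
          ψ (M * h) - ψ t + (ψ ((M + 1) * h) - ψ (M * h)) / h * (t - M * h) by ring]
        linarith

theorem tendsto_interpolant {ψ : ℝ → ℝ} (hψ : LipschitzWith 1 ψ) (h0 : ψ 0 = 0) {t : ℝ}
    (ht : 0 ≤ t) :
    Tendsto (fun n : ℕ => interpolant ψ (1 / ((n : ℝ) + 1)) ((n + 1) ^ 2) t) atTop (𝓝 (ψ t)) := by
  rw [tendsto_iff_norm_sub_tendsto_zero]
  have h1 : Tendsto (fun n : ℕ => 2 * (1 / ((n : ℝ) + 1))) atTop (𝓝 0) := by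
    simpa using (tendsto_one_div_add_atTop_nhds_zero_nat (𝕜 := ℝ)).const_mul 2
  refine squeeze_zero' (Eventually.of_forall fun n => norm_nonneg _) ?_ h1
  obtain ⟨N, hN⟩ := exists_nat_ge t
  filter_upwards [eventually_ge_atTop N] with n hn
  refine (abs_interpolant_sub_le hψ h0 (by positivity) ht ((n + 1) ^ 2)).2 ?_
  have : (N : ℝ) ≤ n := by exact_mod_cast hn
  push_cast
  rw [mul_one_div, le_div_iff₀ (by positivity)]
  nlinarith

/-- For pieces with nonnegative mutual energies the energy of a sum does not increase if the pieces
are multiplied by coefficients in `[-1, 1]`. -/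
theorem LTwoForm.form_sum_le {d : ℕ} {E : LTwoForm d} {ι : Type*} [Fintype ι] (e : ι → E.dom)
    (a : ι → ℝ) (ha : ∀ i, |a i| ≤ 1) (h : ∀ i j, 0 ≤ E.form (e i) (e j)) :
    E.form (∑ i, a i • e i) (∑ i, a i • e i) ≤ E.form (∑ i, e i) (∑ i, e i) := by
  simp only [map_sum, LinearMap.sum_apply, map_smul, LinearMap.smul_apply, smul_eq_mul,
    Finset.mul_sum]
  refine Finset.sum_le_sum fun i _ => Finset.sum_le_sum fun j _ => ?_
  have h1 : a i * a j ≤ 1 := by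
    refine (le_abs_self _).trans ?_
    rw [abs_mul]
    exact mul_le_one₀ (ha i) (abs_nonneg _) (ha j)
  nlinarith [h i j, h j i]

namespace RegularDirichletForm

variable {d : ℕ}

theorem isClosedForm (D : RegularDirichletForm d) : D.toLTwoForm.IsClosedForm :=
  ⟨D.symm, D.nonneg, D.closed⟩

theorem exists_clampTo (D : RegularDirichletForm d) {b : ℝ} (hb : 0 ≤ b) (u : D.dom) :
    ∃ v : D.dom, ((v : LTwo d) =ᵐ[volume] fun x => clampTo b ((u : LTwo d) x)) ∧
      D.form v v ≤ D.form u u := by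
  rcases hb.eq_or_lt with rfl | hb
  · refine ⟨0, ?_, by simpa using D.nonneg u⟩
    filter_upwards [Lp.coeFn_zero ℝ 2 (volume : Measure (RSpace d))] with x hx
    rw [Submodule.coe_zero, hx, Pi.zero_apply, clampTo, max_eq_left (min_le_left _ _)]
  · obtain ⟨v, hv, hv'⟩ := D.markov (b⁻¹ • u)
    refine ⟨b • v, ?_, ?_⟩
    · filter_upwards [hv, Lp.coeFn_smul b (v : LTwo d), Lp.coeFn_smul b⁻¹ (u : LTwo d)]
        with x h1 h2 h3
      rw [Submodule.coe_smul] at h1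
      rw [Submodule.coe_smul, h2, Pi.smul_apply, h1, h3, Pi.smul_apply, smul_eq_mul, smul_eq_mul,
        clampTo, mul_max_of_nonneg _ _ hb.le, mul_min_of_nonneg _ _ hb.le, mul_zero, mul_one,
        mul_inv_cancel_left₀ hb.ne']
    · rw [LTwoForm.IsClosedForm.form_smul_self] at hv' ⊢
      have : b ^ 2 * D.form v v ≤ b ^ 2 * (b⁻¹ ^ 2 * D.form u u) := by gcongr
      refine this.trans_eq ?_
      field_simp

/-- If the truncation `(0 ∨ ·) ∧ b` maps all `p + ε q` to `p`, then `D(p, q) ≥ 0`: the energy of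
`p + ε q` has its minimum over `ε ≥ 0` at `ε = 0`. -/
theorem form_nonneg_of_clampTo (D : RegularDirichletForm d) (p q : D.dom) {b : ℝ} (hb : 0 ≤ b)
    (h : ∀ᵐ x, 0 ≤ (p : LTwo d) x ∧ (p : LTwo d) x ≤ b ∧
      (0 < (q : LTwo d) x → (p : LTwo d) x = b) ∧ ((q : LTwo d) x < 0 → (p : LTwo d) x = 0)) :
    0 ≤ D.form p q := by
  have key : ∀ ε : ℝ, 0 < ε → 0 ≤ 2 * D.form p q + ε * D.form q q := by
    intro ε hε
    obtain ⟨v, hv, hv'⟩ := D.exists_clampTo hb (p + ε • q)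
    have hvp : v = p := by
      refine Subtype.ext (Lp.ext ?_)
      filter_upwards [hv, h, Lp.coeFn_add (p : LTwo d) (ε • (q : LTwo d)),
        Lp.coeFn_smul ε (q : LTwo d)] with x h1 h2 h3 h4
      rw [h1, Submodule.coe_add, Submodule.coe_smul, h3, Pi.add_apply, h4, Pi.smul_apply,
        smul_eq_mul]
      rcases lt_trichotomy ((q : LTwo d) x) 0 with hq | hq | hq
      · rw [h2.2.2.2 hq, clampTo_of_nonpos (by nlinarith)]
      · rw [hq, mul_zero, add_zero, clampTo_of_le h2.1 h2.2.1]
      · rw [h2.2.2.1 hq, clampTo_of_ge hb (by nlinarith)]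
    rw [hvp, D.isClosedForm.form_add_self, LTwoForm.IsClosedForm.form_smul_self, map_smul,
      smul_eq_mul] at hv'
    by_contra hneg
    nlinarith
  by_contra! hneg
  have hq := D.nonneg q
  have h1 := key (-D.form p q / (D.form q q + 1)) (by apply div_pos <;> linarith)
  have h2 : -D.form p q / (D.form q q + 1) * D.form q q ≤ -D.form p q := by
    rw [div_mul_eq_mul_div, div_le_iff₀ (by linarith)]
    nlinarith
  linarith

end RegularDirichletForm

theorem clampTo_sub_le {a b t : ℝ} (ha : 0 ≤ a) (hab : a ≤ b) :
    clampTo b t - clampTo a t ≤ b - a := by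
  rcases le_total t a with h | h
  · rcases le_total t 0 with h' | h'
    · rw [clampTo_of_nonpos h', clampTo_of_nonpos h']; linarith
    · rw [clampTo_of_le h' (h.trans hab), clampTo_of_le h' h]; linarith
  · rw [clampTo_of_ge ha h]
    have : clampTo b t ≤ b := max_le (ha.trans hab) (min_le_left _ _)
    linarith

theorem clampTo_sub_eq_zero {a b t : ℝ} (hab : a ≤ b) (h : t ≤ a) :
    clampTo b t - clampTo a t = 0 := by
  rcases le_total t 0 with h' | h'
  · rw [clampTo_of_nonpos h', clampTo_of_nonpos h', sub_zero]
  · rw [clampTo_of_le h' (h.trans hab), clampTo_of_le h' h, sub_self]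

namespace RegularDirichletForm

variable {d : ℕ}

/-- The pieces into which a function is cut at the levels `0, ±h, …, ±M h`: on the index `none`
sits the part beyond `±M h`. -/
noncomputable def levelPiece (h : ℝ) (M : ℕ) : Option (Bool × Fin M) → ℝ → ℝ
  | none, t => t - clampTo (M * h) t + clampTo (M * h) (-t)
  | some (true, k), t => clampTo ((k + 1) * h) t - clampTo (k * h) t
  | some (false, k), t => -(clampTo ((k + 1) * h) (-t) - clampTo (k * h) (-t))

/-- A function in the domain is a sum of level pieces in the domain, any two of which have a
nonnegative mutual energy. -/
theorem exists_levelPiece (D : RegularDirichletForm d) (u : D.dom) {h : ℝ} (hh : 0 < h) (M : ℕ) :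
    ∃ e : Option (Bool × Fin M) → D.dom,
      (∀ i, (e i : LTwo d) =ᵐ[volume] fun x => levelPiece h M i ((u : LTwo d) x)) ∧
      ∀ i j, 0 ≤ D.form (e i) (e j) := by
  have H : ∀ b : ℝ, 0 ≤ b → ∀ w : D.dom, ∃ v : D.dom,
      (v : LTwo d) =ᵐ[volume] fun x => clampTo b ((w : LTwo d) x) := fun b hb w =>
    (D.exists_clampTo hb w).imp fun _ hv => hv.1
  choose! c hc using H
  have hM : 0 ≤ (M : ℝ) * h := by positivity
  have hk : ∀ k : ℕ, 0 ≤ (k : ℝ) * h := fun k => by positivity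
  have hk1 : ∀ k : ℕ, 0 ≤ ((k : ℝ) + 1) * h := fun k => by positivity
  have hkk : ∀ k : ℕ, (k : ℝ) * h ≤ ((k : ℝ) + 1) * h := fun k => by linarith
  have hkM : ∀ k : Fin M, ((k : ℝ) + 1) * h ≤ M * h := fun k => by
    have : ((k : ℕ) : ℝ) + 1 ≤ M := by exact_mod_cast k.2
    gcongr
  have hkl : ∀ k l : Fin M, k < l → ((k : ℝ) + 1) * h ≤ l * h := fun k l hkl => by
    have : ((k : ℕ) : ℝ) + 1 ≤ (l : ℕ) := by exact_mod_cast hkl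
    gcongr
  let p : D.dom → Fin M → D.dom := fun w k => c ((k + 1) * h) w - c (k * h) w
  have hp : ∀ w k, (p w k : LTwo d) =ᵐ[volume] fun x =>
      clampTo ((k + 1) * h) ((w : LTwo d) x) - clampTo (k * h) ((w : LTwo d) x) := by
    intro w k
    filter_upwards [hc _ (hk1 k) w, hc _ (hk k) w,
      Lp.coeFn_sub (c ((k + 1) * h) w : LTwo d) (c (k * h) w : LTwo d)] with x h1 h2 h3
    rw [Submodule.coe_sub, h3, Pi.sub_apply, h1, h2]
  let r : D.dom := u - c (M * h) u + c (M * h) (-u)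
  have hneg : ((-u : D.dom) : LTwo d) =ᵐ[volume] fun x => -((u : LTwo d) x) := by
    filter_upwards [Lp.coeFn_neg (u : LTwo d)] with x hx
    rw [Submodule.coe_neg, hx, Pi.neg_apply]
  have hr : (r : LTwo d) =ᵐ[volume] fun x => (u : LTwo d) x - clampTo (M * h) ((u : LTwo d) x) +
      clampTo (M * h) (-(u : LTwo d) x) := by
    filter_upwards [hc _ hM u, hc _ hM (-u), hneg,
      Lp.coeFn_sub (u : LTwo d) (c (M * h) u : LTwo d),
      Lp.coeFn_add ((u : LTwo d) - (c (M * h) u : LTwo d)) (c (M * h) (-u) : LTwo d)]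
      with x h1 h2 h3 h4 h5
    rw [Submodule.coe_add, Submodule.coe_sub, h5, Pi.add_apply, h4, Pi.sub_apply, h1, h2, h3]
  have hnonneg : ∀ (w : D.dom) (k : Fin M) (q : D.dom),
      (∀ᵐ x, (0 < (q : LTwo d) x → (k + 1) * h ≤ (w : LTwo d) x) ∧
        ((q : LTwo d) x < 0 → (w : LTwo d) x ≤ 0)) → 0 ≤ D.form (p w k) q := by
    intro w k q hq
    refine D.form_nonneg_of_clampTo _ _ hh.le ?_
    filter_upwards [hq, hp w k] with x h1 h2
    rw [h2]
    refine ⟨clampTo_sub_nonneg (hkk k), ?_, fun h3 => ?_, fun h3 => ?_⟩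
    · exact (clampTo_sub_le (hk k) (hkk k)).trans_eq (by ring)
    · rw [clampTo_of_ge (hk1 k) (h1.1 h3), clampTo_of_ge (hk k) ((hkk k).trans (h1.1 h3))]
      ring
    · rw [clampTo_of_nonpos (h1.2 h3), clampTo_of_nonpos (h1.2 h3), sub_zero]
  have hpp : ∀ (w : D.dom) (k l : Fin M), 0 ≤ D.form (p w k) (p w l) := by
    have hlt : ∀ (w : D.dom) (k l : Fin M), k < l → 0 ≤ D.form (p w k) (p w l) := by
      intro w k l hlt
      refine hnonneg w k _ ?_
      filter_upwards [hp w l] with x h1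
      rw [h1]
      refine ⟨fun h2 => ?_, fun h2 => ?_⟩
      · by_contra! h3
        rw [clampTo_sub_eq_zero (hkk l) (h3.le.trans (hkl k l hlt))] at h2
        exact h2.false
      · exact absurd h2 (not_lt.2 (clampTo_sub_nonneg (hkk l)))
    intro w k l
    rcases lt_trichotomy k l with h1 | rfl | h1
    · exact hlt w k l h1
    · exact D.nonneg _
    · rw [D.symm]; exact hlt w l k h1
  have hpn : ∀ k l : Fin M, 0 ≤ D.form (p u k) (-p (-u) l) := by
    intro k l
    refine hnonneg u k _ ?_
    filter_upwards [hp (-u) l, hneg, Lp.coeFn_neg (p (-u) l : LTwo d)] with x h1 h2 h3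
    rw [Submodule.coe_neg, h3, Pi.neg_apply, h1, h2]
    have h4 := clampTo_sub_nonneg (t := -(u : LTwo d) x) (hkk l)
    refine ⟨fun h5 => by linarith, fun h5 => ?_⟩
    by_contra! h6
    rw [clampTo_of_nonpos (by linarith), clampTo_of_nonpos (by linarith)] at h5
    simp at h5
  have hrest : ∀ t : ℝ, (0 < t - clampTo (M * h) t + clampTo (M * h) (-t) → M * h ≤ t) ∧
      (t - clampTo (M * h) t + clampTo (M * h) (-t) < 0 → t ≤ -(M * h)) := by
    intro t
    rcases le_total 0 t with ht | ht
    · rw [clampTo_of_nonpos (by linarith : -t ≤ 0)]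
      rcases le_total t (M * h) with h1 | h1
      · rw [clampTo_of_le ht h1]; simp
      · rw [clampTo_of_ge hM h1]
        exact ⟨fun _ => h1, fun h2 => by linarith⟩
    · rw [clampTo_of_nonpos ht]
      rcases le_total (-t) (M * h) with h1 | h1
      · rw [clampTo_of_le (by linarith) h1]; simp
      · rw [clampTo_of_ge hM h1]
        exact ⟨fun _ => by linarith, fun h2 => by linarith⟩
  have hpr : ∀ k : Fin M, 0 ≤ D.form (p u k) r := by
    intro k
    refine hnonneg u k _ ?_
    filter_upwards [hr] with x h1
    rw [h1]
    exact ⟨fun h2 => (hkM k).trans ((hrest _).1 h2), fun h2 => ((hrest _).2 h2).trans (by linarith)⟩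
  have hnr : ∀ k : Fin M, 0 ≤ D.form (p (-u) k) (-r) := by
    intro k
    refine hnonneg (-u) k _ ?_
    filter_upwards [hr, hneg, Lp.coeFn_neg (r : LTwo d)] with x h1 h2 h3
    rw [Submodule.coe_neg, h3, Pi.neg_apply, h1, h2]
    refine ⟨fun h4 => ?_, fun h4 => ?_⟩
    · linarith [hkM k, (hrest ((u : LTwo d) x)).2 (by linarith)]
    · linarith [(hrest ((u : LTwo d) x)).1 (by linarith)]
  refine ⟨fun i => match i with
    | none => r
    | some (true, k) => p u k
    | some (false, k) => -p (-u) k, ?_, ?_⟩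
  · rintro (_ | ⟨_ | _, k⟩)
    · exact hr
    · filter_upwards [hp (-u) k, hneg, Lp.coeFn_neg (p (-u) k : LTwo d)] with x h1 h2 h3
      simp only [levelPiece]
      rw [Submodule.coe_neg, h3, Pi.neg_apply, h1, h2]
    · exact hp u k
  · rintro (_ | ⟨_ | _, k⟩) (_ | ⟨_ | _, l⟩)
    · exact D.nonneg _
    · have := hnr l
      rw [D.symm]
      simpa only [map_neg, LinearMap.neg_apply] using this
    · rw [D.symm]
      exact hpr l
    · have := hnr k
      simpa only [map_neg, LinearMap.neg_apply] using this
    · have := hpp (-u) k l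
      simpa only [map_neg, LinearMap.neg_apply, neg_neg] using this
    · rw [D.symm]
      exact hpn l k
    · exact hpr k
    · exact hpn k l
    · exact hpp u k l

/-- Every normal contraction operates on a Dirichlet form: a piecewise linear interpolation of it is
a combination of level pieces, with the slopes as coefficients. -/
theorem form_compLp_le (D : RegularDirichletForm d) {ψ : ℝ → ℝ} (hψ : LipschitzWith 1 ψ)
    (h0 : ψ 0 = 0) (u : D.dom) :
    ∃ hu : hψ.compLp h0 (u : LTwo d) ∈ D.dom,
      D.form ⟨hψ.compLp h0 (u : LTwo d), hu⟩ ⟨hψ.compLp h0 (u : LTwo d), hu⟩ ≤ D.form u u := by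
  have hψ' : LipschitzWith 1 fun t => ψ (-t) := by
    refine LipschitzWith.of_dist_le_mul fun x y => ?_
    simpa only [dist_neg_neg] using hψ.dist_le_mul (-x) (-y)
  have h0' : (fun t => ψ (-t)) 0 = 0 := by simpa using h0
  have step : ∀ n : ℕ, ∃ v : D.dom, D.form v v ≤ D.form u u ∧ (v : LTwo d) =ᵐ[volume] fun x =>
      interpolant ψ (1 / ((n : ℝ) + 1)) ((n + 1) ^ 2) ((u : LTwo d) x) +
        interpolant (fun t => ψ (-t)) (1 / ((n : ℝ) + 1)) ((n + 1) ^ 2) (-(u : LTwo d) x) := by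
    intro n
    have hh : (0 : ℝ) < 1 / ((n : ℝ) + 1) := by positivity
    set h : ℝ := 1 / ((n : ℝ) + 1)
    set M : ℕ := (n + 1) ^ 2
    obtain ⟨e, he, hee⟩ := D.exists_levelPiece u hh M
    let a : Option (Bool × Fin M) → ℝ := fun i => match i with
      | none => 0
      | some (true, k) => (ψ ((k + 1) * h) - ψ (k * h)) / h
      | some (false, k) => -((ψ (-((k + 1) * h)) - ψ (-(k * h))) / h)
    have ha : ∀ i, |a i| ≤ 1 := by
      rintro (_ | ⟨_ | _, k⟩)
      · simp [a]
      · have := abs_slope_le_one hψ' hh (k * h)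
        rw [show (k : ℝ) * h + h = (k + 1) * h by ring] at this
        simpa only [a, abs_neg] using this
      · have := abs_slope_le_one hψ hh (k * h)
        rw [show (k : ℝ) * h + h = (k + 1) * h by ring] at this
        exact this
    have hsum : ∑ i, e i = u := by
      refine Subtype.ext (Lp.ext ?_)
      rw [Submodule.coe_sum]
      filter_upwards [Lp.coeFn_finsetSum Finset.univ fun i => (e i : LTwo d), ae_all_iff.2 he]
        with x h1 h2
      rw [h1, Finset.sum_apply]
      simp only [h2, Fintype.sum_option, Fintype.sum_prod_type, Fintype.sum_bool, levelPiece,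
        Finset.sum_neg_distrib]
      rw [Fin.sum_univ_eq_sum_range (fun k : ℕ => clampTo ((k + 1) * h) ((u : LTwo d) x) -
          clampTo (k * h) ((u : LTwo d) x)) M,
        Fin.sum_univ_eq_sum_range (fun k : ℕ => clampTo ((k + 1) * h) (-(u : LTwo d) x) -
          clampTo (k * h) (-(u : LTwo d) x)) M]
      have hs : ∀ t : ℝ, ∑ k ∈ Finset.range M, (clampTo (((k : ℝ) + 1) * h) t - clampTo (k * h) t)
          = clampTo (M * h) t := by
        intro t
        have := Finset.sum_range_sub (fun k : ℕ => clampTo (k * h) t) M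
        simp only [Nat.cast_succ, Nat.cast_zero, zero_mul] at this
        rw [this, show clampTo 0 t = 0 from max_eq_left (min_le_left _ _), sub_zero]
      rw [hs, hs]
      ring
    refine ⟨∑ i, a i • e i, ?_, ?_⟩
    · have := LTwoForm.form_sum_le e a ha hee
      rwa [hsum] at this
    · rw [Submodule.coe_sum]
      filter_upwards [Lp.coeFn_finsetSum Finset.univ fun i => ((a i • e i : D.dom) : LTwo d),
        ae_all_iff.2 he, ae_all_iff.2 fun i => Lp.coeFn_smul (a i) (e i : LTwo d)] with x h1 h2 h3
      rw [h1, Finset.sum_apply]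
      simp only [Submodule.coe_smul, h3, Pi.smul_apply, smul_eq_mul, h2, Fintype.sum_option,
        Fintype.sum_prod_type, Fintype.sum_bool, levelPiece, a, zero_mul, zero_add, neg_mul_neg]
      rw [interpolant, interpolant, Finset.sum_range, Finset.sum_range]
  choose v hvE hv using step
  refine D.isClosedForm.mem_dom_of_tendsto v _ _ hvE ?_
  refine LTwo.tendsto_of_dominated _ _ (u : LTwo d) (fun n => ?_) ?_
  · filter_upwards [hv n] with x hx
    rw [hx]
    rcases le_total 0 ((u : LTwo d) x) with hu | hu
    · rw [interpolant_of_nonpos _ _ _ (neg_nonpos.2 hu), add_zero, abs_of_nonneg hu]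
      exact abs_interpolant_le hψ (by positivity) _ hu
    · rw [interpolant_of_nonpos _ _ _ hu, zero_add, abs_of_nonpos hu]
      exact abs_interpolant_le hψ' (by positivity) _ (neg_nonneg.2 hu)
  · filter_upwards [ae_all_iff.2 hv, hψ.coeFn_compLp h0 (u : LTwo d)] with x hx hx'
    simp only [hx, hx', Function.comp_apply]
    rcases le_total 0 ((u : LTwo d) x) with hu | hu
    · simp only [interpolant_of_nonpos _ _ _ (neg_nonpos.2 hu), add_zero]
      exact tendsto_interpolant hψ h0 hu
    · simp only [interpolant_of_nonpos _ _ _ hu, zero_add]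
      simpa using tendsto_interpolant hψ' h0' (neg_nonneg.2 hu)

end RegularDirichletForm

/-! ### The form with killing -/

namespace RegularDirichletForm

variable {d : ℕ} (D : RegularDirichletForm d) (V : RSpace d → ℝ≥0)

theorem killed_dom_le : (D.killed V).dom ≤ D.preDom V := Submodule.map_subtype_le _ _

variable {D V}

/-- An element of `𝒟(D^V)` as an element of `𝒟(D) ∩ L²(V dx)`. -/
noncomputable def toPre (u : (D.killed V).dom) : D.preDom V :=
  Submodule.inclusion (D.killed_dom_le V) u

theorem killed_form_eq_preForm (u v : (D.killed V).dom) :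
    (D.killed V).form u v = D.preForm V (toPre u) (toPre v) := rfl

theorem killed_form_apply (u v : (D.killed V).dom) :
    (D.killed V).form u v = D.form ⟨u, (D.killed_dom_le V u.2).1⟩ ⟨v, (D.killed_dom_le V v.2).1⟩
      + ∫ x, (V x : ℝ) * ((u : LTwo d) x * (v : LTwo d) x) := rfl

theorem integrable_potential (u : (D.killed V).dom) :
    Integrable (fun x => (V x : ℝ) * (u : LTwo d) x ^ 2) volume := by
  simp only [sq]
  exact D.integrable_pre V (toPre u) (toPre u)

theorem integral_potential_le (u : (D.killed V).dom) :
    ∫ x, (V x : ℝ) * (u : LTwo d) x ^ 2 ≤ (D.killed V).form u u := by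
  rw [killed_form_apply]
  simp only [sq]
  exact le_add_of_nonneg_left (D.nonneg _)

theorem mem_killed_dom_iff {u : LTwo d} : u ∈ (D.killed V).dom ↔
    ∃ hu : u ∈ D.preDom V, ∀ ε : ℝ, 0 < ε → ∃ g : D.preDom V, (g : LTwo d) ∈ ccClass d 2 ∧
      D.preForm V (⟨u, hu⟩ - g) (⟨u, hu⟩ - g) + ‖(⟨u, hu⟩ - g : D.preDom V)‖ ^ 2 < ε := by
  constructor
  · rintro ⟨v, hv, rfl⟩
    exact ⟨v.2, hv⟩
  · rintro ⟨hu, h⟩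
    exact ⟨⟨u, hu⟩, h, rfl⟩

theorem preForm_symm (u v : D.preDom V) : D.preForm V u v = D.preForm V v u := by
  rw [preForm_apply, preForm_apply, D.symm]
  simp only [mul_comm ((u : LTwo d) _)]

theorem isClosedForm_killed : (D.killed V).IsClosedForm where
  symm u v := preForm_symm _ _
  nonneg u := D.preForm_nonneg V _
  closed u hu := by
    have hpot : ∀ w : D.preDom V, 0 ≤ ∫ x, (V x : ℝ) * ((w : LTwo d) x * (w : LTwo d) x) :=
      fun w => integral_nonneg fun x => mul_nonneg (NNReal.coe_nonneg _) (mul_self_nonneg _)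
    let u' : ℕ → D.dom := fun n => ⟨u n, (toPre (u n)).2.1⟩
    obtain ⟨v, hv⟩ := D.closed u' (fun ε hε => by
      obtain ⟨N, hN⟩ := hu ε hε
      refine ⟨N, fun m n hm hn => lt_of_le_of_lt ?_ (hN m n hm hn)⟩
      have e : (D.killed V).form (u m - u n) (u m - u n) = D.form (u' m - u' n) (u' m - u' n) +
        ∫ x, (V x : ℝ) * (((u m - u n : (D.killed V).dom) : LTwo d) x *
          ((u m - u n : (D.killed V).dom) : LTwo d) x) := rfl
      have e2 : ‖(u m - u n : (D.killed V).dom)‖ = ‖(u' m - u' n : D.dom)‖ := rfl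
      rw [e, e2]
      have h : 0 ≤ ∫ x, (V x : ℝ) * (((u m - u n : (D.killed V).dom) : LTwo d) x *
          ((u m - u n : (D.killed V).dom) : LTwo d) x) := hpot (toPre (u m - u n))
      linarith)
    let w : ℕ → LTwo d := fun n => (toPre (u n)).2.2.toLp _
    have hw : ∀ n, w n =ᵐ[volume] fun x => √(V x : ℝ) * (u n : LTwo d) x := fun n =>
      (toPre (u n)).2.2.coeFn_toLp
    have hwnorm : ∀ m n, ‖w m - w n‖ ^ 2 = ∫ x, (V x : ℝ) *
        (((u m - u n : (D.killed V).dom) : LTwo d) x *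
          ((u m - u n : (D.killed V).dom) : LTwo d) x) := by
      intro m n
      rw [LTwo.norm_sq_eq_integral]
      refine integral_congr_ae ?_
      filter_upwards [hw m, hw n, Lp.coeFn_sub (w m) (w n),
        Lp.coeFn_sub (u m : LTwo d) (u n : LTwo d)] with x h1 h2 h3 h4
      rw [Submodule.coe_sub, h4, h3, Pi.sub_apply, Pi.sub_apply, h1, h2, ← mul_sub, mul_pow,
        Real.sq_sqrt (NNReal.coe_nonneg _), sq]
    have hwc : CauchySeq w := by
      rw [Metric.cauchySeq_iff]
      intro ε hε
      obtain ⟨N, hN⟩ := hu (ε ^ 2) (by positivity)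
      refine ⟨N, fun m hm n hn => ?_⟩
      rw [dist_eq_norm]
      refine lt_of_pow_lt_pow_left₀ 2 hε.le (lt_of_le_of_lt ?_ (hN m n hm hn))
      rw [hwnorm, killed_form_eq_preForm, preForm_apply]
      have h1 := D.nonneg (u' m - u' n)
      have h2 := sq_nonneg ‖(u m - u n : (D.killed V).dom)‖
      have e : (D.form ⟨_, (toPre (u m - u n)).2.1⟩) ⟨_, (toPre (u m - u n)).2.1⟩
        = D.form (u' m - u' n) (u' m - u' n) := rfl
      rw [e]
      have e2 : ((toPre (u m - u n) : D.preDom V) : LTwo d)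
        = ((u m - u n : (D.killed V).dom) : LTwo d) := rfl
      rw [e2]
      linarith
    obtain ⟨z, hz⟩ := cauchySeq_tendsto_of_complete hwc
    have huv : Tendsto (fun n => (u n : LTwo d)) atTop (𝓝 (v : LTwo d)) := by
      rw [tendsto_iff_norm_sub_tendsto_zero]
      have h1 : Tendsto (fun n => ‖(u' n - v : D.dom)‖ ^ 2) atTop (𝓝 0) :=
        squeeze_zero (fun n => by positivity) (fun n => by linarith [D.nonneg (u' n - v)]) hv
      have h2 := h1.sqrt
      simp only [Real.sqrt_sq (norm_nonneg _), Real.sqrt_zero] at h2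
      exact h2
    -- along a subsequence both `u n` and `√V u n` converge almost everywhere
    obtain ⟨k, hk, hku⟩ := (tendstoInMeasure_of_tendsto_Lp huv).exists_seq_tendsto_ae
    obtain ⟨l, hl, hlw⟩ :=
      (tendstoInMeasure_of_tendsto_Lp (hz.comp hk.tendsto_atTop)).exists_seq_tendsto_ae
    have hzv : z =ᵐ[volume] fun x => √(V x : ℝ) * (v : LTwo d) x := by
      filter_upwards [hku, hlw, ae_all_iff.2 hw] with x h1 h2 h3
      refine tendsto_nhds_unique h2 ?_
      have := (h1.comp hl.tendsto_atTop).const_mul √(V x : ℝ)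
      refine this.congr fun n => ?_
      simp only [Function.comp_apply, h3]
    have hvpre : (v : LTwo d) ∈ D.preDom V := ⟨v.2, (Lp.memLp z).ae_eq hzv⟩
    have hconv : Tendsto (fun n => D.preForm V (toPre (u n) - ⟨v, hvpre⟩) (toPre (u n) - ⟨v, hvpre⟩)
        + ‖(toPre (u n) - ⟨v, hvpre⟩ : D.preDom V)‖ ^ 2) atTop (𝓝 0) := by
      have h1 : Tendsto (fun n => ‖w n - z‖ ^ 2) atTop (𝓝 0) := by
        have := (tendsto_iff_norm_sub_tendsto_zero.1 hz).pow 2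
        simpa using this
      have h2 := hv.add h1
      rw [add_zero] at h2
      refine h2.congr fun n => ?_
      have h3 : ‖w n - z‖ ^ 2 = ∫ x, (V x : ℝ) *
          (((toPre (u n) - ⟨v, hvpre⟩ : D.preDom V) : LTwo d) x *
            ((toPre (u n) - ⟨v, hvpre⟩ : D.preDom V) : LTwo d) x) := by
        rw [LTwo.norm_sq_eq_integral]
        refine integral_congr_ae ?_
        filter_upwards [hw n, hzv, Lp.coeFn_sub (w n) z,
          Lp.coeFn_sub (u n : LTwo d) (v : LTwo d)] with x h1 h2 h3 h4
        have e : ((toPre (u n) - ⟨v, hvpre⟩ : D.preDom V) : LTwo d) = (u n : LTwo d) - v := rfl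
        rw [e, h4, h3, Pi.sub_apply, Pi.sub_apply, h1, h2, ← mul_sub, mul_pow,
          Real.sq_sqrt (NNReal.coe_nonneg _), sq]
      have e1 : (D.form ⟨_, (toPre (u n) - ⟨v, hvpre⟩ : D.preDom V).2.1⟩)
          ⟨_, (toPre (u n) - ⟨v, hvpre⟩ : D.preDom V).2.1⟩ = D.form (u' n - v) (u' n - v) := rfl
      have e2 : ‖(toPre (u n) - ⟨v, hvpre⟩ : D.preDom V)‖ = ‖(u' n - v : D.dom)‖ := rfl
      rw [preForm_apply, h3, e1, e2]
      ring
    have hvk : (v : LTwo d) ∈ (D.killed V).dom := by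
      refine mem_killed_dom_iff.2 ⟨hvpre, fun ε hε => ?_⟩
      obtain ⟨n, hn⟩ := (hconv.eventually (gt_mem_nhds (show (0 : ℝ) < ε / 4 by positivity))).exists
      obtain ⟨hun, hun'⟩ := mem_killed_dom_iff.1 (u n).2
      obtain ⟨g, hg, hg'⟩ := hun' (ε / 4) (by positivity)
      refine ⟨g, hg, ?_⟩
      have h1 := D.preForm_add_le V (-(toPre (u n) - ⟨v, hvpre⟩)) (toPre (u n) - g)
      have e : -(toPre (u n) - ⟨v, hvpre⟩) + (toPre (u n) - g) = ⟨v, hvpre⟩ - g := by abel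
      rw [e] at h1
      simp only [map_neg, LinearMap.neg_apply, neg_neg, norm_neg] at h1
      have h2 : D.preForm V (toPre (u n) - g) (toPre (u n) - g)
        + ‖(toPre (u n) - g : D.preDom V)‖ ^ 2 < ε / 4 := hg'
      linarith
    exact ⟨⟨v, hvk⟩, hconv⟩

/-- `C_c^2(ℝ^d)` is dense in `𝒟(D^V)` for the form norm. -/
theorem exists_core_approx (u : (D.killed V).dom) {ε : ℝ} (hε : 0 < ε) :
    ∃ g : (D.killed V).dom, (g : LTwo d) ∈ ccClass d 2 ∧
      (D.killed V).form (u - g) (u - g) + ‖(u - g : (D.killed V).dom)‖ ^ 2 < ε := by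
  obtain ⟨hu, h⟩ := mem_killed_dom_iff.1 u.2
  obtain ⟨g, hg, hg'⟩ := h ε hε
  refine ⟨⟨g, mem_killed_dom_iff.2 ⟨g.2, fun ε hε => ⟨g, hg, ?_⟩⟩⟩, hg, hg'⟩
  have e : (⟨(g : LTwo d), g.2⟩ : D.preDom V) - g = 0 := sub_self g
  rw [e]
  simpa using hε

theorem ccClass_subset_killed_dom
    (hV : Measurable V)
    (hVloc : ∀ S : Set (RSpace d), IsCompact S → ∃ M : ℝ, ∀ x ∈ S, (V x : ℝ) ≤ M)
    {u : LTwo d} (hu : u ∈ ccClass d 2) : u ∈ (D.killed V).dom := by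
  have hpre : u ∈ D.preDom V := by
    refine ⟨D.core_subset u hu, ?_⟩
    obtain ⟨f, hf, hfc, hfu⟩ := hu
    obtain ⟨M, hM⟩ := hVloc _ hfc
    refine MemLp.of_le_mul (c := √M) (Lp.memLp u) ?_ ?_
    · exact (hV.coe_nnreal_real.sqrt).aestronglyMeasurable.mul (Lp.memLp u).aestronglyMeasurable
    · filter_upwards [hfu] with x hx
      rw [norm_mul, Real.norm_eq_abs √_, abs_of_nonneg (Real.sqrt_nonneg _)]
      by_cases hxs : x ∈ tsupport f
      · gcongr
        exact hM x hxs
      · rw [hx, image_eq_zero_of_notMem_tsupport hxs, norm_zero, mul_zero, mul_zero]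
  refine mem_killed_dom_iff.2 ⟨hpre, fun ε hε => ⟨⟨u, hpre⟩, hu, ?_⟩⟩
  rw [sub_self]
  simpa using hε

end RegularDirichletForm

/-! ### Normal contractions operate on the form with killing -/

open scoped Convolution in
/-- A normal contraction of the line is a pointwise limit of smooth ones, namely of its
mollifications, shifted so as to vanish at `0`. -/
theorem exists_smooth_contractions {ψ : ℝ → ℝ} (hψ : LipschitzWith 1 ψ) (h0 : ψ 0 = 0) :
    ∃ χ : ℕ → ℝ → ℝ, (∀ n, ContDiff ℝ 2 (χ n)) ∧ (∀ n, LipschitzWith 1 (χ n)) ∧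
      (∀ n, χ n 0 = 0) ∧ ∀ t, Tendsto (fun n => χ n t) atTop (𝓝 (ψ t)) := by
  let η : ℕ → ContDiffBump (0 : ℝ) := fun n =>
    ⟨1 / ((n : ℝ) + 1) / 2, 1 / ((n : ℝ) + 1), by positivity, half_lt_self (by positivity)⟩
  let c : ℕ → ℝ → ℝ := fun n => (η n).normed volume ⋆[ContinuousLinearMap.lsmul ℝ ℝ, volume] ψ
  have hc : ∀ n x, c n x = ∫ t, (η n).normed volume t * ψ (x - t) := fun n x => rfl
  have hint : ∀ n x, Integrable (fun t => (η n).normed volume t * ψ (x - t)) := fun n x =>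
    ((η n).continuous_normed.mul (hψ.continuous.comp (by fun_prop))).integrable_of_hasCompactSupport
      (η n).hasCompactSupport_normed.mul_right
  have hlip : ∀ n, LipschitzWith 1 (c n) := by
    refine fun n => LipschitzWith.of_dist_le_mul fun x y => ?_
    rw [NNReal.coe_one, one_mul, dist_eq_norm, hc, hc, ← integral_sub (hint n x) (hint n y)]
    have h1 : ∫ t, (η n).normed volume t * dist x y = dist x y := by
      rw [integral_mul_const, (η n).integral_normed, one_mul]
    rw [← h1]
    refine norm_integral_le_of_norm_le ((η n).integrable_normed.mul_const _) (ae_of_all _ fun t => ?_)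
    rw [← mul_sub, norm_mul, Real.norm_eq_abs, abs_of_nonneg ((η n).nonneg_normed t), ← dist_eq_norm]
    have h2 := hψ.dist_le_mul (x - t) (y - t)
    rw [NNReal.coe_one, one_mul, dist_sub_right] at h2
    exact mul_le_mul_of_nonneg_left h2 ((η n).nonneg_normed t)
  have hlim : ∀ t, Tendsto (fun n => c n t) atTop (𝓝 (ψ t)) := fun t =>
    ContDiffBump.convolution_tendsto_right_of_continuous
      (tendsto_one_div_add_atTop_nhds_zero_nat (𝕜 := ℝ)) hψ.continuous t
  refine ⟨fun n t => c n t - c n 0, fun n => ?_, fun n => ?_, fun n => sub_self _, fun t => ?_⟩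
  · refine ContDiff.sub ?_ contDiff_const
    exact (η n).hasCompactSupport_normed.contDiff_convolution_left _ (n := 2) (η n).contDiff_normed
      hψ.continuous.locallyIntegrable
  · refine LipschitzWith.of_dist_le_mul fun x y => ?_
    simpa only [dist_sub_right] using (hlip n).dist_le_mul x y
  · simpa only [h0, sub_zero] using (hlim t).sub (hlim 0)

theorem LTwoForm.IsClosedForm.exists_pos_form_le {d : ℕ} {E : LTwoForm d} (hE : E.IsClosedForm)
    (u : E.dom) {δ : ℝ} (hδ : 0 < δ) :
    ∃ η : ℝ, 0 < η ∧ ∀ g : E.dom, E.form (u - g) (u - g) < η → E.form g g ≤ E.form u u + δ := by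
  have h1 : Tendsto (fun η : ℝ => 2 * √(E.form u u) * √η + η) (𝓝[>] 0) (𝓝 0) := by
    have : Continuous fun η : ℝ => 2 * √(E.form u u) * √η + η := by fun_prop
    simpa using (this.tendsto 0).mono_left nhdsWithin_le_nhds
  obtain ⟨η, hη, hη0⟩ := ((h1.eventually (gt_mem_nhds hδ)).and self_mem_nhdsWithin).exists
  refine ⟨η, hη0, fun g hg => ?_⟩
  have h2 := hE.sqrt_form_add_le u (g - u)
  rw [add_sub_cancel, ← neg_sub u g, form_neg_self] at h2
  have h3 : √(E.form (u - g) (u - g)) ≤ √η := Real.sqrt_le_sqrt hg.le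
  have h4 := Real.sq_sqrt (hE.nonneg u)
  have h5 := Real.sq_sqrt (le_of_lt hη0)
  rw [← Real.sq_sqrt (hE.nonneg g)]
  have h6 : √(E.form g g) ≤ √(E.form u u) + √η := by linarith
  have h7 := pow_le_pow_left₀ (Real.sqrt_nonneg _) h6 2
  nlinarith

theorem LTwo.abs_compLp_le {d : ℕ} {ψ : ℝ → ℝ} (hψ : LipschitzWith 1 ψ) (h0 : ψ 0 = 0)
    (u : LTwo d) : ∀ᵐ x, |hψ.compLp h0 u x| ≤ |u x| := by
  filter_upwards [hψ.coeFn_compLp h0 u] with x hx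
  have := hψ.dist_le_mul (u x) 0
  simpa [hx, h0] using this

theorem LTwo.norm_compLp_sub_le {d : ℕ} {ψ : ℝ → ℝ} (hψ : LipschitzWith 1 ψ) (h0 : ψ 0 = 0)
    (u v : LTwo d) : ‖hψ.compLp h0 u - hψ.compLp h0 v‖ ≤ ‖u - v‖ := by
  simpa using hψ.norm_compLp_sub_le h0 u v

namespace RegularDirichletForm

variable {d : ℕ} {D : RegularDirichletForm d} {V : RSpace d → ℝ≥0}

theorem exists_core_approx_of_le (u : (D.killed V).dom) {δ ε : ℝ} (hδ : 0 < δ) (hε : 0 < ε) :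
    ∃ g : (D.killed V).dom, (g : LTwo d) ∈ ccClass d 2 ∧
      (D.killed V).form g g ≤ (D.killed V).form u u + δ ∧ ‖(u : LTwo d) - g‖ < ε := by
  obtain ⟨η, hη, h⟩ := D.isClosedForm_killed.exists_pos_form_le u hδ
  obtain ⟨g, hg, hg'⟩ := exists_core_approx u (lt_min hη (pow_pos hε 2))
  have h1 := lt_of_lt_of_le hg' (min_le_left _ _)
  have h2 := lt_of_lt_of_le hg' (min_le_right _ _)
  have h3 := (D.isClosedForm_killed (V := V)).nonneg (u - g)
  refine ⟨g, hg, h g ?_, ?_⟩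
  · linarith [sq_nonneg ‖(u - g : (D.killed V).dom)‖]
  · refine lt_of_pow_lt_pow_left₀ 2 hε.le ?_
    have e : ‖(u : LTwo d) - g‖ = ‖(u - g : (D.killed V).dom)‖ := rfl
    rw [e]
    linarith

/-- Every normal contraction operates on the form with killing. For functions in `C_c^2` and smooth
contractions, which preserve `C_c^2`, this is inherited from `D`; the general case follows by weak
closure. -/
theorem killed_form_compLp_le (hV : Measurable V)
    (hVloc : ∀ S : Set (RSpace d), IsCompact S → ∃ M : ℝ, ∀ x ∈ S, (V x : ℝ) ≤ M)
    {ψ : ℝ → ℝ} (hψ : LipschitzWith 1 ψ) (h0 : ψ 0 = 0) (u : (D.killed V).dom) :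
    ∃ hu : hψ.compLp h0 (u : LTwo d) ∈ (D.killed V).dom,
      (D.killed V).form ⟨_, hu⟩ ⟨_, hu⟩ ≤ (D.killed V).form u u := by
  have hsmooth : ∀ (χ : ℝ → ℝ) (_ : ContDiff ℝ 2 χ) (hχ : LipschitzWith 1 χ) (hχ0 : χ 0 = 0)
      (g : (D.killed V).dom), (g : LTwo d) ∈ ccClass d 2 →
      ∃ h : hχ.compLp hχ0 (g : LTwo d) ∈ (D.killed V).dom,
        (D.killed V).form ⟨_, h⟩ ⟨_, h⟩ ≤ (D.killed V).form g g := by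
    intro χ hχ2 hχ hχ0 g hg
    have hcc : hχ.compLp hχ0 (g : LTwo d) ∈ ccClass d 2 := by
      obtain ⟨f, hf, hfc, hgf⟩ := hg
      refine ⟨χ ∘ f, hχ2.comp hf, hfc.comp_left hχ0, ?_⟩
      filter_upwards [hχ.coeFn_compLp hχ0 (g : LTwo d), hgf] with x h1 h2
      rw [h1, Function.comp_apply, Function.comp_apply, h2]
    have hmem := ccClass_subset_killed_dom (D := D) hV hVloc hcc
    refine ⟨hmem, ?_⟩
    obtain ⟨h1, h2⟩ := D.form_compLp_le hχ hχ0 ⟨g, (D.killed_dom_le V g.2).1⟩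
    rw [killed_form_apply, killed_form_apply]
    refine add_le_add h2 ?_
    have h3 := integrable_potential (⟨_, hmem⟩ : (D.killed V).dom)
    have h4 := integrable_potential g
    simp only [sq] at h3 h4
    refine integral_mono_ae h3 h4 ?_
    filter_upwards [LTwo.abs_compLp_le hχ hχ0 (g : LTwo d)] with x hx
    refine mul_le_mul_of_nonneg_left ?_ (NNReal.coe_nonneg _)
    exact abs_le_iff_mul_self_le.1 hx
  have hcore : ∀ g : (D.killed V).dom, (g : LTwo d) ∈ ccClass d 2 →
      ∃ h : hψ.compLp h0 (g : LTwo d) ∈ (D.killed V).dom,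
        (D.killed V).form ⟨_, h⟩ ⟨_, h⟩ ≤ (D.killed V).form g g := by
    intro g hg
    obtain ⟨χ, h1, h2, h3, h4⟩ := exists_smooth_contractions hψ h0
    choose hm hmE using fun n => hsmooth (χ n) (h1 n) (h2 n) (h3 n) g hg
    refine D.isClosedForm_killed.mem_dom_of_tendsto (fun n => ⟨_, hm n⟩) _ _ hmE ?_
    refine LTwo.tendsto_of_dominated _ _ (g : LTwo d)
      (fun n => LTwo.abs_compLp_le (h2 n) (h3 n) _) ?_
    filter_upwards [ae_all_iff.2 fun n => (h2 n).coeFn_compLp (h3 n) (g : LTwo d),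
      hψ.coeFn_compLp h0 (g : LTwo d)] with x hx hx'
    simp only [hx, hx', Function.comp_apply]
    exact h4 _
  have hδ : ∀ δ : ℝ, 0 < δ → ∃ h : hψ.compLp h0 (u : LTwo d) ∈ (D.killed V).dom,
      (D.killed V).form ⟨_, h⟩ ⟨_, h⟩ ≤ (D.killed V).form u u + δ := by
    intro δ hδ
    obtain ⟨h1, h2, -⟩ := D.isClosedForm_killed.mem_dom_of_bounded Set.univ
      (fun _ _ _ _ => Set.mem_univ _) (hψ.compLp h0 (u : LTwo d)) ((D.killed V).form u u + δ)
      (fun ε hε => by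
        obtain ⟨g, hg, hgE, hgn⟩ := exists_core_approx_of_le u hδ hε
        obtain ⟨hm, hmE⟩ := hcore g hg
        refine ⟨⟨_, hm⟩, Set.mem_univ _, hmE.trans hgE, ?_⟩
        refine (LTwo.norm_compLp_sub_le hψ h0 _ _).trans_lt ?_
        rwa [norm_sub_rev])
    exact ⟨h1, h2⟩
  exact ⟨(hδ 1 one_pos).1, le_of_forall_pos_le_add fun δ h => (hδ δ h).2⟩

end RegularDirichletForm

/-! ### The semigroup of a form -/

namespace LTwo

variable {d : ℕ}

theorem le_iff_ae {u v : LTwo d} : u ≤ v ↔ ∀ᵐ x, u x ≤ v x := (Lp.coeFn_le u v).symm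

theorem inner_le_inner_of_le {u v φ : LTwo d} (huv : u ≤ v) (hφ : 0 ≤ φ) :
    ⟪u, φ⟫_ℝ ≤ ⟪v, φ⟫_ℝ := by
  rw [inner_eq_integral, inner_eq_integral]
  refine integral_mono_ae (integrable_mul u φ) (integrable_mul v φ) ?_
  filter_upwards [le_iff_ae.1 huv, le_iff_ae.1 hφ, Lp.coeFn_zero ℝ 2 (volume : Measure (RSpace d))]
    with x h1 h2 h3
  rw [h3, Pi.zero_apply] at h2
  exact mul_le_mul_of_nonneg_right h1 h2

/-- The negative part of a square integrable function. -/
noncomputable def neg (u : LTwo d) : LTwo d := (2⁻¹ : ℝ) • (|u| - u)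

theorem coeFn_neg' (u : LTwo d) : ∀ᵐ x, neg u x = 2⁻¹ * (|u x| - u x) := by
  filter_upwards [Lp.coeFn_smul (2⁻¹ : ℝ) (|u| - u), Lp.coeFn_sub |u| u, Lp.coeFn_abs u]
    with x h1 h2 h3
  rw [neg, h1, Pi.smul_apply, h2, Pi.sub_apply, h3, smul_eq_mul]

theorem neg_eq_zero_iff {u : LTwo d} : neg u = 0 ↔ 0 ≤ u := by
  rw [neg, smul_eq_zero_iff_right (by norm_num), sub_eq_zero]
  exact ⟨fun h => h ▸ abs_nonneg u, fun h => abs_of_nonneg h⟩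

theorem norm_neg_sub_neg_le (u v : LTwo d) : ‖neg u - neg v‖ ≤ ‖u - v‖ := by
  have e : neg u - neg v = (2⁻¹ : ℝ) • ((|u| - |v|) - (u - v)) := by
    rw [neg, neg]; module
  rw [e, norm_smul, Real.norm_eq_abs, abs_of_pos (by norm_num : (0 : ℝ) < 2⁻¹)]
  have h1 := norm_sub_le (|u| - |v|) (u - v)
  have h2 : ‖|u| - |v|‖ ≤ ‖u - v‖ := norm_abs_sub_abs u v
  linarith

theorem continuous_neg : Continuous (neg : LTwo d → LTwo d) :=
  (LipschitzWith.of_dist_le_mul (K := 1) fun u v => by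
    simpa [dist_eq_norm] using norm_neg_sub_neg_le u v).continuous

/-- The squared distance to the cone of nonnegative functions lies below its quadratic
approximation. -/
theorem norm_neg_sq_le (u v : LTwo d) :
    ‖neg v‖ ^ 2 ≤ ‖neg u‖ ^ 2 + (-2 * ⟪neg u, v - u⟫_ℝ + ‖v - u‖ ^ 2) := by
  have i1 := integrable_sq (neg u)
  have i2 := (integrable_mul (neg u) (v - u)).const_mul (-2)
  have i3 := integrable_sq (v - u)
  have i4 : Integrable (fun x => -2 * (neg u x * (v - u) x) + (v - u) x ^ 2) := i2.add i3
  rw [norm_sq_eq_integral, norm_sq_eq_integral, norm_sq_eq_integral, inner_eq_integral,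
    ← integral_const_mul, ← integral_add i2 i3, ← integral_add i1 i4]
  refine integral_mono_ae (integrable_sq _) (i1.add i4) ?_
  filter_upwards [coeFn_neg' u, coeFn_neg' v, Lp.coeFn_sub v u] with x h1 h2 h3
  rw [h1, h2, h3, Pi.sub_apply]
  rcases abs_cases (u x) with ⟨h4, h5⟩ | ⟨h4, h5⟩ <;> rcases abs_cases (v x) with ⟨h6, h7⟩ | ⟨h6, h7⟩ <;>
    rw [h4, h6] <;> nlinarith

end LTwo

namespace IsSemigroupOf

variable {d : ℕ} {E : LTwoForm d} {T : ℝ → LTwo d →L[ℝ] LTwo d}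

/-- `u` lies in the domain of the infinitesimal generator and is mapped to `w`. -/
def HasGenerator (T : ℝ → LTwo d →L[ℝ] LTwo d) (u w : LTwo d) : Prop :=
  Tendsto (fun t : ℝ => t⁻¹ • (T t u - u)) (𝓝[>] 0) (𝓝 w)

theorem norm_apply_le (hT : IsSemigroupOf E T) {t : ℝ} (ht : 0 ≤ t) (u : LTwo d) :
    ‖T t u‖ ≤ ‖u‖ :=
  ((T t).le_of_opNorm_le (hT.contraction t ht) u).trans_eq (one_mul _)

theorem add_apply (hT : IsSemigroupOf E T) {s t : ℝ} (hs : 0 ≤ s) (ht : 0 ≤ t) (u : LTwo d) :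
    T (s + t) u = T s (T t u) := by
  rw [hT.add s t hs ht, ContinuousLinearMap.comp_apply]

theorem zero_apply (hT : IsSemigroupOf E T) (u : LTwo d) : T 0 u = u := by
  rw [hT.zero, ContinuousLinearMap.id_apply]

theorem continuous_orbit (hT : IsSemigroupOf E T) (u : LTwo d) :
    Continuous fun t : ℝ => T |t| u := by
  have hle : ∀ s t : ℝ, 0 ≤ s → s ≤ t → ‖T t u - T s u‖ ≤ ‖T (t - s) u - u‖ := by
    intro s t hs hst
    have e : T t u - T s u = T s (T (t - s) u - u) := by
      rw [map_sub, ← hT.add_apply hs (sub_nonneg.2 hst), add_sub_cancel]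
    rw [e]
    exact hT.norm_apply_le hs _
  rw [Metric.continuous_iff]
  intro t ε hε
  obtain ⟨δ, hδ, h⟩ := Metric.mem_nhdsWithin_iff.1 ((hT.continuous u) (Metric.ball_mem_nhds u hε))
  have h' : ∀ r : ℝ, 0 ≤ r → r < δ → ‖T r u - u‖ < ε := by
    intro r hr hrδ
    rcases hr.eq_or_lt with rfl | hr
    · rwa [hT.zero_apply, sub_self, norm_zero]
    · rw [← dist_eq_norm]
      exact h ⟨by rw [Metric.mem_ball, dist_zero_right, Real.norm_eq_abs, abs_of_pos hr]; exact hrδ,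
        hr⟩
  refine ⟨δ, hδ, fun s hs => ?_⟩
  rw [dist_eq_norm]
  have hst : |(|s| - |t|)| < δ := by
    rw [Real.dist_eq] at hs
    exact (abs_abs_sub_abs_le_abs_sub s t).trans_lt hs
  rcases le_total |t| |s| with h1 | h1
  · refine (hle _ _ (abs_nonneg t) h1).trans_lt (h' _ (sub_nonneg.2 h1) ?_)
    rwa [abs_of_nonneg (sub_nonneg.2 h1)] at hst
  · rw [norm_sub_rev]
    refine (hle _ _ (abs_nonneg s) h1).trans_lt (h' _ (sub_nonneg.2 h1) ?_)
    rwa [abs_sub_comm, abs_of_nonneg (sub_nonneg.2 h1)] at hst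

theorem hasGenerator_orbit (hT : IsSemigroupOf E T) {u w : LTwo d} (h : HasGenerator T u w)
    {t : ℝ} (ht : 0 ≤ t) : HasGenerator T (T t u) (T t w) := by
  refine (((T t).continuous.tendsto w).comp h).congr' ?_
  filter_upwards [self_mem_nhdsWithin] with s hs
  rw [Function.comp_apply, map_smul, map_sub, ← hT.add_apply ht hs.le, add_comm,
    hT.add_apply hs.le ht]

theorem tendsto_slope (hT : IsSemigroupOf E T) {u w : LTwo d} (h : HasGenerator T u w)
    {t : ℝ} (ht : 0 ≤ t) :
    Tendsto (fun z => (z - t)⁻¹ • (T |z| u - T |t| u)) (𝓝[>] t) (𝓝 (T t w)) := by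
  have h1 : Tendsto (fun z : ℝ => z - t) (𝓝[>] t) (𝓝[>] 0) := by
    refine tendsto_nhdsWithin_iff.2 ⟨?_, ?_⟩
    · have : Tendsto (fun z : ℝ => z - t) (𝓝 t) (𝓝 (t - t)) := tendsto_id.sub_const t
      rw [sub_self] at this
      exact this.mono_left nhdsWithin_le_nhds
    · filter_upwards [self_mem_nhdsWithin] with z hz
      exact sub_pos.2 (Set.mem_Ioi.1 hz)
  refine ((hT.hasGenerator_orbit h ht).comp h1).congr' ?_
  filter_upwards [self_mem_nhdsWithin] with z hz
  have hz' : t < z := hz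
  rw [Function.comp_apply, ← hT.add_apply (sub_pos.2 hz').le ht, sub_add_cancel, abs_of_nonneg ht,
    abs_of_nonneg (ht.trans hz'.le)]

/-- The domain of the generator is dense: it contains the averages of the orbits. -/
theorem exists_hasGenerator (hT : IsSemigroupOf E T) (u : LTwo d) {ε : ℝ} (hε : 0 < ε) :
    ∃ v w : LTwo d, HasGenerator T v w ∧ ‖v - u‖ < ε := by
  have hc := hT.continuous_orbit u
  let F : ℝ → LTwo d := fun x => ∫ s in (0 : ℝ)..x, T |s| u
  have hF : ∀ x, HasDerivAt F (T |x| u) x := fun x =>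
    intervalIntegral.integral_hasDerivAt_right (hc.intervalIntegrable _ _)
      (hc.stronglyMeasurableAtFilter _ _) hc.continuousAt
  have hslope : ∀ x, Tendsto (fun t : ℝ => t⁻¹ • (F (x + t) - F x)) (𝓝[>] 0) (𝓝 (T |x| u)) :=
    fun x => (hasDerivAt_iff_tendsto_slope_zero.1 (hF x)).mono_left
      (nhdsWithin_mono _ fun t ht => ne_of_gt ht)
  have hF0 : F 0 = 0 := intervalIntegral.integral_same
  have h0 := hslope 0
  simp only [zero_add, hF0, sub_zero, abs_zero, hT.zero_apply] at h0
  obtain ⟨a, ha, ha0⟩ := ((h0.eventually (Metric.ball_mem_nhds u hε)).and self_mem_nhdsWithin).exists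
  have ha0 : 0 < a := ha0
  refine ⟨a⁻¹ • F a, a⁻¹ • (T |a| u - u), ?_, by rwa [← dist_eq_norm]⟩
  refine (((hslope a).sub h0).const_smul a⁻¹).congr' ?_
  filter_upwards [self_mem_nhdsWithin] with t ht
  have ht : 0 < t := ht
  have h1 : T t (F a) = F (a + t) - F t := by
    have e1 : T t (F a) = ∫ s in (0 : ℝ)..a, T |s + t| u := by
      rw [← (T t).intervalIntegral_comp_comm (hc.intervalIntegrable _ _)]
      refine intervalIntegral.integral_congr fun s hs => ?_
      rw [Set.uIcc_of_le ha0.le] at hs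
      change T t (T |s| u) = T |s + t| u
      rw [← hT.add_apply ht.le (abs_nonneg s), abs_of_nonneg hs.1, abs_of_nonneg (by linarith [hs.1]),
        add_comm]
    rw [e1, intervalIntegral.integral_comp_add_right (fun s => T |s| u) t, zero_add,
      intervalIntegral.integral_interval_sub_left (hc.intervalIntegrable _ _)
        (hc.intervalIntegrable _ _)]
  rw [map_smul, h1]
  module

/-- `E(u, |u|) ≤ E(u, u)`, written in terms of the generator. -/
theorem inner_generator_abs_le (hT : IsSemigroupOf E T) (hE : E.IsClosedForm)
    (habs : ∀ u : E.dom, ∃ h : |(u : LTwo d)| ∈ E.dom, E.form ⟨_, h⟩ ⟨_, h⟩ ≤ E.form u u)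
    {u w : LTwo d} (h : HasGenerator T u w) : 0 ≤ ⟪LTwo.neg u, w⟫_ℝ := by
  obtain ⟨hu, hgen⟩ := (hT.generator u w).2 h
  obtain ⟨ha, hle⟩ := habs ⟨u, hu⟩
  have h1 := hgen ⟨_, ha⟩
  have h2 := hgen ⟨u, hu⟩
  have h3 := hE.nonneg (⟨u, hu⟩ - ⟨_, ha⟩)
  rw [hE.form_sub_self] at h3
  rw [LTwo.neg, real_inner_smul_left, inner_sub_left, real_inner_comm w, real_inner_comm w]
  simp only at h1 h2 hle
  linarith

/-- The distance to the cone of nonnegative functions decreases along the semigroup. -/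
theorem norm_neg_apply_le (hT : IsSemigroupOf E T) (hE : E.IsClosedForm)
    (habs : ∀ u : E.dom, ∃ h : |(u : LTwo d)| ∈ E.dom, E.form ⟨_, h⟩ ⟨_, h⟩ ≤ E.form u u)
    {t : ℝ} (ht : 0 ≤ t) (u : LTwo d) : ‖LTwo.neg (T t u)‖ ≤ ‖LTwo.neg u‖ := by
  have key : ∀ v w : LTwo d, HasGenerator T v w → ‖LTwo.neg (T t v)‖ ≤ ‖LTwo.neg v‖ := by
    intro v w hvw
    have hc := hT.continuous_orbit v
    have hg := le_gronwallBound_of_liminf_deriv_right_le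
      (f := fun z => ‖LTwo.neg (T |z| v)‖ ^ 2)
      (f' := fun z => -2 * ⟪LTwo.neg (T |z| v), T z w⟫_ℝ) (δ := ‖LTwo.neg v‖ ^ 2) (K := 0) (ε := 0)
      (a := 0) (b := t) ((LTwo.continuous_neg.comp hc).norm.pow 2).continuousOn ?_ ?_ ?_ t ⟨ht, le_rfl⟩
    · simp only [gronwallBound_K0, zero_mul, add_zero, abs_of_nonneg ht] at hg
      exact le_of_sq_le_sq hg (norm_nonneg _)
    · intro x hx r hr
      have h1 := hT.tendsto_slope hvw hx.1
      have h2 : Tendsto (fun z => -2 * ⟪LTwo.neg (T |x| v), (z - x)⁻¹ • (T |z| v - T |x| v)⟫_ℝ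
          + ‖(z - x)⁻¹ • (T |z| v - T |x| v)‖ * ‖T |z| v - T |x| v‖) (𝓝[>] x)
          (𝓝 (-2 * ⟪LTwo.neg (T |x| v), T x w⟫_ℝ + ‖T x w‖ * ‖T |x| v - T |x| v‖)) := by
        refine Tendsto.add ((tendsto_const_nhds.inner h1).const_mul _) (h1.norm.mul ?_)
        exact (((hc.tendsto x).mono_left nhdsWithin_le_nhds).sub_const _).norm
      rw [sub_self, norm_zero, mul_zero, add_zero] at h2
      refine Eventually.frequently ?_
      filter_upwards [h2.eventually (gt_mem_nhds hr), self_mem_nhdsWithin] with z hz hz'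
      have hz' : 0 < z - x := sub_pos.2 hz'
      refine lt_of_le_of_lt ?_ hz
      rw [real_inner_smul_right, norm_smul, Real.norm_eq_abs, abs_of_pos (inv_pos.2 hz')]
      have h3 := LTwo.norm_neg_sq_le (T |x| v) (T |z| v)
      calc (z - x)⁻¹ * (‖LTwo.neg (T |z| v)‖ ^ 2 - ‖LTwo.neg (T |x| v)‖ ^ 2)
          ≤ (z - x)⁻¹ * (-2 * ⟪LTwo.neg (T |x| v), T |z| v - T |x| v⟫_ℝ
            + ‖T |z| v - T |x| v‖ ^ 2) := by
            refine mul_le_mul_of_nonneg_left ?_ (inv_pos.2 hz').le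
            linarith
        _ = _ := by ring
    · simp [hT.zero_apply]
    · intro x hx
      have := hT.inner_generator_abs_le hE habs (hT.hasGenerator_orbit hvw hx.1)
      rw [abs_of_nonneg hx.1]
      linarith
  choose v w hvw hv using fun n : ℕ => hT.exists_hasGenerator u (ε := 1 / ((n : ℝ) + 1)) (by positivity)
  have hlim : Tendsto v atTop (𝓝 u) := by
    rw [tendsto_iff_norm_sub_tendsto_zero]
    exact squeeze_zero (fun n => norm_nonneg _) (fun n => (hv n).le)
      tendsto_one_div_add_atTop_nhds_zero_nat
  refine le_of_tendsto_of_tendsto' (b := atTop) ?_ ?_ fun n => key (v n) (w n) (hvw n)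
  · exact ((LTwo.continuous_neg.comp (T t).continuous).norm.tendsto u).comp hlim
  · exact (LTwo.continuous_neg.norm.tendsto u).comp hlim

theorem nonneg_apply (hT : IsSemigroupOf E T) (hE : E.IsClosedForm)
    (habs : ∀ u : E.dom, ∃ h : |(u : LTwo d)| ∈ E.dom, E.form ⟨_, h⟩ ⟨_, h⟩ ≤ E.form u u)
    {t : ℝ} (ht : 0 ≤ t) {u : LTwo d} (hu : 0 ≤ u) : 0 ≤ T t u := by
  have h := hT.norm_neg_apply_le hE habs ht u
  rw [LTwo.neg_eq_zero_iff.2 hu, norm_zero] at h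
  exact LTwo.neg_eq_zero_iff.1 (norm_le_zero_iff.1 h)

theorem abs_apply_le (hT : IsSemigroupOf E T) (hE : E.IsClosedForm)
    (habs : ∀ u : E.dom, ∃ h : |(u : LTwo d)| ∈ E.dom, E.form ⟨_, h⟩ ⟨_, h⟩ ≤ E.form u u)
    {t : ℝ} (ht : 0 ≤ t) (u : LTwo d) : |T t u| ≤ T t |u| := by
  have h1 := hT.nonneg_apply hE habs ht (sub_nonneg.2 (le_abs_self u))
  have h2 := hT.nonneg_apply hE habs ht (sub_nonneg.2 (neg_le_abs u))
  rw [map_sub, sub_nonneg] at h1 h2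
  rw [map_neg] at h2
  exact abs_le'.2 ⟨h1, h2⟩

/-- The mass `∫ |u| φ` with respect to a nonnegative eigenfunction `φ` decreases along the
semigroup. -/
theorem mass_apply_le (hT : IsSemigroupOf E T) (hE : E.IsClosedForm)
    (habs : ∀ u : E.dom, ∃ h : |(u : LTwo d)| ∈ E.dom, E.form ⟨_, h⟩ ⟨_, h⟩ ≤ E.form u u)
    {φ : LTwo d} (hφ : 0 ≤ φ) {l : ℝ} (hl : 0 ≤ l)
    (heigen : ∀ t : ℝ, 0 ≤ t → T t φ = Real.exp (-l * t) • φ)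
    {t : ℝ} (ht : 0 ≤ t) (u : LTwo d) : ⟪|T t u|, φ⟫_ℝ ≤ ⟪|u|, φ⟫_ℝ := by
  have h0 : 0 ≤ ⟪|u|, φ⟫_ℝ := by
    simpa using LTwo.inner_le_inner_of_le (abs_nonneg u) hφ
  refine (LTwo.inner_le_inner_of_le (hT.abs_apply_le hE habs ht u) hφ).trans ?_
  rw [hT.symm t ht, heigen t ht, real_inner_smul_right]
  refine mul_le_of_le_one_left h0 (Real.exp_le_one_iff.2 ?_)
  nlinarith

/-- A super Poincaré inequality with constants `s`, `b` makes the squared norm decay towards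
`b (∫ |u| φ)²` at rate `2 / s`. -/
theorem norm_sq_apply_le (hT : IsSemigroupOf E T) (hE : E.IsClosedForm)
    (habs : ∀ u : E.dom, ∃ h : |(u : LTwo d)| ∈ E.dom, E.form ⟨_, h⟩ ⟨_, h⟩ ≤ E.form u u)
    {φ : LTwo d} (hφ : 0 ≤ φ) {l : ℝ} (hl : 0 ≤ l)
    (heigen : ∀ t : ℝ, 0 ≤ t → T t φ = Real.exp (-l * t) • φ) {s b : ℝ} (hs : 0 < s) (hb : 0 ≤ b)
    (hsp : ∀ f : E.dom, ‖(f : LTwo d)‖ ^ 2 ≤ s * E.form f f + b * ⟪|(f : LTwo d)|, φ⟫_ℝ ^ 2)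
    {t : ℝ} (ht : 0 ≤ t) (u : LTwo d) :
    ‖T t u‖ ^ 2 ≤ Real.exp (-2 * t / s) * ‖u‖ ^ 2 + b * ⟪|u|, φ⟫_ℝ ^ 2 := by
  have key : ∀ v w : LTwo d, HasGenerator T v w →
      ‖T t v‖ ^ 2 ≤ Real.exp (-2 * t / s) * ‖v‖ ^ 2 + b * ⟪|v|, φ⟫_ℝ ^ 2 := by
    intro v w hvw
    have hc := hT.continuous_orbit v
    have hK : -2 / s ≠ 0 := by
      have : -2 / s < 0 := div_neg_of_neg_of_pos (by norm_num) hs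
      exact this.ne
    have hg := le_gronwallBound_of_liminf_deriv_right_le
      (f := fun z => ‖T |z| v‖ ^ 2)
      (f' := fun z => 2 * ⟪T z w, T |z| v⟫_ℝ) (δ := ‖v‖ ^ 2) (K := -2 / s)
      (ε := 2 / s * (b * ⟪|v|, φ⟫_ℝ ^ 2))
      (a := 0) (b := t) (hc.norm.pow 2).continuousOn ?_ ?_ ?_ t ⟨ht, le_rfl⟩
    · rw [gronwallBound_of_K_ne_0 hK] at hg
      simp only [abs_of_nonneg ht, sub_zero] at hg
      have e1 : 2 / s * (b * ⟪|v|, φ⟫_ℝ ^ 2) / (-2 / s) = -(b * ⟪|v|, φ⟫_ℝ ^ 2) := by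
        field_simp
      rw [e1, show -2 / s * t = -2 * t / s by ring] at hg
      have h1 : 0 ≤ b * ⟪|v|, φ⟫_ℝ ^ 2 := by positivity
      nlinarith [Real.exp_pos (-2 * t / s)]
    · intro x hx r hr
      have h1 := hT.tendsto_slope hvw hx.1
      have h2 : Tendsto (fun z => ⟪(z - x)⁻¹ • (T |z| v - T |x| v), T |z| v + T |x| v⟫_ℝ) (𝓝[>] x)
          (𝓝 ⟪T x w, T |x| v + T |x| v⟫_ℝ) :=
        h1.inner (((hc.tendsto x).mono_left nhdsWithin_le_nhds).add_const _)
      rw [inner_add_right, ← two_mul] at h2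
      refine Eventually.frequently ?_
      filter_upwards [h2.eventually (gt_mem_nhds hr)] with z hz
      refine lt_of_eq_of_lt ?_ hz
      rw [real_inner_smul_left, inner_sub_left, inner_add_right, inner_add_right,
        real_inner_self_eq_norm_sq, real_inner_self_eq_norm_sq, real_inner_comm (T |z| v) (T |x| v)]
      ring
    · simp [hT.zero_apply]
    · intro x hx
      obtain ⟨hu, hgen⟩ := (hT.generator _ _).2 (hT.hasGenerator_orbit hvw hx.1)
      have h1 := hgen ⟨_, hu⟩
      have h2 := hsp ⟨_, hu⟩
      have h3 := hT.mass_apply_le hE habs hφ hl heigen hx.1 v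
      have h4 : 0 ≤ ⟪|T x v|, φ⟫_ℝ := by
        simpa using LTwo.inner_le_inner_of_le (abs_nonneg (T x v)) hφ
      have h5 := mul_le_mul_of_nonneg_left (pow_le_pow_left₀ h4 h3 2) hb
      simp only at h1 h2
      rw [abs_of_nonneg hx.1]
      have h6 : ‖T x v‖ ^ 2 - b * ⟪|v|, φ⟫_ℝ ^ 2 ≤ -(s * ⟪T x w, T x v⟫_ℝ) := by
        rw [h1] at h2
        linarith
      have h7 : 2 * ⟪T x w, T x v⟫_ℝ = -2 / s * -(s * ⟪T x w, T x v⟫_ℝ) := by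
        field_simp
      have h8 := mul_le_mul_of_nonneg_left h6 (show 0 ≤ 2 / s by positivity)
      rw [h7]
      linarith [show -2 / s * -(s * ⟪T x w, T x v⟫_ℝ) = -(2 / s * -(s * ⟪T x w, T x v⟫_ℝ)) by ring,
        show -2 / s * ‖T x v‖ ^ 2 + 2 / s * (b * ⟪|v|, φ⟫_ℝ ^ 2)
          = -(2 / s * (‖T x v‖ ^ 2 - b * ⟪|v|, φ⟫_ℝ ^ 2)) by ring]
  choose v w hvw hv using fun n : ℕ => hT.exists_hasGenerator u (ε := 1 / ((n : ℝ) + 1)) (by positivity)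
  have hlim : Tendsto v atTop (𝓝 u) := by
    rw [tendsto_iff_norm_sub_tendsto_zero]
    exact squeeze_zero (fun n => norm_nonneg _) (fun n => (hv n).le)
      tendsto_one_div_add_atTop_nhds_zero_nat
  have habsc : Continuous fun v : LTwo d => |v| :=
    (LipschitzWith.of_dist_le_mul (K := 1) fun u v => by
      simpa [dist_eq_norm] using norm_abs_sub_abs u v).continuous
  refine le_of_tendsto_of_tendsto' (b := atTop) ?_ ?_ fun n => key (v n) (w n) (hvw n)
  · exact (((T t).continuous.norm.pow 2).tendsto u).comp hlim
  · have : Continuous fun v : LTwo d =>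
        Real.exp (-2 * t / s) * ‖v‖ ^ 2 + b * ⟪|v|, φ⟫_ℝ ^ 2 := by fun_prop
    exact (this.tendsto u).comp hlim

end IsSemigroupOf

/-! ### Intrinsic ultracontractivity from a super Poincaré inequality -/

theorem rateInv_anti (b : ℝ → ℝ≥0∞) {y z : ℝ≥0∞} (h : y ≤ z) : rateInv b z ≤ rateInv b y :=
  le_iInf₂ fun s hs => iInf₂_le s ⟨hs.1, hs.2.trans h⟩

/-- For an integrable rate the inverse values at dyadic levels are summable. -/
theorem RateIntegrable.exists_summable {b : ℝ → ℝ≥0∞} (hb : RateIntegrable b) :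
    ∃ (y : ℝ) (σ : ℕ → ℝ), 0 < y ∧ (∀ k, 0 < σ k) ∧ (∀ k, b (σ k) ≤ ENNReal.ofReal (y * 2 ^ k)) ∧
      Summable σ := by
  obtain ⟨hb1, hb2⟩ := hb
  set m := ⨅ s ∈ Set.Ioi (0 : ℝ), b s with hm
  let y : ℝ := m.toReal + 1
  have hy : 0 < y := by positivity
  have hmy : m < ENNReal.ofReal y := by
    rw [ENNReal.lt_ofReal_iff_toReal_lt hb1.ne]
    exact lt_add_one _
  have hint := hb2 y hmy
  let f : ℕ → ℝ := fun k => y * 2 ^ k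
  have hf0 : ∀ k, 0 < f k := fun k => by positivity
  have hfs : ∀ k, f (k + 1) = f k + f k := fun k => by simp only [f]; ring
  have hf : Monotone f := monotone_nat_of_le_succ fun k => by rw [hfs]; linarith [hf0 k]
  let I : ℝ → ℝ≥0∞ := fun z => rateInv b (ENNReal.ofReal z)
  have hpiece : ∀ k, I (f (k + 1)) ≤
      2 * ∫⁻ z in Set.Ioc (f k) (f (k + 1)), I z / ENNReal.ofReal z := by
    intro k
    have h1 : ∫⁻ _ in Set.Ioc (f k) (f (k + 1)), I (f (k + 1)) / ENNReal.ofReal (f (k + 1)) ≤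
        ∫⁻ z in Set.Ioc (f k) (f (k + 1)), I z / ENNReal.ofReal z := by
      refine setLIntegral_mono' measurableSet_Ioc fun z hz => ?_
      refine ENNReal.div_le_div (rateInv_anti b (ENNReal.ofReal_le_ofReal hz.2)) ?_
      exact ENNReal.ofReal_le_ofReal hz.2
    refine le_trans ?_ (mul_le_mul_right h1 2)
    have hcancel : ∀ a c : ℝ≥0∞, c ≠ 0 → c ≠ ∞ → 2 * (a / (c + c) * c) = a := by
      intro a c hc hc'
      rw [← two_mul, show 2 * (a / (2 * c) * c) = a / (2 * c) * (2 * c) by ring,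
        ENNReal.div_mul_cancel (mul_ne_zero two_ne_zero hc)
          (ENNReal.mul_ne_top ENNReal.ofNat_ne_top hc')]
    rw [setLIntegral_const, Real.volume_Ioc, show f (k + 1) - f k = f k by rw [hfs]; ring,
      show ENNReal.ofReal (f (k + 1)) = ENNReal.ofReal (f k) + ENNReal.ofReal (f k) by
        rw [hfs, ENNReal.ofReal_add (hf0 k).le (hf0 k).le],
      hcancel _ _ (ENNReal.ofReal_pos.2 (hf0 k)).ne' ENNReal.ofReal_ne_top]
  have hsum : ∑' k, I (f (k + 1)) ≠ ∞ := by
    have h1 : ∑' k, ∫⁻ z in Set.Ioc (f k) (f (k + 1)), I z / ENNReal.ofReal z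
        ≤ ∫⁻ z in Set.Ioi y, I z / ENNReal.ofReal z := by
      have hdisj : Pairwise (Function.onFun Disjoint fun k => Set.Ioc (f k) (f (k + 1))) :=
        hf.pairwise_disjoint_on_Ioc_succ
      rw [← lintegral_iUnion (fun k => measurableSet_Ioc) hdisj]
      refine lintegral_mono_set (Set.iUnion_subset fun k z hz => ?_)
      refine lt_of_le_of_lt ?_ hz.1
      have := hf (Nat.zero_le k)
      simpa [f] using this
    have h2 : ∑' k, I (f (k + 1)) ≤ 2 * ∫⁻ z in Set.Ioi y, I z / ENNReal.ofReal z := by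
      refine (ENNReal.tsum_le_tsum hpiece).trans ?_
      rw [ENNReal.tsum_mul_left]
      exact mul_le_mul_right h1 2
    exact (h2.trans_lt (ENNReal.mul_lt_top ENNReal.ofNat_lt_top hint)).ne
  have hsel : ∀ k, ∃ s : ℝ, (0 < s ∧ b s ≤ ENNReal.ofReal (f (k + 1))) ∧
      s < (I (f (k + 1))).toReal + (1 / 2) ^ k := by
    intro k
    have hfin := ENNReal.ne_top_of_tsum_ne_top hsum k
    have h1 : I (f (k + 1)) < I (f (k + 1)) + ENNReal.ofReal ((1 / 2) ^ k) :=
      ENNReal.lt_add_right hfin (ENNReal.ofReal_pos.2 (by positivity)).ne'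
    obtain ⟨s, hs⟩ := iInf_lt_iff.1 (lt_of_eq_of_lt rfl h1 : (⨅ s ∈ {s : ℝ | 0 < s ∧ b s ≤
      ENNReal.ofReal (f (k + 1))}, ENNReal.ofReal s) < _)
    obtain ⟨hs1, hs2⟩ := iInf_lt_iff.1 hs
    refine ⟨s, hs1, ?_⟩
    rw [ENNReal.ofReal_lt_iff_lt_toReal hs1.1.le (by finiteness), ENNReal.toReal_add hfin
      ENNReal.ofReal_ne_top, ENNReal.toReal_ofReal (by positivity)] at hs2
    exact hs2
  choose σ hσ hσ' using hsel
  refine ⟨2 * y, σ, by positivity, fun k => (hσ k).1, fun k => ?_, ?_⟩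
  · refine (hσ k).2.trans_eq ?_
    simp only [f]
    ring_nf
  · refine Summable.of_nonneg_of_le (fun k => (hσ k).1.le) (fun k => (hσ' k).le) ?_
    exact (ENNReal.summable_toReal hsum).add summable_geometric_two

namespace LTwo

variable {d : ℕ}

/-- A function bounded by `M φ` when tested against all square integrable functions is bounded by
`M φ`; test with the positive part of the difference. -/
theorem le_smul_of_inner_le {h φ : LTwo d} {M : ℝ}
    (H : ∀ u : LTwo d, ⟪h, u⟫_ℝ ≤ M * ⟪|u|, φ⟫_ℝ) : h ≤ M • φ := by
  rw [← sub_nonneg, ← neg_eq_zero_iff]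
  set w := M • φ - h with hw
  have hnn : 0 ≤ neg w := by
    rw [le_iff_ae]
    filter_upwards [coeFn_neg' w, Lp.coeFn_zero ℝ 2 (volume : Measure (RSpace d))] with x h1 h2
    rw [h1, h2, Pi.zero_apply]
    linarith [le_abs_self (w x)]
  have h1 := H (neg w)
  rw [abs_of_nonneg hnn] at h1
  have h2 : ⟪w, neg w⟫_ℝ = -‖neg w‖ ^ 2 := by
    rw [inner_eq_integral, norm_sq_eq_integral, ← integral_neg]
    refine integral_congr_ae ?_
    filter_upwards [coeFn_neg' w] with x hx
    simp only [hx]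
    rcases abs_cases (w x) with ⟨h4, h5⟩ | ⟨h4, h5⟩ <;> rw [h4] <;> ring
  rw [hw, inner_sub_left, real_inner_smul_left, real_inner_comm, ← hw] at h2
  have h3 : ‖neg w‖ ^ 2 = 0 := le_antisymm (by linarith) (sq_nonneg _)
  simpa using h3

end LTwo

namespace IsSemigroupOf

variable {d : ℕ} {E : LTwoForm d} {T : ℝ → LTwo d →L[ℝ] LTwo d}

/-- If the super Poincaré inequality holds along a summable sequence of scales `σ k` with constants
`y 2^k`, then the semigroup maps the weighted `L¹` space to `L²`: running for the time `σ k` takes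
the squared norm from the level `y 2^(k+1)` to the level `y 2^k`. -/
theorem exists_norm_sq_apply_le (hT : IsSemigroupOf E T) (hE : E.IsClosedForm)
    (habs : ∀ u : E.dom, ∃ h : |(u : LTwo d)| ∈ E.dom, E.form ⟨_, h⟩ ⟨_, h⟩ ≤ E.form u u)
    {φ : LTwo d} (hφ : 0 ≤ φ) {l : ℝ} (hl : 0 ≤ l)
    (heigen : ∀ t : ℝ, 0 ≤ t → T t φ = Real.exp (-l * t) • φ)
    (hinj : ∀ u : LTwo d, ⟪|u|, φ⟫_ℝ = 0 → u = 0)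
    {σ : ℕ → ℝ} (hσ : ∀ k, 0 < σ k) (hsum : Summable σ) {y : ℝ} (hy : 0 < y) {N : ℕ}
    (hsp : ∀ k, N ≤ k → ∀ f : E.dom,
      ‖(f : LTwo d)‖ ^ 2 ≤ σ k * E.form f f + y * 2 ^ k * ⟪|(f : LTwo d)|, φ⟫_ℝ ^ 2)
    {t : ℝ} (ht : 0 < t) :
    ∃ C : ℝ, 0 ≤ C ∧ ∀ u : LTwo d, ‖T t u‖ ^ 2 ≤ C * ⟪|u|, φ⟫_ℝ ^ 2 := by
  have htail : Tendsto (fun n => ∑' k, σ (k + n)) atTop (𝓝 0) := tendsto_sum_nat_add σ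
  obtain ⟨n₀, hn₀, hN⟩ := ((htail.eventually (gt_mem_nhds ht)).and (eventually_ge_atTop N)).exists
  have hS : ∀ n, 0 ≤ ∑ k ∈ Finset.range n, σ (k + n₀) := fun n =>
    Finset.sum_nonneg fun k _ => (hσ _).le
  have hSt : ∀ n, ∑ k ∈ Finset.range n, σ (k + n₀) ≤ t := fun n =>
    (((summable_nat_add_iff n₀).2 hsum).sum_le_tsum _ fun k _ => (hσ _).le).trans hn₀.le
  have hexp : Real.exp (-2) ≤ 1 / 4 := by
    rw [Real.exp_neg, one_div]
    refine inv_anti₀ (by norm_num) ?_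
    have h1 := Real.add_one_le_exp 1
    have h2 : Real.exp 2 = Real.exp 1 * Real.exp 1 := by rw [← Real.exp_add]; norm_num
    nlinarith
  have key : ∀ (n : ℕ) (m : ℝ) (v : LTwo d), 0 ≤ m → ⟪|v|, φ⟫_ℝ ≤ m →
      ‖v‖ ^ 2 ≤ 4 * (y * 2 ^ (n + n₀)) * m ^ 2 →
      ‖T (∑ k ∈ Finset.range n, σ (k + n₀)) v‖ ^ 2 ≤ 4 * (y * 2 ^ n₀) * m ^ 2 := by
    intro n
    induction n with
    | zero =>
      intro m v _ _ hv
      simpa [hT.zero_apply] using hv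
    | succ n ih =>
      intro m v hm hvm hv
      rw [Finset.sum_range_succ, hT.add_apply (hS n) (hσ _).le]
      have h0 : 0 ≤ ⟪|v|, φ⟫_ℝ := by
        simpa using LTwo.inner_le_inner_of_le (abs_nonneg v) hφ
      refine ih m _ hm ((hT.mass_apply_le hE habs hφ hl heigen (hσ _).le v).trans hvm) ?_
      have h1 := hT.norm_sq_apply_le hE habs hφ hl heigen (hσ (n + n₀))
        (b := y * 2 ^ (n + n₀)) (by positivity) (hsp (n + n₀) (by omega)) (hσ (n + n₀)).le v
      rw [mul_div_assoc, div_self (hσ (n + n₀)).ne', mul_one] at h1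
      have h2 : ⟪|v|, φ⟫_ℝ ^ 2 ≤ m ^ 2 := pow_le_pow_left₀ h0 hvm 2
      have h3 : y * 2 ^ (n + n₀) * ⟪|v|, φ⟫_ℝ ^ 2 ≤ y * 2 ^ (n + n₀) * m ^ 2 := by gcongr
      have h4 : Real.exp (-2) * ‖v‖ ^ 2 ≤ 1 / 4 * (4 * (y * 2 ^ (n + 1 + n₀)) * m ^ 2) := by gcongr
      have h5 : 1 / 4 * (4 * (y * 2 ^ (n + 1 + n₀)) * m ^ 2) = 2 * (y * 2 ^ (n + n₀) * m ^ 2) := by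
        ring
      have h6 : 0 ≤ y * 2 ^ (n + n₀) * m ^ 2 := by positivity
      linarith
  -- start at a level `y 2^(n + n₀)` above the squared norm of `u`, and descend to `y 2^n₀`
  refine ⟨4 * (y * 2 ^ n₀), by positivity, fun u => ?_⟩
  by_cases hu : ⟪|u|, φ⟫_ℝ = 0
  · rw [hinj u hu]; simp
  · have h0 : 0 ≤ ⟪|u|, φ⟫_ℝ := by
      simpa using LTwo.inner_le_inner_of_le (abs_nonneg u) hφ
    have hpos : 0 < 4 * y * ⟪|u|, φ⟫_ℝ ^ 2 := by
      have := h0.lt_of_ne' hu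
      positivity
    obtain ⟨n, hn⟩ := pow_unbounded_of_one_lt (‖u‖ ^ 2 / (4 * y * ⟪|u|, φ⟫_ℝ ^ 2)) one_lt_two
    rw [div_lt_iff₀ hpos] at hn
    have hn' : ‖u‖ ^ 2 ≤ 4 * (y * 2 ^ (n + n₀)) * ⟪|u|, φ⟫_ℝ ^ 2 := by
      have : (2 : ℝ) ^ n ≤ 2 ^ (n + n₀) := pow_le_pow_right₀ one_le_two (Nat.le_add_right _ _)
      nlinarith
    have h1 := key n _ u h0 le_rfl hn'
    refine le_trans ?_ h1
    have e : T t u = T (t - ∑ k ∈ Finset.range n, σ (k + n₀))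
        (T (∑ k ∈ Finset.range n, σ (k + n₀)) u) := by
      rw [← hT.add_apply (sub_nonneg.2 (hSt n)) (hS n), sub_add_cancel]
    rw [e]
    exact pow_le_pow_left₀ (norm_nonneg _) (hT.norm_apply_le (sub_nonneg.2 (hSt n)) _) 2

end IsSemigroupOf

/-- The `L²(φ² dx)` norm of `f` is the `L²(dx)` norm of `φ f`. -/
theorem eLpNorm_two_withDensity {d : ℕ} {φ : RSpace d → ℝ} (hφ : Continuous φ)
    (f : RSpace d → ℝ) :
    eLpNorm f 2 (volume.withDensity fun x => ENNReal.ofReal (φ x ^ 2))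
      = eLpNorm (fun x => φ x * f x) 2 volume := by
  rw [eLpNorm_eq_lintegral_rpow_enorm_toReal two_ne_zero ENNReal.ofNat_ne_top,
    eLpNorm_eq_lintegral_rpow_enorm_toReal two_ne_zero ENNReal.ofNat_ne_top,
    lintegral_withDensity_eq_lintegral_mul_non_measurable _ (by fun_prop)
      (ae_of_all _ fun x => ENNReal.ofReal_lt_top)]
  congr 2
  funext x
  simp only [Pi.mul_apply, ENNReal.toReal_ofNat, ENNReal.rpow_ofNat, enorm_mul, mul_pow]
  rw [← sq_abs (φ x), ENNReal.ofReal_pow (abs_nonneg _), ← Real.enorm_eq_ofReal_abs]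

/-- A super Poincaré inequality with integrable rate implies intrinsic ultracontractivity. -/
theorem IsSemigroupOf.intrinsicallyUltracontractive {d : ℕ} {E : LTwoForm d}
    {T : ℝ → LTwo d →L[ℝ] LTwo d} (hT : IsSemigroupOf E T) (hE : E.IsClosedForm)
    (habs : ∀ u : E.dom, ∃ h : |(u : LTwo d)| ∈ E.dom, E.form ⟨_, h⟩ ⟨_, h⟩ ≤ E.form u u)
    {φ₁ : RSpace d → ℝ} {l₁ : ℝ} (hl₁ : 0 < l₁) (hφ₁ : IsGroundState T φ₁ l₁)
    {b : ℝ → ℝ≥0∞} {r : ℝ} (hr : 0 < r) (hSP : SuperPoincare E φ₁ b r) (hb : RateIntegrable b) :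
    IntrinsicallyUltracontractive T φ₁ l₁ := by
  obtain ⟨φ, hφ, -, heigen⟩ := hφ₁.eigen
  have hφ0 : 0 ≤ φ := by
    rw [LTwo.le_iff_ae]
    filter_upwards [hφ, Lp.coeFn_zero ℝ 2 (volume : Measure (RSpace d))] with x h1 h2
    rw [h1, h2]
    exact (hφ₁.pos x).le
  have hmass : ∀ u : LTwo d, ∫ x, |u x| * φ₁ x = ⟪|u|, φ⟫_ℝ := by
    intro u
    rw [LTwo.inner_eq_integral]
    refine integral_congr_ae ?_
    filter_upwards [hφ, Lp.coeFn_abs u] with x h1 h2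
    rw [h1, h2]
  have hinj : ∀ u : LTwo d, ⟪|u|, φ⟫_ℝ = 0 → u = 0 := by
    intro u hu
    rw [LTwo.inner_eq_integral, integral_eq_zero_iff_of_nonneg_ae ?_ (LTwo.integrable_mul _ _)] at hu
    · refine Lp.ext ?_
      filter_upwards [hu, hφ, Lp.coeFn_abs u, Lp.coeFn_zero ℝ 2 (volume : Measure (RSpace d))]
        with x h1 h2 h3 h4
      rw [h3, h2, Pi.zero_apply, mul_eq_zero, abs_eq_zero] at h1
      rw [h4, Pi.zero_apply]
      exact h1.resolve_right (hφ₁.pos x).ne'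
    · filter_upwards [hφ, Lp.coeFn_abs u] with x h1 h2
      rw [h1, h2]
      exact mul_nonneg (abs_nonneg _) (hφ₁.pos x).le
  obtain ⟨y, σ, hy, hσ, hσb, hsum⟩ := hb.exists_summable
  obtain ⟨N, hN⟩ := ((hsum.tendsto_atTop_zero.eventually (gt_mem_nhds hr))).exists_forall_of_atTop
  have hsp : ∀ k, N ≤ k → ∀ f : E.dom,
      ‖(f : LTwo d)‖ ^ 2 ≤ σ k * E.form f f + y * 2 ^ k * ⟪|(f : LTwo d)|, φ⟫_ℝ ^ 2 := by
    intro k hk f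
    have h1 := hSP (σ k) (hσ k) f
    rw [min_eq_left (hN k hk).le, ← LTwo.norm_sq_eq_integral, hmass] at h1
    have hE0 : 0 ≤ σ k * E.form f f := mul_nonneg (hσ k).le (hE.nonneg f)
    have hy0 : 0 ≤ y * 2 ^ k := by positivity
    have h2 : ENNReal.ofReal (‖(f : LTwo d)‖ ^ 2) ≤
        ENNReal.ofReal (σ k * E.form f f + y * 2 ^ k * ⟪|(f : LTwo d)|, φ⟫_ℝ ^ 2) := by
      rw [ENNReal.ofReal_add hE0 (by positivity), ENNReal.ofReal_mul hy0]
      exact h1.trans (by gcongr; exact hσb k)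
    exact (ENNReal.ofReal_le_ofReal_iff (by positivity)).1 h2
  intro t ht
  obtain ⟨C, hC, hCu⟩ := hT.exists_norm_sq_apply_le hE habs hφ0 hl₁.le heigen hinj hσ hsum hy hsp ht
  refine ⟨Real.toNNReal (Real.exp (l₁ * t) * √C), fun f hf => ?_⟩
  set G : LTwo d := hf.toLp _ with hG
  -- duality: the bound from the weighted `L¹` space to `L²` is one from `L²` to functions `≤ M φ`
  have hbound : ∀ g : LTwo d, T t g ≤ (√C * ‖g‖) • φ := by
    intro g
    refine LTwo.le_smul_of_inner_le fun u => ?_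
    have h0 : 0 ≤ ⟪|u|, φ⟫_ℝ := by
      simpa using LTwo.inner_le_inner_of_le (abs_nonneg u) hφ0
    rw [hT.symm t ht.le]
    refine (real_inner_le_norm _ _).trans ?_
    have h1 : ‖T t u‖ ≤ √C * ⟪|u|, φ⟫_ℝ := by
      refine le_of_sq_le_sq ?_ (by positivity)
      rw [mul_pow, Real.sq_sqrt hC]
      exact hCu u
    nlinarith [norm_nonneg g]
  have h1 := LTwo.le_iff_ae.1 (hbound G)
  have h2 := LTwo.le_iff_ae.1 (hbound (-G))
  rw [map_neg, norm_neg] at h2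
  have habsle : ∀ᵐ x, |T t G x| ≤ √C * ‖G‖ * φ₁ x := by
    filter_upwards [h1, h2, Lp.coeFn_smul (√C * ‖G‖) φ, Lp.coeFn_neg (T t G), hφ] with x g1 g2 g3 g4 g5
    rw [g3, Pi.smul_apply, smul_eq_mul, g5] at g1 g2
    rw [g4, Pi.neg_apply] at g2
    exact abs_le.2 ⟨by linarith, g1⟩
  have hae := (withDensity_absolutelyContinuous volume
    fun x => ENNReal.ofReal (φ₁ x ^ 2)).ae_le habsle
  rw [eLpNorm_two_withDensity hφ₁.continuous, eLpNorm_exponent_top]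
  have hnorm : eLpNorm (fun x => φ₁ x * f x) 2 volume = ENNReal.ofReal ‖G‖ := by
    rw [hG, Lp.norm_toLp, ENNReal.ofReal_toReal hf.2.ne]
  have hrhs : ((Real.exp (l₁ * t) * √C).toNNReal : ℝ≥0∞) * ENNReal.ofReal ‖G‖
      = ENNReal.ofReal (Real.exp (l₁ * t) * √C * ‖G‖) := by
    rw [ENNReal.ofReal_mul (by positivity)]
    rfl
  rw [hnorm, hrhs]
  refine eLpNormEssSup_le_of_ae_bound ?_
  filter_upwards [hae] with x hx
  have hpos := hφ₁.pos x
  rw [norm_mul, norm_div, Real.norm_eq_abs, Real.norm_eq_abs, Real.norm_eq_abs, Real.abs_exp,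
    abs_of_pos hpos, div_mul_eq_mul_div, div_le_iff₀ hpos]
  have := mul_le_mul_of_nonneg_left hx (Real.exp_pos (l₁ * t)).le
  linarith

/-! ### The potential at infinity -/

section Potential

variable {d : ℕ} {V : RSpace d → ℝ≥0} {K : ℝ}

theorem nonempty_potInf_set (h : Tendsto (potInf V K) atTop atTop) (R : ℝ) :
    {x : RSpace d | R ≤ ‖x‖ ∧ K < V x}.Nonempty := by
  obtain ⟨R', hR', hRR'⟩ := ((h.eventually_gt_atTop 0).and (eventually_ge_atTop R)).exists
  by_contra hne
  have he : {x : RSpace d | R' ≤ ‖x‖ ∧ K < V x} = ∅ := by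
    rw [Set.not_nonempty_iff_eq_empty] at hne
    exact Set.subset_empty_iff.1 (hne ▸ fun x hx => ⟨hRR'.trans hx.1, hx.2⟩)
  rw [potInf, he, Set.image_empty, Real.sInf_empty] at hR'
  exact hR'.false

theorem bddBelow_potInf_set (V : RSpace d → ℝ≥0) (K R : ℝ) :
    BddBelow ((fun x => (V x : ℝ)) '' {x | R ≤ ‖x‖ ∧ K < V x}) :=
  ⟨0, by rintro _ ⟨x, -, rfl⟩; exact NNReal.coe_nonneg _⟩

theorem potInf_le {R : ℝ} {x : RSpace d} (hx : R ≤ ‖x‖) (hV : K < V x) : potInf V K R ≤ V x :=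
  csInf_le (bddBelow_potInf_set V K R) ⟨x, ⟨hx, hV⟩, rfl⟩

theorem le_potInf (h : Tendsto (potInf V K) atTop atTop) (R : ℝ) : K ≤ potInf V K R :=
  le_csInf ((nonempty_potInf_set h R).image _) (by rintro _ ⟨x, hx, rfl⟩; exact hx.2.le)

theorem monotone_potInf (h : Tendsto (potInf V K) atTop atTop) : Monotone (potInf V K) :=
  fun R R' hR => csInf_le_csInf (bddBelow_potInf_set V K R) ((nonempty_potInf_set h R').image _)
    (Set.image_mono fun _ hx => ⟨hR.trans hx.1, hx.2⟩)

theorem nonempty_potInfInv_set (h : Tendsto (potInf V K) atTop atTop) (r₀ t : ℝ) :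
    {R | r₀ ≤ R ∧ t ≤ potInf V K R}.Nonempty :=
  ((eventually_ge_atTop r₀).and (h.eventually_ge_atTop t)).exists

theorem bddBelow_potInfInv_set (V : RSpace d → ℝ≥0) (K r₀ t : ℝ) :
    BddBelow {R | r₀ ≤ R ∧ t ≤ potInf V K R} := ⟨r₀, fun _ hR => hR.1⟩

theorem le_potInfInv (h : Tendsto (potInf V K) atTop atTop) (r₀ t : ℝ) :
    r₀ ≤ potInfInv V K r₀ t :=
  le_csInf (nonempty_potInfInv_set h r₀ t) fun _ hR => hR.1

theorem monotone_potInfInv (h : Tendsto (potInf V K) atTop atTop) (r₀ : ℝ) :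
    Monotone (potInfInv V K r₀) := fun t t' ht =>
  csInf_le_csInf (bddBelow_potInfInv_set V K r₀ t) (nonempty_potInfInv_set h r₀ t')
    fun _ hR => ⟨hR.1, ht.trans hR.2⟩

theorem le_potInfInv_of_lt (h : Tendsto (potInf V K) atTop atTop) {r₀ R t : ℝ}
    (hR : potInf V K R < t) : R ≤ potInfInv V K r₀ t := by
  refine le_csInf (nonempty_potInfInv_set h r₀ t) fun R' hR' => ?_
  by_contra! hlt
  exact absurd (hR'.2.trans (monotone_potInf h hlt.le)) (not_le.2 hR)

theorem lt_of_lt_potInfInv {r₀ R t : ℝ} (hr : r₀ ≤ R) (hR : R < potInfInv V K r₀ t) :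
    potInf V K R < t := by
  by_contra! hle
  exact absurd (csInf_le (bddBelow_potInfInv_set V K r₀ t) ⟨hr, hle⟩) (not_le.2 hR)

theorem le_potential_of_potInfInv_lt (h : Tendsto (potInf V K) atTop atTop) {r₀ t : ℝ}
    {x : RSpace d} (hx : potInfInv V K r₀ t < ‖x‖) (hV : K < V x) : t ≤ V x := by
  obtain ⟨R, hR, hR'⟩ := exists_lt_of_csInf_lt (nonempty_potInfInv_set h r₀ t) hx
  exact hR.2.trans ((monotone_potInf h hR'.le).trans (potInf_le le_rfl hV))

theorem volume_low_lt_top (hA2 : ∀ r : ℝ, 0 < r → volume {x : RSpace d | (V x : ℝ) ≤ r} < ∞)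
    (hK : 0 < K) (R : ℝ) : volume {x : RSpace d | R ≤ ‖x‖ ∧ (V x : ℝ) ≤ K} < ∞ :=
  (measure_mono fun _ hx => hx.2).trans_lt (hA2 K hK)

theorem antitone_lowVol (hA2 : ∀ r : ℝ, 0 < r → volume {x : RSpace d | (V x : ℝ) ≤ r} < ∞)
    (hK : 0 < K) : Antitone (lowVol V K) := fun R _ hR =>
  ENNReal.toReal_mono (volume_low_lt_top hA2 hK R).ne
    (measure_mono fun _ hx => ⟨hR.trans hx.1, hx.2⟩)

theorem lowVol_nonneg (V : RSpace d → ℝ≥0) (K R : ℝ) : 0 ≤ lowVol V K R := ENNReal.toReal_nonneg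

theorem measurableSet_low (hV : Measurable V) (K R : ℝ) :
    MeasurableSet {x : RSpace d | R ≤ ‖x‖ ∧ (V x : ℝ) ≤ K} :=
  (measurableSet_le measurable_const measurable_norm).inter
    (measurableSet_le hV.coe_nnreal_real measurable_const)

theorem tendsto_lowVol (hV : Measurable V)
    (hA2 : ∀ r : ℝ, 0 < r → volume {x : RSpace d | (V x : ℝ) ≤ r} < ∞) (hK : 0 < K) :
    Tendsto (lowVol V K) atTop (𝓝 0) := by
  have h1 := tendsto_measure_iInter_atTop (μ := volume)
    (s := fun R : ℝ => {x : RSpace d | R ≤ ‖x‖ ∧ (V x : ℝ) ≤ K})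
    (fun R => (measurableSet_low hV K R).nullMeasurableSet)
    (fun R R' hR x hx => ⟨hR.trans hx.1, hx.2⟩) ⟨0, (volume_low_lt_top hA2 hK 0).ne⟩
  have h2 : ⋂ R : ℝ, {x : RSpace d | R ≤ ‖x‖ ∧ (V x : ℝ) ≤ K} = ∅ := by
    refine Set.eq_empty_of_forall_notMem fun x hx => ?_
    have := (Set.mem_iInter.1 hx (‖x‖ + 1)).1
    linarith
  rw [h2, measure_empty] at h1
  have h3 := (ENNReal.tendsto_toReal ENNReal.zero_ne_top).comp h1
  rw [ENNReal.toReal_zero] at h3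
  exact h3

/-- `Θ` is left-continuous, as the infimum defining it runs over a closed condition. -/
theorem exists_lowVol_lt (hV : Measurable V)
    (hA2 : ∀ r : ℝ, 0 < r → volume {x : RSpace d | (V x : ℝ) ≤ r} < ∞) (hK : 0 < K) (R : ℝ)
    {ε : ℝ} (hε : 0 < ε) : ∃ R' < R, lowVol V K R' < lowVol V K R + ε := by
  let r : ℕ → ℝ := fun n => R - 1 / ((n : ℝ) + 1)
  have hr : ∀ n, r n < R := fun n => sub_lt_self _ (by positivity)
  have hrm : Monotone r := fun m n hmn => by
    have : 1 / ((n : ℝ) + 1) ≤ 1 / ((m : ℝ) + 1) :=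
      one_div_le_one_div_of_le (by positivity) (by gcongr)
    simp only [r]; linarith
  have h1 := tendsto_measure_iInter_atTop (μ := volume)
    (s := fun n : ℕ => {x : RSpace d | r n ≤ ‖x‖ ∧ (V x : ℝ) ≤ K})
    (fun R => (measurableSet_low hV K _).nullMeasurableSet)
    (fun m n hmn x hx => ⟨(hrm hmn).trans hx.1, hx.2⟩) ⟨0, (volume_low_lt_top hA2 hK _).ne⟩
  have h2 : ⋂ n : ℕ, {x : RSpace d | r n ≤ ‖x‖ ∧ (V x : ℝ) ≤ K}
      = {x : RSpace d | R ≤ ‖x‖ ∧ (V x : ℝ) ≤ K} := by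
    ext x
    rw [Set.mem_iInter]
    refine ⟨fun hx => ⟨?_, (hx 0).2⟩, fun hx n => ⟨(hr n).le.trans hx.1, hx.2⟩⟩
    have h3 : Tendsto r atTop (𝓝 (R - 0)) := tendsto_one_div_add_atTop_nhds_zero_nat.const_sub R
    rw [sub_zero] at h3
    exact le_of_tendsto' h3 fun n => (hx n).1
  rw [h2] at h1
  have h4 : Tendsto (fun n => lowVol V K (r n)) atTop (𝓝 (lowVol V K R)) :=
    (ENNReal.tendsto_toReal (volume_low_lt_top hA2 hK R).ne).comp h1
  obtain ⟨n, hn⟩ := (h4.eventually (gt_mem_nhds (lt_add_of_pos_right _ hε))).exists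
  exact ⟨r n, hr n, hn⟩

end Potential

/-! ### The super Poincaré inequality with a tail term -/

/-- The local intrinsic super Poincaré inequality for the form with killing, with the reference
function already replaced by `C₀ φ₁`, together with the standing assumptions on the potential. -/
structure LocalSuperPoincare {d : ℕ} (D : RegularDirichletForm d) (V : RSpace d → ℝ≥0)
    (φ₁ : RSpace d → ℝ) (K r₀ C₀ : ℝ) (α : ℝ → ℝ → ℝ) : Prop where
  meas : Measurable V
  volume_lt_top : ∀ r : ℝ, 0 < r → volume {x : RSpace d | (V x : ℝ) ≤ r} < ∞
  K_pos : 0 < K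
  tendsto : Tendsto (potInf V K) atTop atTop
  r₀_pos : 0 < r₀
  α_nonneg : ∀ r s : ℝ, 0 < r → 0 < s → 0 ≤ α r s
  ineq : ∀ r : ℝ, r₀ ≤ r → ∀ s : ℝ, 0 < s → ∀ f : (D.killed V).dom,
    ∫ x in Metric.ball (0 : RSpace d) r, (f : LTwo d) x ^ 2
      ≤ s * (D.killed V).form f f + C₀ ^ 2 * α r s * (∫ x, |(f : LTwo d) x| * φ₁ x) ^ 2

namespace LocalSuperPoincare

variable {d : ℕ} {D : RegularDirichletForm d} {V : RSpace d → ℝ≥0} {φ₁ : RSpace d → ℝ}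
  {K r₀ C₀ : ℝ} {α : ℝ → ℝ → ℝ}

theorem integral_sq_eq (hV : Measurable V) (K R : ℝ) (f : LTwo d) :
    ∫ x, f x ^ 2 = (∫ x in Metric.ball (0 : RSpace d) R, f x ^ 2) +
      (∫ x in {x : RSpace d | R ≤ ‖x‖ ∧ K < V x}, f x ^ 2) +
      ∫ x in {x : RSpace d | R ≤ ‖x‖ ∧ (V x : ℝ) ≤ K}, f x ^ 2 := by
  have hi := LTwo.integrable_sq f
  have hm : MeasurableSet {x : RSpace d | (V x : ℝ) ≤ K} :=
    measurableSet_le hV.coe_nnreal_real measurable_const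
  rw [← integral_add_compl (measurableSet_ball (x := (0 : RSpace d)) (ε := R)) hi, add_assoc,
    ← integral_inter_add_sdiff (s := (Metric.ball (0 : RSpace d) R)ᶜ) hm hi.integrableOn,
    add_comm (∫ x in _ ∩ _, _)]
  have e1 : (Metric.ball (0 : RSpace d) R)ᶜ \ {x : RSpace d | (V x : ℝ) ≤ K}
      = {x : RSpace d | R ≤ ‖x‖ ∧ K < V x} := by
    ext x; simp
  have e2 : (Metric.ball (0 : RSpace d) R)ᶜ ∩ {x : RSpace d | (V x : ℝ) ≤ K}
      = {x : RSpace d | R ≤ ‖x‖ ∧ (V x : ℝ) ≤ K} := by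
    ext x; simp
  rw [e1, e2]

/-- Chebyshev's inequality for the potential. -/
theorem setIntegral_sq_le {A : Set (RSpace d)} (hA : MeasurableSet A) {t : ℝ} (ht : 0 < t)
    (h : ∀ᵐ x, x ∈ A → t ≤ V x) (f : (D.killed V).dom) :
    ∫ x in A, (f : LTwo d) x ^ 2 ≤ 1 / t * (D.killed V).form f f := by
  have hi := LTwo.integrable_sq (f : LTwo d)
  have hiV := RegularDirichletForm.integrable_potential f
  calc ∫ x in A, (f : LTwo d) x ^ 2 ≤ ∫ x in A, 1 / t * ((V x : ℝ) * (f : LTwo d) x ^ 2) := by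
        refine setIntegral_mono_on_ae hi.integrableOn (hiV.const_mul _).integrableOn hA ?_
        filter_upwards [h] with x hx hxA
        have h1 := hx hxA
        rw [one_div_mul_eq_div, le_div_iff₀ ht, mul_comm]
        exact mul_le_mul_of_nonneg_right h1 (sq_nonneg _)
    _ ≤ ∫ x, 1 / t * ((V x : ℝ) * (f : LTwo d) x ^ 2) :=
        setIntegral_le_integral (hiV.const_mul _) (ae_of_all _ fun x => by positivity)
    _ ≤ _ := by
        rw [integral_const_mul]
        have := RegularDirichletForm.integral_potential_le f
        gcongr

theorem measurableSet_high (hV : Measurable V) (K R : ℝ) :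
    MeasurableSet {x : RSpace d | R ≤ ‖x‖ ∧ K < V x} :=
  (measurableSet_le measurable_const measurable_norm).inter
    (measurableSet_lt measurable_const hV.coe_nnreal_real)

theorem ae_norm_ne {R : ℝ} (hR : 0 < R) : ∀ᵐ x : RSpace d, ‖x‖ ≠ R := by
  have h := Measure.addHaar_sphere_of_ne_zero (volume : Measure (RSpace d)) 0 hR.ne'
  rw [← compl_mem_ae_iff] at h
  filter_upwards [h] with x hx hxR
  exact hx (by simpa using hxR)

/-- The super Poincaré inequality of the form with killing, up to the mass of `f²` on the far part
of the set where the potential is small. -/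
theorem norm_sq_le (h : LocalSuperPoincare D V φ₁ K r₀ C₀ α) {s : ℝ} (hs : 0 < s)
    (f : (D.killed V).dom) :
    ‖(f : LTwo d)‖ ^ 2 ≤ s * (D.killed V).form f f
      + rateBeta V K r₀ C₀ α s * (∫ x, |(f : LTwo d) x| * φ₁ x) ^ 2
      + ∫ x in {x : RSpace d | potInfInv V K r₀ (2 / s) ≤ ‖x‖ ∧ (V x : ℝ) ≤ K},
          (f : LTwo d) x ^ 2 := by
  set R := potInfInv V K r₀ (2 / s)
  have hR : r₀ ≤ R := le_potInfInv h.tendsto _ _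
  have h1 := h.ineq R hR (s / 2) (half_pos hs) f
  have h2 := setIntegral_sq_le (D := D) (measurableSet_high h.meas K R) (t := 2 / s) (by positivity)
    (by
      filter_upwards [ae_norm_ne (h.r₀_pos.trans_le hR)] with x hx hxA
      exact le_potential_of_potInfInv_lt h.tendsto (lt_of_le_of_ne hxA.1 (Ne.symm hx)) hxA.2) f
  rw [one_div_div] at h2
  rw [LTwo.norm_sq_eq_integral, integral_sq_eq h.meas K R, rateBeta]
  linarith

theorem rateBeta_nonneg (h : LocalSuperPoincare D V φ₁ K r₀ C₀ α) {s : ℝ} (hs : 0 < s) :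
    0 ≤ rateBeta V K r₀ C₀ α s :=
  mul_nonneg (sq_nonneg _)
    (h.α_nonneg _ _ (h.r₀_pos.trans_le (le_potInfInv h.tendsto _ _)) (half_pos hs))

end LocalSuperPoincare

theorem lpExponent_pos {p : ℝ≥0∞} (hp : 2 < p) : 0 < lpExponent p := by
  rw [lpExponent]
  split_ifs with h
  · exact one_pos
  · have h2 : 2 < p.toReal := by
      have := (ENNReal.toReal_lt_toReal ENNReal.ofNat_ne_top h).2 hp
      simpa using this
    exact div_pos (by linarith) (by linarith)

/-- Hölder's inequality on a set of finite measure. -/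
theorem setIntegral_sq_le_eLpNorm {d : ℕ} {A : Set (RSpace d)} (hA : volume A < ∞) {p : ℝ≥0∞}
    (hp : 2 < p) (f : LTwo d) :
    ENNReal.ofReal (∫ x in A, f x ^ 2)
      ≤ ENNReal.ofReal ((volume A).toReal ^ lpExponent p) * eLpNorm f p volume ^ 2 := by
  have h1 : ENNReal.ofReal (∫ x in A, f x ^ 2) = eLpNorm f 2 (volume.restrict A) ^ 2 := by
    rw [ofReal_integral_eq_lintegral_ofReal (LTwo.integrable_sq f).integrableOn
        (ae_of_all _ fun x => sq_nonneg _),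
      eLpNorm_eq_lintegral_rpow_enorm_toReal two_ne_zero ENNReal.ofNat_ne_top,
      ENNReal.toReal_ofNat, ← ENNReal.rpow_two, ← ENNReal.rpow_mul, one_div,
      inv_mul_cancel₀ two_ne_zero, ENNReal.rpow_one]
    refine lintegral_congr fun x => ?_
    rw [ENNReal.rpow_two, ← sq_abs, ENNReal.ofReal_pow (abs_nonneg _), Real.enorm_eq_ofReal_abs]
  have h2 := eLpNorm_le_eLpNorm_mul_rpow_measure_univ (μ := volume.restrict A) hp.le
    (Lp.aestronglyMeasurable f).restrict
  rw [Measure.restrict_apply_univ] at h2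
  have h3 : eLpNorm f p (volume.restrict A) ≤ eLpNorm f p volume :=
    eLpNorm_mono_measure _ Measure.restrict_le_self
  have h4 : (volume A ^ (1 / (2 : ℝ≥0∞).toReal - 1 / p.toReal)) ^ 2
      = ENNReal.ofReal ((volume A).toReal ^ lpExponent p) := by
    rw [← ENNReal.ofReal_rpow_of_nonneg ENNReal.toReal_nonneg (lpExponent_pos hp).le,
      ENNReal.ofReal_toReal hA.ne, ← ENNReal.rpow_two, ← ENNReal.rpow_mul]
    congr 1
    rw [lpExponent]
    split_ifs with h
    · simp [h]
    · have : p.toReal ≠ 0 := (ENNReal.toReal_pos (by positivity) h).ne'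
      rw [ENNReal.toReal_ofNat]
      field_simp
  rw [h1, ← h4, mul_comm, ← mul_pow]
  exact pow_le_pow_left' (h2.trans (mul_le_mul_left h3 _)) 2

theorem SuperPoincare.of_le {d : ℕ} {E : LTwoForm d} (hE : E.IsClosedForm) {φ₁ : RSpace d → ℝ}
    {b : ℝ → ℝ≥0∞} {r : ℝ} (hr : 0 < r)
    (h : ∀ s : ℝ, 0 < s → s ≤ r → ∀ f : E.dom, ENNReal.ofReal (∫ x, (f : LTwo d) x ^ 2)
      ≤ ENNReal.ofReal (s * E.form f f)
        + b s * ENNReal.ofReal ((∫ x, |(f : LTwo d) x| * φ₁ x) ^ 2)) :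
    SuperPoincare E φ₁ b r := by
  intro s hs f
  refine (h (min s r) (lt_min hs hr) (min_le_right _ _) f).trans ?_
  gcongr
  · exact hE.nonneg f
  · exact min_le_left _ _

theorem SuperPoincare.of_real_le {d : ℕ} {E : LTwoForm d} (hE : E.IsClosedForm)
    {φ₁ : RSpace d → ℝ} {b : ℝ → ℝ} {r : ℝ} (hr : 0 < r)
    (hb : ∀ s : ℝ, 0 < s → 0 ≤ b s)
    (h : ∀ s : ℝ, 0 < s → s ≤ r → ∀ f : E.dom, ‖(f : LTwo d)‖ ^ 2
      ≤ s * E.form f f + b s * (∫ x, |(f : LTwo d) x| * φ₁ x) ^ 2) :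
    SuperPoincare E φ₁ (fun s => ENNReal.ofReal (b s)) r := by
  refine SuperPoincare.of_le hE hr fun s hs hsr f => ?_
  rw [← LTwo.norm_sq_eq_integral, ← ENNReal.ofReal_mul (hb s hs),
    ← ENNReal.ofReal_add (mul_nonneg hs.le (hE.nonneg f)) (mul_nonneg (hb s hs) (sq_nonneg _))]
  exact ENNReal.ofReal_le_ofReal (h s hs hsr f)

namespace LocalSuperPoincare

variable {d : ℕ} {D : RegularDirichletForm d} {V : RSpace d → ℝ≥0} {φ₁ : RSpace d → ℝ}
  {K r₀ C₀ : ℝ} {α : ℝ → ℝ → ℝ}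

theorem mixed (h : LocalSuperPoincare D V φ₁ K r₀ C₀ α) {s s' : ℝ} (hs' : 0 < s') (hss' : s' ≤ s)
    (f : (D.killed V).dom) {p : ℝ≥0∞} (hp : 2 < p) :
    ENNReal.ofReal (∫ x, (f : LTwo d) x ^ 2)
      ≤ ENNReal.ofReal (s * (D.killed V).form f f)
        + ENNReal.ofReal (rateBeta V K r₀ C₀ α s' * (∫ x, |(f : LTwo d) x| * φ₁ x) ^ 2)
        + ENNReal.ofReal (rateGamma V K r₀ s' ^ lpExponent p)
          * eLpNorm (f : LTwo d) p volume ^ 2 := by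
  have h1 := h.norm_sq_le hs' f
  rw [LTwo.norm_sq_eq_integral] at h1
  have hE := RegularDirichletForm.isClosedForm_killed.nonneg f
  have hb := h.rateBeta_nonneg hs'
  refine (ENNReal.ofReal_le_ofReal h1).trans ?_
  refine ENNReal.ofReal_add_le.trans (add_le_add (ENNReal.ofReal_add_le.trans ?_) ?_)
  · gcongr
  · exact setIntegral_sq_le_eLpNorm (volume_low_lt_top h.volume_lt_top h.K_pos _) hp _

theorem superPoincare_of_tendsto (h : LocalSuperPoincare D V φ₁ K r₀ C₀ α)
    (hV : Tendsto (fun x => (V x : ℝ)) (cocompact (RSpace d)) atTop) :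
    ∃ r : ℝ, 0 < r ∧
      SuperPoincare (D.killed V) φ₁ (fun s => ENNReal.ofReal (rateBeta V K r₀ C₀ α s)) r := by
  obtain ⟨R, hR⟩ : ∃ R : ℝ, ∀ x : RSpace d, R ≤ ‖x‖ → K < V x := by
    have h1 := hV.eventually_gt_atTop K
    rw [← Metric.cobounded_eq_cocompact, ← comap_norm_atTop (E := RSpace d), eventually_comap,
      eventually_atTop] at h1
    obtain ⟨R, hR⟩ := h1
    exact ⟨R, fun x hx => hR _ hx x rfl⟩
  have hpos : 0 < potInf V K R := h.K_pos.trans_le (le_potInf h.tendsto R)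
  refine ⟨1 / potInf V K R, by positivity, ?_⟩
  refine SuperPoincare.of_real_le RegularDirichletForm.isClosedForm_killed (by positivity)
    (fun s hs => h.rateBeta_nonneg hs) fun s hs hsr f => ?_
  have h1 : potInf V K R < 2 / s := by
    rw [le_div_iff₀ hpos] at hsr
    rw [lt_div_iff₀ hs]
    linarith
  have h2 := h.norm_sq_le hs f
  have h3 : {x : RSpace d | potInfInv V K r₀ (2 / s) ≤ ‖x‖ ∧ (V x : ℝ) ≤ K} = ∅ := by
    refine Set.eq_empty_of_forall_notMem fun x hx => ?_
    exact absurd hx.2 (not_le.2 (hR x ((le_potInfInv_of_lt h.tendsto h1).trans hx.1)))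
  rw [h3, setIntegral_empty, add_zero] at h2
  exact h2

end LocalSuperPoincare

/-! ### Smooth functions are dense in the domain of the form with killing -/

section Convolution

open scoped Pointwise

variable {d : ℕ}

/-- The convolution of the restriction of `k` to the unit ball with `f`. -/
noncomputable def ballConvolution (f k : RSpace d → ℝ) : RSpace d → ℝ :=
  MeasureTheory.convolution ((Metric.ball (0 : RSpace d) 1).indicator k) f
    (ContinuousLinearMap.lsmul ℝ ℝ) volume

theorem ballConvolution_apply (f k : RSpace d → ℝ) (x : RSpace d) :
    ballConvolution f k x = ∫ t, (Metric.ball (0 : RSpace d) 1).indicator k t * f (x - t) := rfl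

theorem integrable_ballConvolution {f k : RSpace d → ℝ} (hf : Continuous f)
    (hfc : HasCompactSupport f) (hk : Integrable k) (x : RSpace d) :
    Integrable fun t => (Metric.ball (0 : RSpace d) 1).indicator k t * f (x - t) :=
  hfc.convolutionExists_right (ContinuousLinearMap.lsmul ℝ ℝ)
    (hk.indicator measurableSet_ball).locallyIntegrable hf x

theorem hasCompactSupport_ballConvolution {f : RSpace d → ℝ} (hfc : HasCompactSupport f)
    (k : RSpace d → ℝ) : HasCompactSupport (ballConvolution f k) := by
  refine HasCompactSupport.convolution _ ?_ hfc
  refine HasCompactSupport.of_support_subset_isCompact (isCompact_closedBall (0 : RSpace d) 1) ?_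
  exact (Set.support_indicator_subset).trans Metric.ball_subset_closedBall

theorem contDiff_ballConvolution {f k : RSpace d → ℝ} (hf : ContDiff ℝ 2 f)
    (hfc : HasCompactSupport f) (hk : Integrable k) : ContDiff ℝ 2 (ballConvolution f k) :=
  hfc.contDiff_convolution_right (n := 2) _ (hk.indicator measurableSet_ball).locallyIntegrable hf

theorem abs_ballConvolution_le {f k : RSpace d → ℝ} {B : ℝ} (hB : ∀ x, |f x| ≤ B)
    (hk : Integrable k) (x : RSpace d) :
    |ballConvolution f k x| ≤
      (Metric.closedBall (0 : RSpace d) 1 + tsupport f).indicator (fun _ => B * ∫ t, |k t|) x := by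
  by_cases hx : x ∈ Metric.closedBall (0 : RSpace d) 1 + tsupport f
  · rw [Set.indicator_of_mem hx, ballConvolution_apply, ← integral_const_mul, ← Real.norm_eq_abs]
    refine norm_integral_le_of_norm_le (hk.abs.const_mul B) (ae_of_all _ fun t => ?_)
    rw [norm_mul, Real.norm_eq_abs, Real.norm_eq_abs, mul_comm]
    refine mul_le_mul (hB _) ?_ (abs_nonneg _) ((abs_nonneg _).trans (hB x))
    by_cases ht : t ∈ Metric.ball (0 : RSpace d) 1
    · rw [Set.indicator_of_mem ht]
    · rw [Set.indicator_of_notMem ht, abs_zero]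
      exact abs_nonneg _
  · rw [Set.indicator_of_notMem hx]
    have h0 : ballConvolution f k x = 0 := by
      by_contra hne
      have h1 := support_convolution_subset (ContinuousLinearMap.lsmul ℝ ℝ) (μ := volume)
        (Function.mem_support.2 hne)
      refine hx (Set.add_subset_add ?_ (subset_tsupport f) h1)
      exact (Set.support_indicator_subset).trans Metric.ball_subset_closedBall
    rw [h0, abs_zero]

end Convolution

namespace RegularDirichletForm

open scoped Pointwise

variable {d : ℕ} {D : RegularDirichletForm d} {V : RSpace d → ℝ≥0}

/-- Convolution of a fixed `C_c^2` function with an integrable function, as an element of the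
domain of the form with killing. -/
theorem exists_convolution_map (hV : Measurable V)
    (hVloc : ∀ S : Set (RSpace d), IsCompact S → ∃ M : ℝ, ∀ x ∈ S, (V x : ℝ) ≤ M)
    {f : RSpace d → ℝ} (hf : ContDiff ℝ 2 f) (hfc : HasCompactSupport f) :
    ∃ A : Lp ℝ 1 (volume : Measure (RSpace d)) →ₗ[ℝ] (D.killed V).dom,
      ∀ k, (A k : LTwo d) =ᵐ[volume] ballConvolution f k := by
  have hk : ∀ k : Lp ℝ 1 (volume : Measure (RSpace d)), Integrable k := fun k =>
    L1.integrable_coeFn k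
  have hmem : ∀ k : Lp ℝ 1 (volume : Measure (RSpace d)), MemLp (ballConvolution f k) 2 volume :=
    fun k => (contDiff_ballConvolution hf hfc (hk k)).continuous.memLp_of_hasCompactSupport
      (hasCompactSupport_ballConvolution hfc k)
  have hdom : ∀ k, (hmem k).toLp _ ∈ (D.killed V).dom := fun k =>
    ccClass_subset_killed_dom hV hVloc ⟨_, contDiff_ballConvolution hf hfc (hk k),
      hasCompactSupport_ballConvolution hfc k, (hmem k).coeFn_toLp⟩
  refine ⟨{ toFun := fun k => ⟨_, hdom k⟩, map_add' := fun k l => ?_, map_smul' := fun c k => ?_ },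
    fun k => (hmem k).coeFn_toLp⟩
  · refine Subtype.ext (Lp.ext ?_)
    filter_upwards [(hmem (k + l)).coeFn_toLp, (hmem k).coeFn_toLp, (hmem l).coeFn_toLp,
      Lp.coeFn_add ((hmem k).toLp _) ((hmem l).toLp _)] with x h1 h2 h3 h4
    rw [Submodule.coe_add, h4, Pi.add_apply, h1, h2, h3, ballConvolution_apply,
      ballConvolution_apply, ballConvolution_apply,
      ← integral_add (integrable_ballConvolution hf.continuous hfc (hk k) x)
        (integrable_ballConvolution hf.continuous hfc (hk l) x)]
    refine integral_congr_ae ?_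
    filter_upwards [Lp.coeFn_add k l] with t ht
    by_cases hb : t ∈ Metric.ball (0 : RSpace d) 1
    · simp only [Set.indicator_of_mem hb, ht, Pi.add_apply, add_mul]
    · simp only [Set.indicator_of_notMem hb, zero_mul, add_zero]
  · refine Subtype.ext (Lp.ext ?_)
    filter_upwards [(hmem (c • k)).coeFn_toLp, (hmem k).coeFn_toLp,
      Lp.coeFn_smul c ((hmem k).toLp _)] with x h1 h2 h3
    rw [RingHom.id_apply, Submodule.coe_smul, h3, Pi.smul_apply, h1, h2, ballConvolution_apply,
      ballConvolution_apply, smul_eq_mul, ← integral_const_mul]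
    refine integral_congr_ae ?_
    filter_upwards [Lp.coeFn_smul c k] with t ht
    by_cases hb : t ∈ Metric.ball (0 : RSpace d) 1
    · simp only [Set.indicator_of_mem hb, ht, Pi.smul_apply, smul_eq_mul, mul_assoc]
    · simp only [Set.indicator_of_notMem hb, zero_mul, mul_zero]

/-- The energy of the convolution of a `C_c^2` function `f` with `k` is controlled by the `L¹` norm
of `k`, although nothing is known about the dependence of the form on derivatives: the energy norm
is a lower semicontinuous seminorm of `k` in the Banach space `L¹`. -/
theorem exists_convolution_bound (hV : Measurable V)
    (hVloc : ∀ S : Set (RSpace d), IsCompact S → ∃ M : ℝ, ∀ x ∈ S, (V x : ℝ) ≤ M)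
    {f : RSpace d → ℝ} (hf : ContDiff ℝ 2 f) (hfc : HasCompactSupport f) :
    ∃ (A : Lp ℝ 1 (volume : Measure (RSpace d)) →ₗ[ℝ] (D.killed V).dom) (C : ℝ),
      (∀ k, (A k : LTwo d) =ᵐ[volume] ballConvolution f k) ∧
      ∀ k, √((D.killed V).form (A k) (A k)) ≤ C * ‖k‖ := by
  obtain ⟨A, hA⟩ := exists_convolution_map (D := D) hV hVloc hf hfc
  have hE := D.isClosedForm_killed (V := V)
  obtain ⟨B, hB⟩ := hfc.exists_bound_of_continuous hf.continuous
  set S := Metric.closedBall (0 : RSpace d) 1 + tsupport f with hS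
  have hSc : IsCompact S := (isCompact_closedBall _ _).add hfc
  let g : LTwo d := indicatorConstLp 2 hSc.measurableSet hSc.measure_lt_top.ne B
  have hAg : ∀ k, ‖(A k : LTwo d)‖ ≤ ‖g‖ * ‖k‖ := by
    intro k
    have h1 : ‖(A k : LTwo d)‖ ≤ ‖(‖k‖ • g : LTwo d)‖ := by
      refine Lp.norm_le_norm_of_ae_le ?_
      filter_upwards [hA k, Lp.coeFn_smul ‖k‖ g, indicatorConstLp_coeFn (p := 2)
        (hs := hSc.measurableSet) (hμs := hSc.measure_lt_top.ne) (c := B)] with x h2 h3 h4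
      rw [h2, h3, Pi.smul_apply, h4, Real.norm_eq_abs]
      refine (abs_ballConvolution_le (fun x => hB x) (L1.integrable_coeFn k) x).trans ?_
      refine le_trans (le_of_eq ?_) (le_abs_self _)
      by_cases hx : x ∈ S
      · rw [Set.indicator_of_mem hx, Set.indicator_of_mem hx, L1.norm_eq_integral_norm, smul_eq_mul,
          mul_comm]
        rfl
      · rw [Set.indicator_of_notMem hx, Set.indicator_of_notMem hx, smul_zero]
    rwa [norm_smul, norm_norm, mul_comm] at h1
  have hAc : Continuous fun k => (A k : LTwo d) := by
    let A' : Lp ℝ 1 (volume : Measure (RSpace d)) →ₗ[ℝ] LTwo d := (D.killed V).dom.subtype ∘ₗ A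
    exact (A'.mkContinuous ‖g‖ hAg).continuous
  let p : Seminorm ℝ (Lp ℝ 1 (volume : Measure (RSpace d))) :=
    Seminorm.of (fun k => √((D.killed V).form (A k) (A k)))
      (fun k l => by rw [map_add]; exact hE.sqrt_form_add_le _ _)
      (fun c k => by
        rw [map_smul, LTwoForm.IsClosedForm.form_smul_self, Real.sqrt_mul (sq_nonneg c),
          Real.sqrt_sq_eq_abs, Real.norm_eq_abs])
  have hp : LowerSemicontinuous p := by
    refine lowerSemicontinuous_iff_isClosed_preimage.2 fun y => ?_
    refine IsSeqClosed.isClosed fun k l hk hkl => ?_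
    have hk' : ∀ n, √((D.killed V).form (A (k n)) (A (k n))) ≤ y := hk
    have hy : 0 ≤ y := (Real.sqrt_nonneg _).trans (hk' 0)
    obtain ⟨h1, h2⟩ := hE.mem_dom_of_tendsto (fun n => A (k n)) (A l : LTwo d) (y ^ 2)
      (fun n => (Real.sqrt_le_left hy).1 (hk' n)) ((hAc.tendsto l).comp hkl)
    exact (Real.sqrt_le_left hy).2 h2
  have hpc : Continuous p := Seminorm.continuous_of_lowerSemicontinuous p hp
  obtain ⟨C, -, hC⟩ := Seminorm.bound_of_continuous_normedSpace p hpc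
  exact ⟨A, C, hA, hC⟩

/-- Every function in `C_c^2` is a limit of functions in `C_c^∞` for the form norm: its
mollifications have bounded energy. -/
theorem exists_smooth_approx_of_mem_ccClass (hV : Measurable V)
    (hVloc : ∀ S : Set (RSpace d), IsCompact S → ∃ M : ℝ, ∀ x ∈ S, (V x : ℝ) ≤ M)
    (u : (D.killed V).dom) (hu : (u : LTwo d) ∈ ccClass d 2) {ε : ℝ} (hε : 0 < ε) :
    ∃ g : (D.killed V).dom, (g : LTwo d) ∈ ccClass d ((⊤ : ℕ∞) : WithTop ℕ∞) ∧
      (D.killed V).form (u - g) (u - g) + ‖(u - g : (D.killed V).dom)‖ ^ 2 < ε := by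
  obtain ⟨f, hf, hfc, huf⟩ := hu
  obtain ⟨A, C, hA, hC⟩ := exists_convolution_bound (D := D) hV hVloc hf hfc
  let η : ℕ → ContDiffBump (0 : RSpace d) := fun n =>
    ⟨1 / ((n : ℝ) + 1) / 2, 1 / ((n : ℝ) + 1), by positivity, half_lt_self (by positivity)⟩
  have hηi : ∀ n, Integrable ((η n).normed volume) := fun n => (η n).integrable_normed
  let k : ℕ → Lp ℝ 1 (volume : Measure (RSpace d)) := fun n => (hηi n).toL1 _
  have hkη : ∀ n, k n =ᵐ[volume] (η n).normed volume := fun n => (hηi n).coeFn_toL1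
  have hknorm : ∀ n, ‖k n‖ = 1 := by
    intro n
    rw [L1.norm_eq_integral_norm, ← (η n).integral_normed (μ := volume)]
    refine integral_congr_ae ?_
    filter_upwards [hkη n] with x hx
    rw [hx, Real.norm_eq_abs, abs_of_nonneg ((η n).nonneg_normed x)]
  have hconv : ∀ n, ballConvolution f (k n) = MeasureTheory.convolution ((η n).normed volume) f
      (ContinuousLinearMap.lsmul ℝ ℝ) volume := by
    intro n
    funext x
    refine integral_congr_ae ?_
    filter_upwards [hkη n] with t ht
    by_cases hb : t ∈ Metric.ball (0 : RSpace d) 1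
    · rw [Set.indicator_of_mem hb, ht]
    · have : (η n).normed volume t = 0 := by
        rw [← Function.notMem_support, (η n).support_normed_eq]
        refine fun h => hb (Metric.ball_subset_ball ?_ h)
        change 1 / ((n : ℝ) + 1) ≤ 1
        rw [div_le_one (by positivity)]
        linarith [(Nat.cast_nonneg n : (0 : ℝ) ≤ n)]
      rw [Set.indicator_of_notMem hb, this]
  have hsmooth : ∀ n, (A (k n) : LTwo d) ∈ ccClass d ((⊤ : ℕ∞) : WithTop ℕ∞) := by
    intro n
    refine ⟨ballConvolution f (k n), ?_, hasCompactSupport_ballConvolution hfc _, hA _⟩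
    rw [hconv]
    exact (η n).hasCompactSupport_normed.contDiff_convolution_left _ (n := ⊤)
      (η n).contDiff_normed hf.continuous.locallyIntegrable
  have hCbound : ∀ n, (D.killed V).form (A (k n)) (A (k n)) ≤ C ^ 2 := by
    intro n
    have h1 := hC (k n)
    rw [hknorm, mul_one] at h1
    exact (Real.sqrt_le_left ((Real.sqrt_nonneg _).trans h1)).1 h1
  obtain ⟨B, hB⟩ := hfc.exists_bound_of_continuous hf.continuous
  have hSc : IsCompact (Metric.closedBall (0 : RSpace d) 1 + tsupport f) :=
    (isCompact_closedBall _ _).add hfc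
  have hlim : Tendsto (fun n => (A (k n) : LTwo d)) atTop (𝓝 (u : LTwo d)) := by
    refine LTwo.tendsto_of_dominated _ _
      (indicatorConstLp 2 hSc.measurableSet hSc.measure_lt_top.ne B) (fun n => ?_) ?_
    · filter_upwards [hA (k n), indicatorConstLp_coeFn (p := 2)
        (hs := hSc.measurableSet) (hμs := hSc.measure_lt_top.ne) (c := B)] with x h1 h2
      have h3 := abs_ballConvolution_le (fun x => hB x) (L1.integrable_coeFn (k n)) x
      have h4 : ∫ t, |k n t| = 1 := (L1.norm_eq_integral_norm (k n)).symm.trans (hknorm n)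
      rw [h4, mul_one] at h3
      rw [h1, h2]
      exact h3.trans (le_abs_self _)
    · filter_upwards [ae_all_iff.2 fun n => hA (k n), huf] with x h1 h2
      simp only [h1, h2, hconv]
      exact ContDiffBump.convolution_tendsto_right_of_continuous
        (tendsto_one_div_add_atTop_nhds_zero_nat (𝕜 := ℝ)) hf.continuous x
  obtain ⟨_, -, h⟩ := D.isClosedForm_killed.mem_dom_of_bounded
    {v : (D.killed V).dom | (v : LTwo d) ∈ ccClass d ((⊤ : ℕ∞) : WithTop ℕ∞)} (by
      rintro v ⟨a, ha, hac, hva⟩ w ⟨b, hb, hbc, hwb⟩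
      refine ⟨(fun _ => (2⁻¹ : ℝ)) • (a + b), contDiff_const.smul (ha.add hb),
        (hac.add hbc).smul_left (f := fun _ => (2⁻¹ : ℝ)), ?_⟩
      filter_upwards [Lp.coeFn_smul (2⁻¹ : ℝ) ((v : LTwo d) + (w : LTwo d)),
        Lp.coeFn_add (v : LTwo d) (w : LTwo d),
        hva, hwb] with x h1 h2 h3 h4
      rw [Submodule.coe_smul, Submodule.coe_add, h1, Pi.smul_apply, h2, Pi.add_apply, h3, h4]
      rfl)
    (u : LTwo d) (C ^ 2) (fun ε hε => by
      obtain ⟨n, hn⟩ := (hlim.eventually (Metric.ball_mem_nhds _ hε)).exists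
      exact ⟨A (k n), hsmooth n, hCbound n, by rwa [← dist_eq_norm]⟩)
  exact h ε hε

theorem exists_smooth_approx (hV : Measurable V)
    (hVloc : ∀ S : Set (RSpace d), IsCompact S → ∃ M : ℝ, ∀ x ∈ S, (V x : ℝ) ≤ M)
    (u : (D.killed V).dom) {ε : ℝ} (hε : 0 < ε) :
    ∃ g : (D.killed V).dom, (g : LTwo d) ∈ ccClass d ((⊤ : ℕ∞) : WithTop ℕ∞) ∧
      (D.killed V).form (u - g) (u - g) + ‖(u - g : (D.killed V).dom)‖ ^ 2 < ε := by
  obtain ⟨v, hv, hv'⟩ := exists_core_approx u (show 0 < ε / 4 by positivity)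
  obtain ⟨g, hg, hg'⟩ := exists_smooth_approx_of_mem_ccClass hV hVloc v hv
    (show 0 < ε / 4 by positivity)
  refine ⟨g, hg, ?_⟩
  have h1 := LTwoForm.IsClosedForm.parallelogram (u - v) (v - g)
  have h2 := D.isClosedForm_killed.nonneg ((u - v) - (v - g))
  have h3 := norm_add_le (u - v) (v - g)
  rw [sub_add_sub_cancel] at h1 h3
  nlinarith [sq_nonneg (‖u - v‖ - ‖v - g‖), norm_nonneg (u - g), norm_nonneg (u - v),
    norm_nonneg (v - g)]

/-- A Sobolev type inequality on `C_c^∞` extends to the domain of the form. -/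
theorem sobolev_of_smooth (hV : Measurable V)
    (hVloc : ∀ S : Set (RSpace d), IsCompact S → ∃ M : ℝ, ∀ x ∈ S, (V x : ℝ) ≤ M)
    {p : ℝ≥0∞} {c₀ : ℝ} (hc₀ : 0 < c₀)
    (h : ∀ f : (D.killed V).dom, (f : LTwo d) ∈ ccClass d ((⊤ : ℕ∞) : WithTop ℕ∞) →
        eLpNorm (f : LTwo d) p volume ^ 2
          ≤ ENNReal.ofReal (c₀ * ((D.killed V).form f f + ∫ x, (f : LTwo d) x ^ 2)))
    (f : (D.killed V).dom) :
    eLpNorm (f : LTwo d) p volume ^ 2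
      ≤ ENNReal.ofReal (c₀ * ((D.killed V).form f f + ‖(f : LTwo d)‖ ^ 2)) := by
  have hE := D.isClosedForm_killed (V := V)
  have key : ∀ δ : ℝ, 0 < δ → eLpNorm (f : LTwo d) p volume ^ 2
      ≤ ENNReal.ofReal (c₀ * ((D.killed V).form f f + δ + (‖(f : LTwo d)‖ + δ) ^ 2)) := by
    intro δ hδ
    set X := ENNReal.ofReal (c₀ * ((D.killed V).form f f + δ + (‖(f : LTwo d)‖ + δ) ^ 2)) with hX
    obtain ⟨η, hη, hηE⟩ := hE.exists_pos_form_le f hδ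
    have hsel : ∀ n : ℕ, ∃ g : (D.killed V).dom, eLpNorm (g : LTwo d) p volume ^ 2 ≤ X ∧
        ‖(g : LTwo d) - f‖ < 1 / ((n : ℝ) + 1) := by
      intro n
      have hn : (0 : ℝ) < 1 / ((n : ℝ) + 1) := by positivity
      obtain ⟨g, hg, hg'⟩ := exists_smooth_approx hV hVloc f
        (lt_min hη (lt_min (pow_pos hδ 2) (pow_pos hn 2)))
      have h1 := hg'.trans_le (min_le_left _ _)
      have h2 := hg'.trans_le ((min_le_right _ _).trans (min_le_left _ _))
      have h3 := hg'.trans_le ((min_le_right _ _).trans (min_le_right _ _))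
      have h4 := hE.nonneg (f - g)
      have e : ‖(f - g : (D.killed V).dom)‖ = ‖(g : LTwo d) - f‖ := by
        rw [norm_sub_rev]; rfl
      rw [e] at h1 h2 h3
      have h5 : ‖(g : LTwo d) - f‖ < δ := lt_of_pow_lt_pow_left₀ 2 hδ.le (by linarith)
      refine ⟨g, ?_, lt_of_pow_lt_pow_left₀ 2 hn.le (by linarith)⟩
      refine (h g hg).trans (ENNReal.ofReal_le_ofReal ?_)
      rw [← LTwo.norm_sq_eq_integral]
      have h6 : ‖(g : LTwo d)‖ ≤ ‖(f : LTwo d)‖ + δ := by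
        have := norm_le_insert' (g : LTwo d) f
        linarith
      have h7 := hηE g (by linarith [sq_nonneg ‖(g : LTwo d) - f‖])
      gcongr
    choose g hgX hgf using hsel
    have hlim : Tendsto (fun n => (g n : LTwo d)) atTop (𝓝 (f : LTwo d)) := by
      rw [tendsto_iff_norm_sub_tendsto_zero]
      exact squeeze_zero (fun n => norm_nonneg _) (fun n => (hgf n).le)
        tendsto_one_div_add_atTop_nhds_zero_nat
    obtain ⟨m, -, hm⟩ := (tendstoInMeasure_of_tendsto_Lp hlim).exists_seq_tendsto_ae
    have hfatou := Lp.eLpNorm_lim_le_liminf_eLpNorm (p := p)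
      (fun n => Lp.aestronglyMeasurable (g (m n) : LTwo d)) _ hm
    have hle : ∀ n, eLpNorm (g (m n) : LTwo d) p volume ≤ X ^ (2⁻¹ : ℝ) := by
      intro n
      rw [← ENNReal.rpow_le_rpow_iff (z := 2) two_pos, ← ENNReal.rpow_mul,
        inv_mul_cancel₀ two_ne_zero, ENNReal.rpow_one, ENNReal.rpow_two]
      exact hgX _
    have h8 : eLpNorm (f : LTwo d) p volume ≤ X ^ (2⁻¹ : ℝ) :=
      hfatou.trans (liminf_le_of_frequently_le' (Eventually.of_forall hle).frequently)
    rw [← ENNReal.rpow_le_rpow_iff (z := 2) two_pos, ← ENNReal.rpow_mul,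
      inv_mul_cancel₀ two_ne_zero, ENNReal.rpow_one, ENNReal.rpow_two] at h8
    exact h8
  have hlim : Tendsto (fun δ : ℝ =>
      ENNReal.ofReal (c₀ * ((D.killed V).form f f + δ + (‖(f : LTwo d)‖ + δ) ^ 2))) (𝓝[>] 0)
      (𝓝 (ENNReal.ofReal (c₀ * ((D.killed V).form f f + 0 + (‖(f : LTwo d)‖ + 0) ^ 2)))) := by
    refine Tendsto.mono_left (Continuous.tendsto ?_ 0) nhdsWithin_le_nhds
    exact ENNReal.continuous_ofReal.comp (by fun_prop)
  rw [add_zero, add_zero] at hlim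
  refine ge_of_tendsto hlim ?_
  filter_upwards [self_mem_nhdsWithin] with δ hδ
  exact key δ hδ

end RegularDirichletForm

/-! ### Absorbing the tail term by a Sobolev inequality -/

namespace LocalSuperPoincare

variable {d : ℕ} {D : RegularDirichletForm d} {V : RSpace d → ℝ≥0} {φ₁ : RSpace d → ℝ}
  {K r₀ C₀ : ℝ} {α : ℝ → ℝ → ℝ}

theorem potInf_pos (h : LocalSuperPoincare D V φ₁ K r₀ C₀ α) (R : ℝ) : 0 < potInf V K R :=
  h.K_pos.trans_le (le_potInf h.tendsto R)

theorem antitone_psiFun (h : LocalSuperPoincare D V φ₁ K r₀ C₀ α) {c₀ : ℝ} (hc₀ : 0 ≤ c₀)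
    {p : ℝ≥0∞} (hp : 2 < p) : Antitone (psiFun V K c₀ p) := by
  intro R R' hR
  refine add_le_add (one_div_le_one_div_of_le (h.potInf_pos R) (monotone_potInf h.tendsto hR))
    (mul_le_mul_of_nonneg_left ?_ hc₀)
  exact Real.rpow_le_rpow (lowVol_nonneg _ _ _) (antitone_lowVol h.volume_lt_top h.K_pos hR)
    (lpExponent_pos hp).le

theorem tendsto_psiFun (h : LocalSuperPoincare D V φ₁ K r₀ C₀ α) (c₀ : ℝ) {p : ℝ≥0∞}
    (hp : 2 < p) : Tendsto (psiFun V K c₀ p) atTop (𝓝 0) := by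
  have h1 := (tendsto_lowVol h.meas h.volume_lt_top h.K_pos).rpow_const
    (Or.inr (lpExponent_pos hp).le)
  rw [Real.zero_rpow (lpExponent_pos hp).ne'] at h1
  have h2 := (tendsto_inv_atTop_zero.comp h.tendsto).add (h1.const_mul c₀)
  rw [mul_zero, add_zero] at h2
  refine h2.congr fun R => ?_
  rw [psiFun, one_div, Function.comp_apply]

theorem nonempty_psiInv_set (h : LocalSuperPoincare D V φ₁ K r₀ C₀ α) (c₀ : ℝ) {p : ℝ≥0∞}
    (hp : 2 < p) {t : ℝ} (ht : 0 < t) : {R | 1 < R ∧ psiFun V K c₀ p R ≤ t}.Nonempty := by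
  obtain ⟨R, hR⟩ := ((eventually_gt_atTop 1).and
    ((h.tendsto_psiFun c₀ hp).eventually (gt_mem_nhds ht))).exists
  exact ⟨R, hR.1, hR.2.le⟩

theorem one_le_psiInv (h : LocalSuperPoincare D V φ₁ K r₀ C₀ α) (c₀ : ℝ) {p : ℝ≥0∞}
    (hp : 2 < p) {t : ℝ} (ht : 0 < t) : 1 ≤ psiInv V K c₀ p t :=
  le_csInf (h.nonempty_psiInv_set c₀ hp ht) fun _ hR => hR.1.le

/-- A Sobolev inequality bounds the mass of `f²` away from the origin. -/
theorem norm_sq_le_of_sobolev (h : LocalSuperPoincare D V φ₁ K r₀ C₀ α) {c₀ : ℝ} (hc₀ : 0 < c₀)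
    {p : ℝ≥0∞} (hp : 2 < p) (f : (D.killed V).dom)
    (hf : eLpNorm (f : LTwo d) p volume ^ 2
      ≤ ENNReal.ofReal (c₀ * ((D.killed V).form f f + ‖(f : LTwo d)‖ ^ 2))) (R : ℝ) :
    ‖(f : LTwo d)‖ ^ 2 ≤ (∫ x in Metric.ball (0 : RSpace d) R, (f : LTwo d) x ^ 2)
      + psiFun V K c₀ p R * ((D.killed V).form f f + ‖(f : LTwo d)‖ ^ 2) := by
  have hE := RegularDirichletForm.isClosedForm_killed.nonneg f
  have hpos := h.potInf_pos R
  have h1 := setIntegral_sq_le (D := D) (V := V) (measurableSet_high h.meas K R) hpos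
    (ae_of_all _ fun x hx => potInf_le hx.1 hx.2) f
  have hfin := volume_low_lt_top h.volume_lt_top h.K_pos R
  have h2 := (setIntegral_sq_le_eLpNorm hfin hp (f : LTwo d)).trans (mul_le_mul_right hf _)
  have hΘ : 0 ≤ lowVol V K R ^ lpExponent p := Real.rpow_nonneg (lowVol_nonneg _ _ _) _
  have hF := sq_nonneg ‖(f : LTwo d)‖
  rw [← ENNReal.ofReal_mul (Real.rpow_nonneg ENNReal.toReal_nonneg _),
    ENNReal.ofReal_le_ofReal_iff (by positivity)] at h2
  change _ ≤ lowVol V K R ^ lpExponent p * _ at h2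
  have h3 : 0 ≤ 1 / potInf V K R * ‖(f : LTwo d)‖ ^ 2 := by positivity
  have h4 := LTwo.norm_sq_eq_integral (f : LTwo d)
  rw [integral_sq_eq h.meas K R] at h4
  rw [psiFun, add_mul, mul_add (1 / potInf V K R)]
  linarith

theorem superPoincare_of_sobolev (h : LocalSuperPoincare D V φ₁ K r₀ C₀ α) {c₀ : ℝ} (hc₀ : 0 < c₀)
    {p : ℝ≥0∞} (hp : 2 < p)
    (hS : ∀ f : (D.killed V).dom, eLpNorm (f : LTwo d) p volume ^ 2
      ≤ ENNReal.ofReal (c₀ * ((D.killed V).form f f + ‖(f : LTwo d)‖ ^ 2))) :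
    ∃ r : ℝ, 0 < r ∧ SuperPoincare (D.killed V) φ₁
      (fun s => ENNReal.ofReal (rateBetaHat V K C₀ c₀ p α s)) r := by
  have hΦ := h.potInf_pos r₀
  have hr : 0 < min 2 (2 / potInf V K r₀) := lt_min two_pos (by positivity)
  refine ⟨_, hr, SuperPoincare.of_real_le RegularDirichletForm.isClosedForm_killed hr
    (fun s hs => ?_) fun s hs hsr f => ?_⟩
  · refine mul_nonneg (by positivity) (h.α_nonneg _ _ ?_ (by positivity))
    exact one_pos.trans_le (h.one_le_psiInv c₀ hp (by positivity))
  set R := psiInv V K c₀ p (s / 4) with hRdef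
  have hne := h.nonempty_psiInv_set c₀ hp (show 0 < s / 4 by positivity)
  have hR1 : 1 ≤ R := h.one_le_psiInv c₀ hp (by positivity)
  -- for small `s` the radius is automatically at least `r₀`
  have hRr : r₀ ≤ R := by
    refine le_csInf hne fun R' hR' => ?_
    by_contra! hlt
    have h1 : 1 / potInf V K r₀ ≤ 1 / potInf V K R' :=
      one_div_le_one_div_of_le (h.potInf_pos R') (monotone_potInf h.tendsto hlt.le)
    have h2 : 0 ≤ c₀ * lowVol V K R' ^ lpExponent p :=
      mul_nonneg hc₀.le (Real.rpow_nonneg (lowVol_nonneg _ _ _) _)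
    have h3 := hR'.2
    rw [psiFun] at h3
    have h4 := hsr.trans (min_le_right _ _)
    rw [← mul_one_div] at h4
    linarith
  have hE := RegularDirichletForm.isClosedForm_killed.nonneg f
  have hF := sq_nonneg ‖(f : LTwo d)‖
  have htail : ∀ n : ℕ, ‖(f : LTwo d)‖ ^ 2 - s / 4 * ((D.killed V).form f f + ‖(f : LTwo d)‖ ^ 2) ≤
      ∫ x in Metric.ball (0 : RSpace d) (R + 1 / ((n : ℝ) + 1)), (f : LTwo d) x ^ 2 := by
    intro n
    have hn : R < R + 1 / ((n : ℝ) + 1) := lt_add_of_pos_right _ (by positivity)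
    obtain ⟨R', hR', hlt⟩ := exists_lt_of_csInf_lt hne hn
    have h1 := h.norm_sq_le_of_sobolev hc₀ hp f (hS f) (R + 1 / ((n : ℝ) + 1))
    have h2 := mul_le_mul_of_nonneg_right
      ((h.antitone_psiFun hc₀.le hp hlt.le).trans hR'.2) (add_nonneg hE hF)
    linarith
  have hlim := tendsto_setIntegral_of_antitone (μ := volume)
    (s := fun n : ℕ => Metric.ball (0 : RSpace d) (R + 1 / ((n : ℝ) + 1)))
    (f := fun x => (f : LTwo d) x ^ 2) (fun n => measurableSet_ball)
    (fun m n hmn => Metric.ball_subset_ball (by gcongr))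
    ⟨0, (LTwo.integrable_sq (f : LTwo d)).integrableOn⟩
  have hset : ⋂ n : ℕ, Metric.ball (0 : RSpace d) (R + 1 / ((n : ℝ) + 1))
      = Metric.closedBall (0 : RSpace d) R := by
    ext x
    simp only [Set.mem_iInter, mem_ball_zero_iff, mem_closedBall_zero_iff]
    refine ⟨fun hx => ?_, fun hx n => hx.trans_lt (lt_add_of_pos_right _ (by positivity))⟩
    have h3 : Tendsto (fun n : ℕ => R + 1 / ((n : ℝ) + 1)) atTop (𝓝 (R + 0)) :=
      tendsto_one_div_add_atTop_nhds_zero_nat.const_add R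
    rw [add_zero] at h3
    exact ge_of_tendsto' h3 fun n => (hx n).le
  have hae : (Metric.closedBall (0 : RSpace d) R : Set (RSpace d)) =ᵐ[volume]
      Metric.ball (0 : RSpace d) R := by
    filter_upwards [ae_norm_ne (one_pos.trans_le hR1)] with x hx
    refine propext ?_
    change x ∈ Metric.closedBall 0 R ↔ x ∈ Metric.ball 0 R
    rw [mem_ball_zero_iff, mem_closedBall_zero_iff]
    exact ⟨fun h => lt_of_le_of_ne h hx, le_of_lt⟩
  rw [hset, setIntegral_congr_set hae] at hlim
  have h1 := ge_of_tendsto' hlim htail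
  have h2 := h.ineq R hRr (s / 4) (by positivity) f
  have h3 : s / 4 * ‖(f : LTwo d)‖ ^ 2 ≤ 1 / 2 * ‖(f : LTwo d)‖ ^ 2 := by
    have := hsr.trans (min_le_left _ _)
    exact mul_le_mul_of_nonneg_right (by linarith) hF
  rw [rateBetaHat, ← hRdef]
  have h4 : 2 * C₀ ^ 2 * α R (s / 4) * (∫ x, |(f : LTwo d) x| * φ₁ x) ^ 2
      = 2 * (C₀ ^ 2 * α R (s / 4) * (∫ x, |(f : LTwo d) x| * φ₁ x) ^ 2) := by ring
  linarith

end LocalSuperPoincare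

/-! ### Cutting a function along its level sets -/

section Levels

/-- If `v` is not close above one of the levels `A Λ ^ j`, then the part of `v` above `A` is
comparable, with a constant close to one, to the piece of `v` between two consecutive levels. The
second sum takes care of the values `v` in a band `[A Λ ^ j, A Λ ^ j ρ)`. -/
theorem sq_max_sub_le_sum_clampTo {A ρ Λ v : ℝ} (hA : 0 < A) (hρ : 100 ≤ ρ) (hρΛ : ρ ≤ Λ) {M : ℕ}
    (hv : v < A * Λ ^ M) :
    max 0 (v - A) ^ 2 ≤
      103 / 100 * ∑ j ∈ Finset.range M, clampTo (A * Λ ^ (j + 1) - A * Λ ^ j) (v - A * Λ ^ j) ^ 2 +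
      ∑ j ∈ Finset.range M, ((if A * Λ ^ j ≤ v then v ^ 2 else 0) -
        (if A * Λ ^ j * ρ ≤ v then v ^ 2 else 0)) := by
  have hΛ : 1 < Λ := by linarith
  have hb : ∀ j ∈ Finset.range M, 0 ≤ (if A * Λ ^ j ≤ v then v ^ 2 else 0) -
        (if A * Λ ^ j * ρ ≤ v then v ^ 2 else 0) := by
    intro j _
    have h1 : 0 < A * Λ ^ j := by positivity
    split_ifs with h2 h3 h3
    · simp
    · simpa using sq_nonneg v
    · nlinarith
    · simp
  have hc : ∀ j ∈ Finset.range M,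
      0 ≤ clampTo (A * Λ ^ (j + 1) - A * Λ ^ j) (v - A * Λ ^ j) ^ 2 := fun j _ => sq_nonneg _
  by_cases hvA : v < A
  · rw [max_eq_left (by linarith), zero_pow two_ne_zero]
    exact add_nonneg (mul_nonneg (by norm_num) (Finset.sum_nonneg hc)) (Finset.sum_nonneg hb)
  push Not at hvA
  obtain ⟨j, hj, hj'⟩ := exists_nat_pow_near ((one_le_div hA).2 hvA) hΛ
  rw [le_div_iff₀ hA, mul_comm] at hj
  rw [div_lt_iff₀ hA, mul_comm] at hj'
  have hjM : j ∈ Finset.range M := by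
    rw [Finset.mem_range]
    exact (pow_lt_pow_iff_right₀ hΛ).1 (lt_of_mul_lt_mul_left (hj.trans_lt hv) hA.le)
  have h1 := Finset.single_le_sum hc hjM
  have h2 := Finset.single_le_sum hb hjM
  have hv2 : max 0 (v - A) ^ 2 ≤ v ^ 2 :=
    pow_le_pow_left₀ (le_max_left _ _) (max_le (by linarith) (by linarith)) 2
  rw [if_pos hj] at h2
  by_cases h3 : A * Λ ^ j * ρ ≤ v
  · have hb0 := Finset.sum_nonneg hb
    rw [clampTo_of_le (by linarith) (by linarith)] at h1
    have h4 : 99 / 100 * v ≤ v - A * Λ ^ j := by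
      have : A * Λ ^ j * 100 ≤ v := (mul_le_mul_of_nonneg_left hρ (by positivity)).trans h3
      linarith
    have h5 := pow_le_pow_left₀ (by linarith) h4 2
    nlinarith [sq_nonneg v]
  · rw [if_neg h3, sub_zero] at h2
    have hc0 := Finset.sum_nonneg hc
    linarith

/-- The pigeonhole principle for residue classes. -/
theorem exists_residue_sum_le (b : ℕ → ℝ) {q : ℕ} (hq : 0 < q) (M : ℕ) {C : ℝ}
    (h : ∑ i ∈ Finset.range (q * M), b i ≤ C) :
    ∃ r < q, ∑ j ∈ Finset.range M, b (r + q * j) ≤ C / q := by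
  have hsum : ∑ r ∈ Finset.range q, ∑ j ∈ Finset.range M, b (r + q * j)
      = ∑ i ∈ Finset.range (q * M), b i := by
    rw [Finset.sum_comm]
    clear h
    induction M with
    | zero => simp
    | succ M ih =>
      rw [Finset.sum_range_succ, ih, mul_add, mul_one, Finset.sum_range_add]
      simp only [add_comm]
  obtain ⟨r, hr, hr'⟩ := Finset.exists_le_of_sum_le (s := Finset.range q)
    (f := fun r => ∑ j ∈ Finset.range M, b (r + q * j)) (g := fun _ => C / q)
    ⟨0, Finset.mem_range.2 hq⟩ (by
      have : (q : ℝ) ≠ 0 := Nat.cast_ne_zero.2 hq.ne'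
      rw [hsum, Finset.sum_const, Finset.card_range, nsmul_eq_mul, mul_div_cancel₀ _ this]
      exact h)
  exact ⟨r, Finset.mem_range.1 hr, hr'⟩

end Levels

/-- Normal contractions operate on the form. -/
def LTwoForm.ContractionsOperate {d : ℕ} (E : LTwoForm d) : Prop :=
  ∀ ψ : ℝ → ℝ, LipschitzWith 1 ψ → ψ 0 = 0 → ∀ u : E.dom,
    ∃ v : E.dom, ((v : LTwo d) =ᵐ[volume] fun x => ψ ((u : LTwo d) x)) ∧ E.form v v ≤ E.form u u

/-- The energy is superadditive along a decomposition into `p` and `q` for which `p - q` is a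
contraction of `p + q`. -/
theorem LTwoForm.form_add_form_le {d : ℕ} {E : LTwoForm d} (hC : E.ContractionsOperate)
    {ψ : ℝ → ℝ} (hψ : LipschitzWith 1 ψ) (h0 : ψ 0 = 0) (p q : E.dom)
    (h : ∀ᵐ x, (p : LTwo d) x - (q : LTwo d) x = ψ ((p : LTwo d) x + (q : LTwo d) x)) :
    E.form p p + E.form q q ≤ E.form (p + q) (p + q) := by
  obtain ⟨v, hv, hle⟩ := hC ψ hψ h0 (p + q)
  have hvpq : v = p - q := by
    refine Subtype.ext (Lp.ext ?_)
    filter_upwards [hv, h, Lp.coeFn_add (p : LTwo d) (q : LTwo d),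
      Lp.coeFn_sub (p : LTwo d) (q : LTwo d)] with x h1 h2 h3 h4
    rw [h1, Submodule.coe_add, h3, Pi.add_apply, ← h2, Submodule.coe_sub, h4, Pi.sub_apply]
  rw [hvpq] at hle
  linarith [LTwoForm.IsClosedForm.parallelogram p q]

theorem lipschitzWith_min_const (A : ℝ) : LipschitzWith 1 fun x : ℝ => min x A :=
  LipschitzWith.id.min_const A

theorem lipschitzWith_clampTo_sub (b A : ℝ) : LipschitzWith 1 fun x : ℝ => clampTo b (x - A) := by
  have h : LipschitzWith 1 fun x : ℝ => x - A := by
    refine LipschitzWith.of_dist_le_mul fun x y => ?_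
    simp [Real.dist_eq]
  exact (h.const_min b).const_max 0

/-- The energy of a function dominates the sum of the energies of its pieces between consecutive
levels. -/
theorem LTwoForm.exists_levels {d : ℕ} {E : LTwoForm d} (hC : E.ContractionsOperate)
    {A : ℕ → ℝ} (hA0 : 0 ≤ A 0) (hA : Monotone A) (f : E.dom) (M : ℕ) :
    ∃ (w : E.dom) (u : ℕ → E.dom),
      ((w : LTwo d) =ᵐ[volume] fun x => min ((f : LTwo d) x) (A 0)) ∧
      (∀ j, (u j : LTwo d) =ᵐ[volume]
        fun x => clampTo (A (j + 1) - A j) ((f : LTwo d) x - A j)) ∧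
      E.form w w + ∑ j ∈ Finset.range M, E.form (u j) (u j) ≤ E.form f f := by
  have hAj : ∀ j, 0 ≤ A j := fun j => hA0.trans (hA (Nat.zero_le j))
  choose w hw hwE using fun j => hC _ (lipschitzWith_min_const (A j)) (min_eq_left (hAj j)) f
  choose u hu huE using fun j => hC _ (lipschitzWith_clampTo_sub (A (j + 1) - A j) (A j))
    (clampTo_of_nonpos (by linarith [hAj j])) f
  have hstep : ∀ j, E.form (w j) (w j) + E.form (u j) (u j) ≤ E.form (w (j + 1)) (w (j + 1)) := by
    intro j
    have hjj := hA (Nat.le_succ j)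
    rw [Nat.succ_eq_add_one] at hjj
    have hpt : ∀ v : ℝ, min v (A j) + clampTo (A (j + 1) - A j) (v - A j) = min v (A (j + 1)) := by
      intro v
      rcases le_total v (A j) with h1 | h1
      · rw [min_eq_left h1, min_eq_left (h1.trans hjj), clampTo_of_nonpos (by linarith), add_zero]
      rcases le_total v (A (j + 1)) with h2 | h2
      · rw [min_eq_right h1, min_eq_left h2, clampTo_of_le (by linarith) (by linarith)]
        ring
      · rw [min_eq_right h1, min_eq_right h2, clampTo_of_ge (by linarith) (by linarith)]
        ring
    have hadd : w j + u j = w (j + 1) := by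
      refine Subtype.ext (Lp.ext ?_)
      filter_upwards [hw j, hu j, hw (j + 1), Lp.coeFn_add (w j : LTwo d) (u j : LTwo d)]
        with x h1 h2 h3 h4
      rw [Submodule.coe_add, h4, Pi.add_apply, h1, h2, h3, hpt]
    rw [← hadd]
    refine LTwoForm.form_add_form_le hC (ψ := fun v => A j - |v - A j|) ?_ ?_ _ _ ?_
    · refine LipschitzWith.of_dist_le_mul fun x y => ?_
      rw [NNReal.coe_one, one_mul, Real.dist_eq, Real.dist_eq, sub_sub_sub_cancel_left, abs_sub_comm]
      refine (abs_abs_sub_abs_le_abs_sub _ _).trans (le_of_eq ?_)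
      congr 1
      ring
    · rw [zero_sub, abs_neg, abs_of_nonneg (hAj j), sub_self]
    · filter_upwards [hw j, hu j] with x h1 h2
      simp only [h1, h2, hpt]
      generalize (f : LTwo d) x = v
      rcases le_total v (A j) with h1 | h1
      · rw [min_eq_left h1, min_eq_left (h1.trans hjj), clampTo_of_nonpos (by linarith),
          abs_of_nonpos (by linarith)]
        ring
      rcases le_total v (A (j + 1)) with h2 | h2
      · rw [min_eq_right h1, min_eq_left h2, clampTo_of_le (by linarith) (by linarith),
          abs_of_nonneg (by linarith)]
      · rw [min_eq_right h1, min_eq_right h2, clampTo_of_ge (by linarith) (by linarith),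
          abs_of_nonneg (by linarith)]
  refine ⟨w 0, u, hw 0, hu, ?_⟩
  have hind : ∀ M, E.form (w 0) (w 0) + ∑ j ∈ Finset.range M, E.form (u j) (u j)
      ≤ E.form (w M) (w M) := by
    intro M
    induction M with
    | zero => simp
    | succ M ih =>
      rw [Finset.sum_range_succ]
      linarith [hstep M]
  exact (hind M).trans (hwE M)

/-- The weighted mass of a function `u` supported in `{|f| ≥ A}`, on which `A |u| ≤ |f u|`. -/
theorem sq_mul_mass_sq_le {d : ℕ} {φ₁ : RSpace d → ℝ} (hφ : MemLp φ₁ 2 volume)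
    (hφ0 : ∀ x, 0 ≤ φ₁ x) {c : ℝ} (hc : ∀ᵐ x, φ₁ x ≤ c) (hc0 : 0 ≤ c) {A : ℝ} (hA : 0 ≤ A)
    (f u : LTwo d) (h : ∀ᵐ x, A * |u x| ≤ |f x| * |u x|) :
    A ^ 2 * (∫ x, |u x| * φ₁ x) ^ 2 ≤ c ^ 2 * ‖f‖ ^ 2 * ‖u‖ ^ 2 := by
  have hi : Integrable fun x => |u x| * φ₁ x := (LTwo.memLp u).abs.integrable_mul hφ
  have hi2 : Integrable fun x => |f x| * |u x| :=
    (LTwo.memLp f).abs.integrable_mul (LTwo.memLp u).abs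
  have h1 : A * ∫ x, |u x| * φ₁ x ≤ c * ∫ x, |f x| * |u x| := by
    rw [← integral_const_mul, ← integral_const_mul]
    refine integral_mono_ae (hi.const_mul _) (hi2.const_mul _) ?_
    filter_upwards [h, hc] with x h2 h3
    calc A * (|u x| * φ₁ x) = (A * |u x|) * φ₁ x := by ring
      _ ≤ (|f x| * |u x|) * c := mul_le_mul h2 h3 (hφ0 x) (by positivity)
      _ = _ := by ring
  have h2 : ∫ x, |f x| * |u x| ≤ ‖f‖ * ‖u‖ := by
    have h3 : ∫ x, |f x| * |u x| = ⟪|f|, |u|⟫_ℝ := by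
      rw [LTwo.inner_eq_integral]
      refine integral_congr_ae ?_
      filter_upwards [Lp.coeFn_abs f, Lp.coeFn_abs u] with x h4 h5
      rw [h4, h5]
    rw [h3, ← norm_abs_eq_norm f, ← norm_abs_eq_norm u]
    exact real_inner_le_norm _ _
  have h3 : 0 ≤ A * ∫ x, |u x| * φ₁ x :=
    mul_nonneg hA (integral_nonneg fun x => mul_nonneg (abs_nonneg _) (hφ0 x))
  have h4 := pow_le_pow_left₀ h3 (h1.trans (mul_le_mul_of_nonneg_left h2 hc0)) 2
  nlinarith

theorem setIntegral_sq_le_of_abs_le {d : ℕ} {L : Set (RSpace d)}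
    (hfin : volume L < ∞) {B : ℝ} {g : RSpace d → ℝ} (hg : ∀ᵐ x, |g x| ≤ B) :
    ∫ x in L, g x ^ 2 ≤ B ^ 2 * (volume L).toReal := by
  have h := norm_setIntegral_le_of_norm_le_const_ae' (f := fun x => g x ^ 2) (C := B ^ 2) hfin (by
    filter_upwards [hg] with x hx _
    rw [Real.norm_eq_abs, abs_pow]
    exact pow_le_pow_left₀ (abs_nonneg _) hx 2)
  exact (le_abs_self _).trans h

/-! ### Functions normalized in `L²` satisfy the inequality without tail term -/

namespace LocalSuperPoincare

variable {d : ℕ} {D : RegularDirichletForm d} {V : RSpace d → ℝ≥0} {φ₁ : RSpace d → ℝ}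
  {K r₀ C₀ : ℝ} {α : ℝ → ℝ → ℝ}

/-- The super Poincaré inequality with a tail term for a bounded function. -/
theorem norm_sq_le_of_bounded (h : LocalSuperPoincare D V φ₁ K r₀ C₀ α) {s : ℝ} (hs : 0 < s)
    (f : (D.killed V).dom) {B : ℝ} (hB : ∀ᵐ x, |(f : LTwo d) x| ≤ B) :
    ‖(f : LTwo d)‖ ^ 2 ≤ s * (D.killed V).form f f
      + rateBeta V K r₀ C₀ α s * (∫ x, |(f : LTwo d) x| * φ₁ x) ^ 2
      + B ^ 2 * rateGamma V K r₀ s :=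
  (h.norm_sq_le hs f).trans (add_le_add le_rfl
    (setIntegral_sq_le_of_abs_le (volume_low_lt_top h.volume_lt_top h.K_pos _) hB))

theorem rateGamma_nonneg (V : RSpace d → ℝ≥0) (K r₀ s : ℝ) : 0 ≤ rateGamma V K r₀ s :=
  lowVol_nonneg _ _ _

/-- The super Poincaré inequality at the level `t` holds for a normalized function as soon as there
are rates `σ i ≤ t` which control the pieces of the function above the levels `a ρ ^ i`. Only every
hundredth of these levels is used for cutting, so that the bands of ratio `ρ` above the levels in
one of the hundred residue classes carry at most a hundredth of the mass. The level `a ρ ^ 100` is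
so low that the part below the cuts has a negligible tail term at the scale `t`. -/
theorem one_le_of_levels (h : LocalSuperPoincare D V φ₁ K r₀ C₀ α)
    (hC : (D.killed V).ContractionsOperate) (hφ : MemLp φ₁ 2 volume) (hφ0 : ∀ x, 0 ≤ φ₁ x)
    {c : ℝ} (hc : ∀ᵐ x, φ₁ x ≤ c) (hc0 : 0 ≤ c) {t a ρ : ℝ} (ht : 0 < t) (ha : 0 < a)
    (hρ : 100 ≤ ρ) {σ : ℕ → ℝ} (hσ0 : ∀ i, 0 < σ i) (hσt : ∀ i, σ i ≤ t)
    (hβ : ∀ i, rateBeta V K r₀ C₀ α (σ i) * c ^ 2 ≤ (a * ρ ^ i) ^ 2 / 100)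
    (hγ : ∀ S : Finset ℕ,
      ∑ i ∈ S, (a * ρ ^ (i + 100)) ^ 2 * rateGamma V K r₀ (σ i) ≤ 1 / 200)
    (hG : (a * ρ ^ 100) ^ 2 * rateGamma V K r₀ t ≤ 1 / 10000)
    (f : (D.killed V).dom) (hf0 : ∀ᵐ x, 0 ≤ (f : LTwo d) x) {B : ℝ}
    (hB : ∀ᵐ x, (f : LTwo d) x ≤ B) (hf1 : ‖(f : LTwo d)‖ = 1) :
    1 ≤ 2 * t * (D.killed V).form f f
      + 2 * rateBeta V K r₀ C₀ α t * (∫ x, |(f : LTwo d) x| * φ₁ x) ^ 2 := by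
  have hE := D.isClosedForm_killed (V := V)
  have hρ1 : 1 < ρ := by linarith
  have hΛ : 1 < ρ ^ 100 := one_lt_pow₀ hρ1 (by norm_num)
  have hρΛ : ρ ≤ ρ ^ 100 := le_self_pow₀ hρ1.le (by norm_num)
  have hf2 : ∫ x, (f : LTwo d) x ^ 2 = 1 := by rw [← LTwo.norm_sq_eq_integral, hf1, one_pow]
  have hfi := LTwo.integrable_sq (f : LTwo d)
  obtain ⟨M, hM⟩ := pow_unbounded_of_one_lt (B / a) hΛ
  rw [div_lt_iff₀ ha, mul_comm] at hM
  -- the mass of `f²` above the level `l`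
  let H : ℝ → RSpace d → ℝ := fun l x => if l ≤ (f : LTwo d) x then (f : LTwo d) x ^ 2 else 0
  have hHle : ∀ l x, H l x ≤ (f : LTwo d) x ^ 2 := by
    intro l x
    simp only [H]
    split_ifs
    exacts [le_rfl, sq_nonneg _]
  have hH0 : ∀ l x, 0 ≤ H l x := by
    intro l x
    simp only [H]
    split_ifs
    exacts [sq_nonneg _, le_rfl]
  have hHi : ∀ l, Integrable (H l) := by
    intro l
    refine hfi.mono ?_ (ae_of_all _ fun x => ?_)
    · have hm := (Lp.stronglyMeasurable (f : LTwo d)).measurable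
      exact (Measurable.ite (measurableSet_le measurable_const hm) (hm.pow_const 2)
        measurable_const).aestronglyMeasurable
    · rw [Real.norm_of_nonneg (hH0 l x), Real.norm_of_nonneg (sq_nonneg _)]
      exact hHle l x
  -- a residue class of levels near which `f²` has little mass
  obtain ⟨r, hr, hband⟩ := exists_residue_sum_le
    (fun i => (∫ x, H (a * ρ ^ i) x) - ∫ x, H (a * ρ ^ (i + 1)) x) (q := 100) (by norm_num) M
    (C := 1) (by
      rw [Finset.sum_range_sub' (fun i => ∫ x, H (a * ρ ^ i) x)]
      have h1 : ∫ x, H (a * ρ ^ 0) x ≤ 1 := hf2 ▸ integral_mono (hHi _) hfi (hHle _)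
      have h2 : 0 ≤ ∫ x, H (a * ρ ^ (100 * M)) x := integral_nonneg (hH0 _)
      linarith)
  let A : ℕ → ℝ := fun j => a * ρ ^ r * (ρ ^ 100) ^ j
  have hAeq : ∀ j, A j = a * ρ ^ (r + 100 * j) := fun j => by
    simp only [A]
    rw [pow_add, pow_mul, mul_assoc]
  have hApos : ∀ j, 0 < A j := fun j => by positivity
  have hAmono : Monotone A := fun i j hij =>
    mul_le_mul_of_nonneg_left (pow_le_pow_right₀ hΛ.le hij) (by positivity)
  have hA0 : A 0 = a * ρ ^ r := by simp [A]
  have haA : a ≤ a * ρ ^ r := le_mul_of_one_le_right ha.le (one_le_pow₀ hρ1.le)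
  have hA0G : A 0 ^ 2 * rateGamma V K r₀ t ≤ 1 / 10000 := by
    refine le_trans (mul_le_mul_of_nonneg_right ?_ (rateGamma_nonneg _ _ _ _)) hG
    rw [hA0]
    have := pow_le_pow_right₀ hρ1.le hr.le
    gcongr
  obtain ⟨w, u, hw, hu, hEsum⟩ := LTwoForm.exists_levels hC (hApos 0).le hAmono f M
  have hi2 : ∀ j, Integrable fun x => clampTo (A (j + 1) - A j) ((f : LTwo d) x - A j) ^ 2 :=
    fun j => (LTwo.integrable_sq (u j : LTwo d)).congr (by
      filter_upwards [hu j] with x hx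
      rw [hx])
  -- the part of `f` above the lowest level
  have hYi : Integrable fun x => max 0 ((f : LTwo d) x - A 0) ^ 2 := by
    refine hfi.mono ?_ ?_
    · exact ((measurable_const.max ((Lp.stronglyMeasurable (f : LTwo d)).measurable.sub_const
        _)).pow_const 2).aestronglyMeasurable
    · filter_upwards [hf0] with x hx
      rw [Real.norm_of_nonneg (sq_nonneg _), Real.norm_of_nonneg (sq_nonneg _)]
      exact pow_le_pow_left₀ (le_max_left _ _) (max_le hx (by linarith [hApos 0])) 2
  set Y := ∫ x, max 0 ((f : LTwo d) x - A 0) ^ 2 with hY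
  have hHd : ∀ j, Integrable fun x =>
      H (a * ρ ^ (r + 100 * j)) x - H (a * ρ ^ (r + 100 * j + 1)) x :=
    fun j => (hHi _).sub (hHi _)
  have hYle : Y ≤ 103 / 100 * ∑ j ∈ Finset.range M, ‖(u j : LTwo d)‖ ^ 2 + 1 / 100 := by
    have h1 : Y ≤ ∫ x, (103 / 100 * ∑ j ∈ Finset.range M,
        clampTo (A (j + 1) - A j) ((f : LTwo d) x - A j) ^ 2 +
        ∑ j ∈ Finset.range M, (H (a * ρ ^ (r + 100 * j)) x - H (a * ρ ^ (r + 100 * j + 1)) x)) := by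
      refine integral_mono_ae hYi (((integrable_finsetSum _ fun j _ => hi2 j).const_mul _).add
        (integrable_finsetSum _ fun j _ => hHd j)) ?_
      filter_upwards [hB] with x hx
      have h2 := sq_max_sub_le_sum_clampTo (A := a * ρ ^ r) (M := M) (by positivity) hρ hρΛ
        (hx.trans_lt (hM.trans_le (mul_le_mul_of_nonneg_right haA (by positivity))))
      have h3 : ∀ j, a * ρ ^ (r + 100 * j + 1) = A j * ρ := fun j => by
        rw [hAeq, pow_succ, mul_assoc]
      simp only [← hAeq, h3, hA0]
      exact h2
    rw [integral_add ((integrable_finsetSum _ fun j _ => hi2 j).const_mul _)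
        (integrable_finsetSum _ fun j _ => hHd j), integral_const_mul,
      integral_finsetSum _ fun j _ => hi2 j,
      integral_finsetSum _ fun j _ => hHd j] at h1
    have h4 : ∀ j, ∫ x, clampTo (A (j + 1) - A j) ((f : LTwo d) x - A j) ^ 2
        = ‖(u j : LTwo d)‖ ^ 2 := by
      intro j
      rw [LTwo.norm_sq_eq_integral]
      refine integral_congr_ae ?_
      filter_upwards [hu j] with x hx
      rw [hx]
    have h5 : ∀ j, ∫ x, (H (a * ρ ^ (r + 100 * j)) x - H (a * ρ ^ (r + 100 * j + 1)) x)
        = (∫ x, H (a * ρ ^ (r + 100 * j)) x) - ∫ x, H (a * ρ ^ (r + 100 * j + 1)) x :=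
      fun j => integral_sub (hHi _) (hHi _)
    simp only [h4, h5] at h1
    push_cast at hband
    linarith
  -- the pieces of `f` between two levels
  have hpiece : ∀ j, 99 / 100 * ‖(u j : LTwo d)‖ ^ 2 ≤ t * (D.killed V).form (u j) (u j)
      + (a * ρ ^ (r + 100 * j + 100)) ^ 2 * rateGamma V K r₀ (σ (r + 100 * j)) := by
    intro j
    have hAj1 : A (j + 1) = a * ρ ^ (r + 100 * j + 100) := by rw [hAeq]; ring_nf
    have h1 := h.norm_sq_le_of_bounded (hσ0 (r + 100 * j)) (u j) (B := A (j + 1)) (by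
      filter_upwards [hu j] with x hx
      rw [hx, abs_of_nonneg (le_max_left _ _)]
      refine max_le (hApos _).le ((min_le_left _ _).trans ?_)
      linarith [hApos j])
    have h2 := sq_mul_mass_sq_le hφ hφ0 hc hc0 (hApos j).le (f : LTwo d) (u j : LTwo d) (by
      filter_upwards [hu j, hf0] with x hx hx0
      rcases le_total ((f : LTwo d) x) (A j) with hle | hle
      · rw [hx, clampTo_of_nonpos (by linarith), abs_zero, mul_zero, mul_zero]
      · exact mul_le_mul_of_nonneg_right (hle.trans (le_abs_self _)) (abs_nonneg _))
    rw [hf1, one_pow, mul_one] at h2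
    have h3 := hβ (r + 100 * j)
    rw [← hAeq] at h3
    have hb0 := h.rateBeta_nonneg (hσ0 (r + 100 * j))
    have hA2 : 0 < A j ^ 2 := pow_pos (hApos j) 2
    have h4 : rateBeta V K r₀ C₀ α (σ (r + 100 * j)) * (∫ x, |(u j : LTwo d) x| * φ₁ x) ^ 2
        ≤ ‖(u j : LTwo d)‖ ^ 2 / 100 := by
      refine le_of_mul_le_mul_left ?_ hA2
      calc A j ^ 2 * (rateBeta V K r₀ C₀ α (σ (r + 100 * j)) *
            (∫ x, |(u j : LTwo d) x| * φ₁ x) ^ 2)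
          = rateBeta V K r₀ C₀ α (σ (r + 100 * j)) *
            (A j ^ 2 * (∫ x, |(u j : LTwo d) x| * φ₁ x) ^ 2) := by ring
        _ ≤ rateBeta V K r₀ C₀ α (σ (r + 100 * j)) * (c ^ 2 * ‖(u j : LTwo d)‖ ^ 2) :=
          mul_le_mul_of_nonneg_left h2 hb0
        _ = rateBeta V K r₀ C₀ α (σ (r + 100 * j)) * c ^ 2 * ‖(u j : LTwo d)‖ ^ 2 := by ring
        _ ≤ A j ^ 2 / 100 * ‖(u j : LTwo d)‖ ^ 2 :=
          mul_le_mul_of_nonneg_right h3 (sq_nonneg _)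
        _ = _ := by ring
    have h5 := mul_le_mul_of_nonneg_right (hσt (r + 100 * j)) (hE.nonneg (u j))
    rw [hAj1] at h1
    linarith
  have hSsum : 99 / 100 * ∑ j ∈ Finset.range M, ‖(u j : LTwo d)‖ ^ 2
      ≤ t * ∑ j ∈ Finset.range M, (D.killed V).form (u j) (u j) + 1 / 200 := by
    have hinj : Function.Injective fun j : ℕ => r + 100 * j := fun i j hij => by
      simp only at hij
      omega
    have h1 := hγ ((Finset.range M).map ⟨_, hinj⟩)
    rw [Finset.sum_map] at h1
    have h2 := Finset.sum_le_sum fun j (_ : j ∈ Finset.range M) => hpiece j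
    rw [← Finset.mul_sum, Finset.sum_add_distrib, ← Finset.mul_sum] at h2
    exact h2.trans (add_le_add le_rfl h1)
  -- the part of `f` below the lowest level
  have hwX := h.norm_sq_le_of_bounded ht w (B := A 0) (by
    filter_upwards [hw, hf0] with x hx hx0
    rw [hx, abs_of_nonneg (le_min hx0 (hApos 0).le)]
    exact min_le_right _ _)
  have hwm : (∫ x, |(w : LTwo d) x| * φ₁ x) ^ 2 ≤ (∫ x, |(f : LTwo d) x| * φ₁ x) ^ 2 := by
    refine pow_le_pow_left₀ (integral_nonneg fun x => mul_nonneg (abs_nonneg _) (hφ0 x)) ?_ 2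
    refine integral_mono_ae ((LTwo.memLp (w : LTwo d)).abs.integrable_mul hφ)
      ((LTwo.memLp (f : LTwo d)).abs.integrable_mul hφ) ?_
    filter_upwards [hw, hf0] with x hx hx0
    refine mul_le_mul_of_nonneg_right ?_ (hφ0 x)
    rw [hx, abs_of_nonneg (le_min hx0 (hApos 0).le), abs_of_nonneg hx0]
    exact min_le_left _ _
  have hb0 := h.rateBeta_nonneg ht
  have hwm' := mul_le_mul_of_nonneg_left hwm hb0
  have hwi := LTwo.integrable_sq (w : LTwo d)
  have hsplit : ∀ᵐ x, (f : LTwo d) x = (w : LTwo d) x + max 0 ((f : LTwo d) x - A 0) := by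
    filter_upwards [hw] with x hx
    rw [hx]
    rcases le_total ((f : LTwo d) x) (A 0) with hle | hle
    · rw [min_eq_left hle, max_eq_left (by linarith), add_zero]
    · rw [min_eq_right hle, max_eq_right (by linarith)]
      ring
  have hone : 1 ≤ 5 / 4 * Y + 5 * ‖(w : LTwo d)‖ ^ 2 := by
    rw [← hf2, hY, LTwo.norm_sq_eq_integral, ← integral_const_mul, ← integral_const_mul,
      ← integral_add (hYi.const_mul _) (hwi.const_mul _)]
    refine integral_mono_ae hfi ((hYi.const_mul _).add (hwi.const_mul _)) ?_
    filter_upwards [hsplit] with x hx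
    generalize max 0 ((f : LTwo d) x - A 0) = p at *
    rw [hx]
    nlinarith [sq_nonneg (p - 4 * (w : LTwo d) x)]
  -- the mass of `f²` on the far part of the set where the potential is small
  have hfar : 1 ≤ t * (D.killed V).form f f
      + rateBeta V K r₀ C₀ α t * (∫ x, |(f : LTwo d) x| * φ₁ x) ^ 2 + 101 / 100 * Y
      + 101 / 10000 := by
    have h1 := h.norm_sq_le ht f
    rw [hf1, one_pow] at h1
    set L := {x : RSpace d | potInfInv V K r₀ (2 / t) ≤ ‖x‖ ∧ (V x : ℝ) ≤ K} with hL
    have hLfin : volume L < ∞ := volume_low_lt_top h.volume_lt_top h.K_pos _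
    have h2 : ∫ x in L, (w : LTwo d) x ^ 2 ≤ A 0 ^ 2 * rateGamma V K r₀ t :=
      setIntegral_sq_le_of_abs_le hLfin (by
        filter_upwards [hw, hf0] with x hx hx0
        rw [hx, abs_of_nonneg (le_min hx0 (hApos 0).le)]
        exact min_le_right _ _)
    have h3 : ∫ x in L, max 0 ((f : LTwo d) x - A 0) ^ 2 ≤ Y :=
      setIntegral_le_integral hYi (ae_of_all _ fun x => sq_nonneg _)
    have h4 : ∫ x in L, (f : LTwo d) x ^ 2 ≤ 101 / 100 *
        (∫ x in L, max 0 ((f : LTwo d) x - A 0) ^ 2) + 101 * ∫ x in L, (w : LTwo d) x ^ 2 := by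
      rw [← integral_const_mul, ← integral_const_mul,
        ← integral_add (hYi.const_mul _).integrableOn (hwi.const_mul _).integrableOn]
      refine setIntegral_mono_ae hfi.integrableOn
        ((hYi.const_mul _).add (hwi.const_mul _)).integrableOn ?_
      filter_upwards [hsplit] with x hx
      generalize max 0 ((f : LTwo d) x - A 0) = p at *
      rw [hx]
      nlinarith [sq_nonneg (p - 100 * (w : LTwo d) x)]
    linarith
  -- the bounds `hfar`, `hYle` and `hSsum` force the pieces above the lowest level to carry most of
  -- the energy, which makes the part below it small by `hwX`; then `hone` makes the part above it
  -- so large that its energy exceeds the whole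
  have hEt := mul_le_mul_of_nonneg_left hEsum ht.le
  rw [mul_add] at hEt
  by_contra! hlt
  linarith

end LocalSuperPoincare

/-! ### The choice of the levels -/

/-- A super Poincaré inequality follows from its validity for normalized bounded nonnegative
functions. -/
theorem LTwoForm.norm_sq_le_of_normalized {d : ℕ} {E : LTwoForm d} (hE : E.IsClosedForm)
    (hC : E.ContractionsOperate) {φ₁ : RSpace d → ℝ} (hφ : MemLp φ₁ 2 volume)
    (hφ0 : ∀ x, 0 ≤ φ₁ x) {a b : ℝ} (ha : 0 ≤ a) (hb : 0 ≤ b)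
    (h : ∀ f : E.dom, (∀ᵐ x, 0 ≤ (f : LTwo d) x) → (∃ B, ∀ᵐ x, (f : LTwo d) x ≤ B) →
      ‖(f : LTwo d)‖ = 1 → 1 ≤ a * E.form f f + b * (∫ x, |(f : LTwo d) x| * φ₁ x) ^ 2)
    (f : E.dom) :
    ‖(f : LTwo d)‖ ^ 2 ≤ a * E.form f f + b * (∫ x, |(f : LTwo d) x| * φ₁ x) ^ 2 := by
  have hlip : ∀ n : ℕ, LipschitzWith 1 fun v : ℝ => min |v| (n : ℝ) := fun n =>
    (lipschitzWith_one_norm (E := ℝ)).min_const _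
  choose w hw hwE using fun n : ℕ => hC _ (hlip n) (by simp) f
  have hle : ∀ n, ‖(w n : LTwo d)‖ ^ 2
      ≤ a * E.form f f + b * (∫ x, |(f : LTwo d) x| * φ₁ x) ^ 2 := by
    intro n
    have hw0 : ∀ᵐ x, 0 ≤ (w n : LTwo d) x := by
      filter_upwards [hw n] with x hx
      rw [hx]
      positivity
    have h1 : ‖(w n : LTwo d)‖ ^ 2
        ≤ a * E.form (w n) (w n) + b * (∫ x, |(w n : LTwo d) x| * φ₁ x) ^ 2 := by
      rcases eq_or_lt_of_le (norm_nonneg (w n : LTwo d)) with h0 | h0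
      · rw [← h0, zero_pow two_ne_zero]
        exact add_nonneg (mul_nonneg ha (hE.nonneg _)) (mul_nonneg hb (sq_nonneg _))
      set k := ‖(w n : LTwo d)‖ with hk
      have hsm := Lp.coeFn_smul k⁻¹ (w n : LTwo d)
      have h2 := h (k⁻¹ • w n) (by
          filter_upwards [hsm, hw0] with x h3 h4
          rw [Submodule.coe_smul, h3, Pi.smul_apply, smul_eq_mul]
          positivity)
        ⟨k⁻¹ * n, by
          filter_upwards [hsm, hw n] with x h3 h4
          rw [Submodule.coe_smul, h3, Pi.smul_apply, smul_eq_mul, h4]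
          exact mul_le_mul_of_nonneg_left (min_le_right _ _) (by positivity)⟩
        (by rw [Submodule.coe_smul, norm_smul, norm_inv, hk, norm_norm, inv_mul_cancel₀ h0.ne'])
      have h5 : ∫ x, |((k⁻¹ • w n : E.dom) : LTwo d) x| * φ₁ x
          = k⁻¹ * ∫ x, |(w n : LTwo d) x| * φ₁ x := by
        rw [← integral_const_mul]
        refine integral_congr_ae ?_
        filter_upwards [hsm] with x h3
        rw [Submodule.coe_smul, h3, Pi.smul_apply, smul_eq_mul, abs_mul,
          abs_of_pos (inv_pos.2 h0), mul_assoc]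
      rw [h5, LTwoForm.IsClosedForm.form_smul_self] at h2
      have h6 := mul_le_mul_of_nonneg_left h2 (sq_nonneg k)
      have h7 : k ^ 2 * (a * (k⁻¹ ^ 2 * E.form (w n) (w n))
          + b * (k⁻¹ * ∫ x, |(w n : LTwo d) x| * φ₁ x) ^ 2)
          = a * E.form (w n) (w n) + b * (∫ x, |(w n : LTwo d) x| * φ₁ x) ^ 2 := by
        field_simp
      rwa [h7, mul_one] at h6
    refine h1.trans (add_le_add (mul_le_mul_of_nonneg_left (hwE n) ha)
      (mul_le_mul_of_nonneg_left (pow_le_pow_left₀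
        (integral_nonneg fun x => mul_nonneg (abs_nonneg _) (hφ0 x)) ?_ 2) hb))
    refine integral_mono_ae ((LTwo.memLp (w n : LTwo d)).abs.integrable_mul hφ)
      ((LTwo.memLp (f : LTwo d)).abs.integrable_mul hφ) ?_
    filter_upwards [hw n, hw0] with x hx hx0
    refine mul_le_mul_of_nonneg_right ?_ (hφ0 x)
    rw [abs_of_nonneg hx0, hx]
    exact min_le_left _ _
  have hlim : Tendsto (fun n => (w n : LTwo d)) atTop (𝓝 |(f : LTwo d)|) := by
    refine LTwo.tendsto_of_dominated _ _ (f : LTwo d) (fun n => ?_) ?_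
    · filter_upwards [hw n] with x hx
      rw [hx, abs_of_nonneg (by positivity)]
      exact min_le_left _ _
    · filter_upwards [ae_all_iff.2 hw, Lp.coeFn_abs (f : LTwo d)] with x hx hx'
      rw [hx']
      simp only [hx]
      refine tendsto_const_nhds.congr' ?_
      filter_upwards [eventually_ge_atTop ⌈|(f : LTwo d) x|⌉₊] with n hn
      exact (min_eq_left (Nat.ceil_le.1 hn)).symm
  have h1 := le_of_tendsto' (hlim.norm.pow 2) hle
  rwa [norm_abs_eq_norm] at h1

namespace LocalSuperPoincare

variable {d : ℕ} {D : RegularDirichletForm d} {V : RSpace d → ℝ≥0} {φ₁ : RSpace d → ℝ}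
  {K r₀ C₀ : ℝ} {α : ℝ → ℝ → ℝ}

/-- `s = 0` is excluded, as `2 / 0 = 0` makes `rateGamma V K r₀ 0` the largest value. -/
theorem rateGamma_mono (h : LocalSuperPoincare D V φ₁ K r₀ C₀ α) {s t : ℝ} (hs : 0 < s)
    (hst : s ≤ t) : rateGamma V K r₀ s ≤ rateGamma V K r₀ t := by
  refine antitone_lowVol h.volume_lt_top h.K_pos (monotone_potInfInv h.tendsto r₀ ?_)
  gcongr

theorem rateGamma_le (h : LocalSuperPoincare D V φ₁ K r₀ C₀ α) (s : ℝ) :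
    rateGamma V K r₀ s ≤ lowVol V K r₀ :=
  antitone_lowVol h.volume_lt_top h.K_pos (le_potInfInv h.tendsto _ _)

theorem exists_rateGamma_le (h : LocalSuperPoincare D V φ₁ K r₀ C₀ α) {ε : ℝ} (hε : 0 < ε) :
    ∃ t₁ : ℝ, 0 < t₁ ∧ ∀ t, 0 < t → t ≤ t₁ → rateGamma V K r₀ t ≤ ε := by
  obtain ⟨R, hR⟩ := ((tendsto_lowVol h.meas h.volume_lt_top h.K_pos).eventually
    (gt_mem_nhds hε)).exists
  have hpos := h.potInf_pos R
  refine ⟨1 / potInf V K R, by positivity, fun t ht ht1 => ?_⟩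
  have h1 : potInf V K R < 2 / t := by
    rw [le_div_iff₀ hpos] at ht1
    rw [lt_div_iff₀ ht]
    linarith
  exact (antitone_lowVol h.volume_lt_top h.K_pos (le_potInfInv_of_lt h.tendsto h1)).trans hR.le

/-- `γ` is right-continuous, in the form that is needed at positive arguments. -/
theorem exists_rateGamma_le_add (h : LocalSuperPoincare D V φ₁ K r₀ C₀ α) {s ε : ℝ} (hs : 0 < s)
    (hε : 0 < ε) : ∃ s' > s, ∀ σ, 0 < σ → σ < s' → rateGamma V K r₀ σ ≤ rateGamma V K r₀ s + ε := by
  have hanti := antitone_lowVol (V := V) h.volume_lt_top h.K_pos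
  rcases le_or_gt (potInfInv V K r₀ (2 / s)) r₀ with hR | hR
  · refine ⟨s + 1, lt_add_one s, fun σ _ _ => ?_⟩
    have := (h.rateGamma_le σ).trans (hanti hR)
    exact this.trans (le_add_of_nonneg_right hε.le)
  · obtain ⟨R', hR', hlt⟩ := exists_lowVol_lt h.meas h.volume_lt_top h.K_pos
      (potInfInv V K r₀ (2 / s)) hε
    have h1 : potInf V K (max r₀ R') < 2 / s :=
      lt_of_lt_potInfInv (le_max_left _ _) (max_lt hR hR')
    have hpos := h.potInf_pos (max r₀ R')
    refine ⟨2 / potInf V K (max r₀ R'), ?_, fun σ hσ hσ' => ?_⟩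
    · rw [lt_div_iff₀ hs] at h1
      rw [gt_iff_lt, lt_div_iff₀ hpos]
      linarith
    · have h2 : potInf V K (max r₀ R') < 2 / σ := by
        rw [lt_div_iff₀ hpos] at hσ'
        rw [lt_div_iff₀ hσ]
        linarith
      exact (hanti ((le_max_right _ _).trans (le_potInfInv_of_lt h.tendsto h2))).trans hlt.le

theorem levelSeq_nonneg (β : ℝ → ℝ) (c₁ δ : ℝ) (n : ℕ) : 0 ≤ levelSeq β c₁ δ n :=
  Real.sInf_nonneg fun _ hs => hs.1.le

/-- The infimum defining `levelSeq` can be replaced by an admissible value at no cost in `γ`. -/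
theorem exists_level (h : LocalSuperPoincare D V φ₁ K r₀ C₀ α) {β : ℝ → ℝ} {c₁ δ : ℝ} {n : ℕ}
    {t ε : ℝ} (ht : 0 < t) (hε : 0 < ε)
    (hlt : rateGamma V K r₀ (levelSeq β c₁ δ n) < rateGamma V K r₀ t) :
    ∃ σ, 0 < σ ∧ σ ≤ t ∧ β σ ≤ c₁ * δ ^ n / 2 ∧
      rateGamma V K r₀ σ ≤ rateGamma V K r₀ (levelSeq β c₁ δ n) + ε := by
  -- the argument `0`, which also stands for an infimum over the empty set, gives the largest `γ`
  have h0 : lowVol V K r₀ ≤ rateGamma V K r₀ 0 := by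
    refine antitone_lowVol h.volume_lt_top h.K_pos ?_
    refine csInf_le (bddBelow_potInfInv_set V K r₀ _) ⟨le_rfl, ?_⟩
    rw [div_zero]
    exact (h.potInf_pos r₀).le
  have hspos : 0 < levelSeq β c₁ δ n := by
    refine lt_of_le_of_ne (levelSeq_nonneg β c₁ δ n) fun hs => ?_
    rw [← hs] at hlt
    exact absurd (hlt.trans_le (h.rateGamma_le t)) (not_lt.2 h0)
  have hne : {s | 0 < s ∧ β s ≤ c₁ * δ ^ n / 2}.Nonempty := by
    by_contra hne
    rw [Set.not_nonempty_iff_eq_empty] at hne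
    rw [levelSeq, hne, Real.sInf_empty] at hspos
    exact hspos.false
  have hst : levelSeq β c₁ δ n < t := by
    by_contra! hle
    exact absurd (h.rateGamma_mono ht hle) (not_le.2 hlt)
  obtain ⟨s', hs', hγ⟩ := h.exists_rateGamma_le_add hspos hε
  obtain ⟨σ, hσ, hσlt⟩ := exists_lt_of_csInf_lt hne (lt_min hst hs')
  exact ⟨σ, hσ.1, (hσlt.trans_le (min_le_left _ _)).le, hσ.2,
    hγ σ hσ.1 (hσlt.trans_le (min_le_right _ _))⟩

/-- For small `t` the summability of `γ (s_n) δ ^ n` provides the levels and rates required by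
`one_le_of_levels`. -/
theorem exists_levels (h : LocalSuperPoincare D V φ₁ K r₀ C₀ α) (c : ℝ) {δ : ℝ} (hδ : 1 < δ)
    (hsum : Summable fun n : ℕ =>
      rateGamma V K r₀ (levelSeq (rateBeta V K r₀ C₀ α) (c ^ 2) δ (n + 1)) * δ ^ (n + 1)) :
    ∃ t₁ : ℝ, 0 < t₁ ∧ ∀ t, 0 < t → t ≤ t₁ → 0 < rateGamma V K r₀ t →
      ∃ (a ρ : ℝ) (σ : ℕ → ℝ), 0 < a ∧ 100 ≤ ρ ∧ (∀ i, 0 < σ i) ∧ (∀ i, σ i ≤ t) ∧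
        (∀ i, rateBeta V K r₀ C₀ α (σ i) * c ^ 2 ≤ (a * ρ ^ i) ^ 2 / 100) ∧
        (∀ S : Finset ℕ,
          ∑ i ∈ S, (a * ρ ^ (i + 100)) ^ 2 * rateGamma V K r₀ (σ i) ≤ 1 / 200) ∧
        (a * ρ ^ 100) ^ 2 * rateGamma V K r₀ t ≤ 1 / 10000 := by
  have hδ0 : 0 < δ := by linarith
  -- `ρ = δ ^ k`; the level `a ρ ^ i = δ ^ (ν + k i)` is paired with `s_n`, `n = 2 (ν + k i) - J`,
  -- where the shift `J` makes the weighted mass negligible; `Q` compares `δ ^ n` with the square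
  -- of the level `a ρ ^ (i + 100)`
  obtain ⟨k, hk⟩ := pow_unbounded_of_one_lt 100 hδ
  have hk0 : 0 < k := by
    rcases Nat.eq_zero_or_pos k with rfl | hk'
    · norm_num at hk
    · exact hk'
  obtain ⟨J, hJ⟩ := pow_unbounded_of_one_lt (50 * c ^ 4) hδ
  set Q := δ ^ (J + 200 * k) with hQ
  have hQ0 : 0 < Q := by positivity
  set ε₀ := 1 / 10000 / (Q * δ ^ 2) with hε₀
  have hε₀0 : 0 < ε₀ := by positivity
  obtain ⟨S₀, hS₀⟩ := summable_iff_vanishing_norm.1 hsum ε₀ hε₀0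
  obtain ⟨N₁, hN₁⟩ := S₀.exists_nat_subset_range
  have hδ2 : 1 < δ ^ 2 := one_lt_pow₀ hδ two_ne_zero
  obtain ⟨t₁, ht₁, hsmall⟩ := h.exists_rateGamma_le
    (show 0 < 1 / 10000 / (δ ^ (200 * k) * (δ ^ 2) ^ (J + N₁ + 2)) by positivity)
  refine ⟨t₁, ht₁, fun t ht htt₁ hG => ?_⟩
  have hGle := hsmall t ht htt₁
  set G := rateGamma V K r₀ t with hGdef
  have hx : (δ ^ 2) ^ (J + N₁ + 2) ≤ 1 / 10000 / (G * δ ^ (200 * k)) := by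
    rw [le_div_iff₀ (by positivity)] at hGle ⊢
    linarith
  -- the lowest level `δ ^ ν` is as large as `γ t` permits
  obtain ⟨ν, hν, hν'⟩ := exists_nat_pow_near ((one_le_pow₀ hδ2.le).trans hx) hδ2
  have hνlarge : J + N₁ + 2 < ν + 1 := (pow_lt_pow_iff_right₀ hδ2).1 (hx.trans_lt hν')
  obtain ⟨m, hm⟩ : ∃ m, 2 * ν = J + (m + 1) := ⟨2 * ν - J - 1, by omega⟩
  have hmN : N₁ ≤ m := by omega
  rw [le_div_iff₀ (by positivity)] at hν
  rw [div_lt_iff₀ (by positivity)] at hν'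
  let β := rateBeta V K r₀ C₀ α
  let n : ℕ → ℕ := fun i => m + 2 * k * i
  have hn : ∀ i, (δ ^ ν * (δ ^ k) ^ i) ^ 2 = δ ^ J * δ ^ (n i + 1) := by
    intro i
    rw [← pow_mul, ← pow_add, ← pow_mul, ← pow_add]
    congr 1
    simp only [n]
    linarith
  have hn' : ∀ i, (δ ^ ν * (δ ^ k) ^ (i + 100)) ^ 2 = Q * δ ^ (n i + 1) := by
    intro i
    rw [hQ, ← pow_mul, ← pow_add, ← pow_mul, ← pow_add]
    congr 1
    simp only [n]
    linarith
  have hninj : Function.Injective n := fun i j hij => by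
    have h1 : 2 * k * i = 2 * k * j := by simpa [n] using hij
    exact Nat.eq_of_mul_eq_mul_left (by omega) h1
  have htail : ∀ S : Finset ℕ,
      ∑ i ∈ S, rateGamma V K r₀ (levelSeq β (c ^ 2) δ (n i + 1)) * δ ^ (n i + 1) < ε₀ := by
    intro S
    have h1 := hS₀ (S.map ⟨n, hninj⟩) (by
      rw [Finset.disjoint_left]
      intro x hx hx'
      obtain ⟨i, -, rfl⟩ := Finset.mem_map.1 hx
      have h2 := Finset.mem_range.1 (hN₁ hx')
      simp only [Function.Embedding.coeFn_mk, n] at h2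
      omega)
    rw [Finset.sum_map] at h1
    exact (le_abs_self _).trans_lt h1
  have hlt : ∀ i, rateGamma V K r₀ (levelSeq β (c ^ 2) δ (n i + 1)) < G := by
    intro i
    have h1 := htail {i}
    rw [Finset.sum_singleton] at h1
    have h2 : δ ^ (m + 1) ≤ δ ^ (n i + 1) := pow_le_pow_right₀ hδ.le (by simp [n])
    have h3 : 1 / 10000 < G * δ ^ (m + 1) * (Q * δ ^ 2) := by
      have e : G * δ ^ (m + 1) * (Q * δ ^ 2) = (δ ^ 2) ^ (ν + 1) * (G * δ ^ (200 * k)) := by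
        have e1 : δ ^ (m + 1) * Q * δ ^ 2 = (δ ^ 2) ^ (ν + 1) * δ ^ (200 * k) := by
          rw [hQ, ← pow_add, ← pow_add, ← pow_mul, ← pow_add]
          congr 1
          linarith
        linear_combination G * e1
      rw [e]
      exact hν'
    have h4 : ε₀ < G * δ ^ (m + 1) := by
      rwa [hε₀, div_lt_iff₀ (by positivity)]
    have h5 : G * δ ^ (m + 1) ≤ G * δ ^ (n i + 1) := mul_le_mul_of_nonneg_left h2 hG.le
    exact lt_of_mul_lt_mul_right ((h1.trans h4).trans_le h5) (by positivity)
  -- the errors are summable against `Q δ ^ n`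
  choose σ hσ0 hσt hσβ hσγ using fun i => h.exists_level (β := β) ht
    (show 0 < 1 / 1000 / (Q * δ ^ (n i + 1)) * (1 / 2) ^ i by positivity) (hlt i)
  refine ⟨δ ^ ν, δ ^ k, σ, by positivity, hk.le, hσ0, hσt, fun i => ?_, fun S => ?_, ?_⟩
  · rw [hn]
    have h1 := mul_le_mul_of_nonneg_right (hσβ i) (sq_nonneg c)
    have h2 := mul_le_mul_of_nonneg_right hJ.le (show 0 ≤ δ ^ (n i + 1) by positivity)
    refine h1.trans ?_
    linarith
  · have h1 : ∀ i ∈ S, (δ ^ ν * (δ ^ k) ^ (i + 100)) ^ 2 * rateGamma V K r₀ (σ i) ≤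
        Q * (rateGamma V K r₀ (levelSeq β (c ^ 2) δ (n i + 1)) * δ ^ (n i + 1))
          + 1 / 1000 * (1 / 2) ^ i := by
      intro i _
      rw [hn']
      have hp : 0 < Q * δ ^ (n i + 1) := by positivity
      have h2 := mul_le_mul_of_nonneg_left (hσγ i) hp.le
      have h3 : Q * δ ^ (n i + 1) * (1 / 1000 / (Q * δ ^ (n i + 1)) * (1 / 2) ^ i)
          = 1 / 1000 * (1 / 2) ^ i := by
        rw [← mul_assoc, mul_div_cancel₀ _ hp.ne']
      linarith
    have h2 := Finset.sum_le_sum h1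
    rw [Finset.sum_add_distrib, ← Finset.mul_sum, ← Finset.mul_sum] at h2
    have h3 := mul_le_mul_of_nonneg_left (htail S).le hQ0.le
    have h4 : ∑ i ∈ S, (1 / 2 : ℝ) ^ i ≤ 2 := by
      exact (summable_geometric_two.sum_le_tsum S fun i _ => by positivity).trans
        tsum_geometric_two.le
    have h5 : Q * ε₀ ≤ 1 / 10000 := by
      have h6 : Q * ε₀ * δ ^ 2 = 1 / 10000 := by
        rw [hε₀]
        field_simp
      rw [← h6]
      exact le_mul_of_one_le_right (by positivity) hδ2.le
    linarith
  · have e : (δ ^ ν * (δ ^ k) ^ 100) ^ 2 * G = (δ ^ 2) ^ ν * (G * δ ^ (200 * k)) := by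
      have e1 : (δ ^ ν * (δ ^ k) ^ 100) ^ 2 = (δ ^ 2) ^ ν * δ ^ (200 * k) := by
        rw [← pow_mul, ← pow_add, ← pow_mul, ← pow_mul, ← pow_add]
        congr 1
        linarith
      rw [e1]
      ring
    rw [e]
    exact hν

end LocalSuperPoincare

/-! ### Removing the tail term by the summability of the levels -/

namespace LocalSuperPoincare

variable {d : ℕ} {D : RegularDirichletForm d} {V : RSpace d → ℝ≥0} {φ₁ : RSpace d → ℝ}
  {K r₀ C₀ : ℝ} {α : ℝ → ℝ → ℝ}

/-- The tail term can be dropped, at the cost of a factor `2`, if `γ (s_n) δ ^ n` is summable. -/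
theorem exists_norm_sq_le_of_summable (h : LocalSuperPoincare D V φ₁ K r₀ C₀ α)
    (hC : (D.killed V).ContractionsOperate) (hφ : MemLp φ₁ 2 volume) (hφ0 : ∀ x, 0 ≤ φ₁ x)
    {c : ℝ} (hc : ∀ᵐ x, φ₁ x ≤ c) (hc0 : 0 ≤ c) {δ : ℝ} (hδ : 1 < δ)
    (hsum : Summable fun n : ℕ =>
      rateGamma V K r₀ (levelSeq (rateBeta V K r₀ C₀ α) (c ^ 2) δ (n + 1)) * δ ^ (n + 1)) :
    ∃ t₁ : ℝ, 0 < t₁ ∧ ∀ t, 0 < t → t ≤ t₁ → ∀ f : (D.killed V).dom, ‖(f : LTwo d)‖ ^ 2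
      ≤ 2 * t * (D.killed V).form f f
        + 2 * rateBeta V K r₀ C₀ α t * (∫ x, |(f : LTwo d) x| * φ₁ x) ^ 2 := by
  have hE := D.isClosedForm_killed (V := V)
  obtain ⟨t₁, ht₁, hlev⟩ := h.exists_levels c hδ hsum
  refine ⟨t₁, ht₁, fun t ht htt₁ f => ?_⟩
  have hb0 := h.rateBeta_nonneg ht
  refine LTwoForm.norm_sq_le_of_normalized hE hC hφ hφ0 (by positivity) (by positivity)
    (fun f hf0 ⟨B, hB⟩ hf1 => ?_) f
  rcases eq_or_lt_of_le (rateGamma_nonneg V K r₀ t) with hG | hG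
  · have h1 := h.norm_sq_le_of_bounded ht f (B := B) (by
      filter_upwards [hf0, hB] with x h1 h2
      rwa [abs_of_nonneg h1])
    rw [← hG, mul_zero, add_zero, hf1, one_pow] at h1
    have h2 := mul_nonneg ht.le (hE.nonneg f)
    have h3 := mul_nonneg hb0 (sq_nonneg (∫ x, |(f : LTwo d) x| * φ₁ x))
    linarith
  · obtain ⟨a, ρ, σ, ha, hρ, hσ0, hσt, hβ, hγ, hG'⟩ := hlev t ht htt₁ hG
    exact h.one_le_of_levels hC hφ hφ0 hc hc0 ht ha hρ hσ0 hσt hβ hγ hG' f hf0 hB hf1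

theorem superPoincare_of_summable (h : LocalSuperPoincare D V φ₁ K r₀ C₀ α)
    (hC : (D.killed V).ContractionsOperate) (hφ : MemLp φ₁ 2 volume) (hφ0 : ∀ x, 0 < φ₁ x)
    {c : ℝ} (hc : ∀ᵐ x, φ₁ x ≤ c) (hc0 : 0 ≤ c) {δ s₀ : ℝ} (hδ : 1 < δ) (hs₀ : 0 < s₀)
    (hsum : Summable fun n : ℕ =>
      rateGamma V K r₀ (levelSeq (rateBeta V K r₀ C₀ α) (c ^ 2) δ (n + 1)) * δ ^ (n + 1)) :
    ∃ r : ℝ, 0 < r ∧ SuperPoincare (D.killed V) φ₁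
      (rateBetaTilde (rateBeta V K r₀ C₀ α) (rateGamma V K r₀) (c ^ 2) δ s₀) r := by
  have hE := D.isClosedForm_killed (V := V)
  obtain ⟨t₁, ht₁, hSP⟩ := h.exists_norm_sq_le_of_summable hC hφ (fun x => (hφ0 x).le) hc hc0 hδ
    hsum
  refine ⟨t₁, ht₁, SuperPoincare.of_le hE ht₁ fun s hs hsr f => ?_⟩
  rw [rateBetaTilde]
  split_ifs with hne
  · obtain ⟨-, -, hy, hN⟩ := Nat.sInf_mem hne
    set N := sInf (levelSet (rateBeta V K r₀ C₀ α) (rateGamma V K r₀) (c ^ 2) δ s₀ s)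
    set y := 1 / (4 * δ ^ (N + 1)) with hydef
    have hδ0 : 0 < δ := by linarith
    have hy0 : 0 < y := by positivity
    set t := incInv (rateGamma V K r₀) y with htdef
    -- `γ` tends to `0` at `0`, so that `t` is positive
    have ht : 0 < t := by
      obtain ⟨τ, hτ, hγτ⟩ := h.exists_rateGamma_le (half_pos hy0)
      refine hτ.trans_le (le_csInf ⟨s₀, hs₀, hy⟩ fun s' hs' => ?_)
      by_contra! hlt
      have := hs'.2.trans (hγτ s' hs'.1 hlt.le)
      linarith
    have hts : 2 * t ≤ s := by
      have h1 : 1 < √δ := Real.lt_sqrt_of_sq_lt (by linarith)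
      have h2 : 0 ≤ 4 * δ * (√δ + 1) * levelSeq (rateBeta V K r₀ C₀ α) (c ^ 2) δ N / (√δ - 1) :=
        div_nonneg (mul_nonneg (by positivity) (levelSeq_nonneg _ _ _ _)) (by linarith)
      linarith
    have h1 := hSP t ht (by linarith) f
    have hb0 := h.rateBeta_nonneg ht
    have h2 := mul_le_mul_of_nonneg_right hts (hE.nonneg f)
    rw [← LTwo.norm_sq_eq_integral, ← ENNReal.ofReal_mul (by positivity),
      ← ENNReal.ofReal_add (mul_nonneg hs.le (hE.nonneg f))
        (mul_nonneg (by positivity) (sq_nonneg _))]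
    exact ENNReal.ofReal_le_ofReal (by linarith)
  · -- the right-hand side is infinite unless `f = 0`
    by_cases hm : ∫ x, |(f : LTwo d) x| * φ₁ x = 0
    · have h1 : ∀ᵐ x, |(f : LTwo d) x| * φ₁ x = 0 :=
        (integral_eq_zero_iff_of_nonneg (fun x => mul_nonneg (abs_nonneg _) (hφ0 x).le)
          ((LTwo.memLp (f : LTwo d)).abs.integrable_mul hφ)).1 hm
      have h2 : ∫ x, (f : LTwo d) x ^ 2 = 0 := by
        refine integral_eq_zero_of_ae ?_
        filter_upwards [h1] with x hx
        have h3 := (mul_eq_zero.1 hx).resolve_right (hφ0 x).ne'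
        rw [abs_eq_zero.1 h3]
        simp
      rw [h2, ENNReal.ofReal_zero]
      exact zero_le
    · have h1 : 0 < (∫ x, |(f : LTwo d) x| * φ₁ x) ^ 2 := by positivity
      rw [ENNReal.top_mul (ENNReal.ofReal_pos.2 h1).ne', add_top]
      exact le_top

end LocalSuperPoincare

/-! ### Conclusions for the form with killing -/

theorem RegularDirichletForm.contractionsOperate_killed {d : ℕ} (D : RegularDirichletForm d)
    {V : RSpace d → ℝ≥0} (hV : Measurable V)
    (hVloc : ∀ S : Set (RSpace d), IsCompact S → ∃ M : ℝ, ∀ x ∈ S, (V x : ℝ) ≤ M) :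
    (D.killed V).ContractionsOperate := by
  intro ψ hψ h0 u
  obtain ⟨hu, hle⟩ := D.killed_form_compLp_le hV hVloc hψ h0 u
  exact ⟨⟨_, hu⟩, hψ.coeFn_compLp h0 _, hle⟩

theorem LTwoForm.ContractionsOperate.abs_mem {d : ℕ} {E : LTwoForm d} (hC : E.ContractionsOperate)
    (u : E.dom) : ∃ h : |(u : LTwo d)| ∈ E.dom, E.form ⟨_, h⟩ ⟨_, h⟩ ≤ E.form u u := by
  obtain ⟨v, hv, hle⟩ := hC (fun x => |x|) (lipschitzWith_one_norm (E := ℝ)) abs_zero u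
  have h : (v : LTwo d) = |(u : LTwo d)| := by
    refine Lp.ext ?_
    filter_upwards [hv, Lp.coeFn_abs (u : LTwo d)] with x h1 h2
    rw [h1, h2]
  obtain ⟨v, hv'⟩ := v
  simp only at h
  subst h
  exact ⟨hv', hle⟩

theorem theorem2p1 {d : ℕ} (hd : 1 ≤ d)
    (D : RegularDirichletForm d)
    (V : RSpace d → ℝ≥0) (hVmeas : Measurable V)
    (hVloc : ∀ S : Set (RSpace d), IsCompact S → ∃ M : ℝ, ∀ x ∈ S, (V x : ℝ) ≤ M)
    -- the semigroup of the form with killing, its compactness and its ground state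
    (T : ℝ → LTwo d →L[ℝ] LTwo d) (hT : IsSemigroupOf (D.killed V) T)
    (hcompact : ∀ t : ℝ, 0 < t → IsCompactOperator (T t))
    (φ₁ : RSpace d → ℝ) (l₁ : ℝ) (hl₁ : 0 < l₁) (hφ₁ : IsGroundState T φ₁ l₁)
    -- the assumptions on the potential
    (hA2 : ∀ r : ℝ, 0 < r → volume {x : RSpace d | (V x : ℝ) ≤ r} < ∞)
    (K : ℝ) (hK : 0 < K) (hA4 : Tendsto (potInf V K) atTop atTop)
    -- the reference function and the local intrinsic super Poincaré inequality
    (φ : RSpace d → ℝ) (hφmeas : Measurable φ) (hφbdd : ∃ M : ℝ, ∀ x, φ x ≤ M)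
    (hφnonneg : ∀ x, 0 ≤ φ x)
    (r₀ : ℝ) (hr₀ : 0 < r₀) (α : ℝ → ℝ → ℝ) (hαmeas : Measurable (Function.uncurry α))
    (hαpos : ∀ r s : ℝ, 0 < r → 0 < s → 0 < α r s)
    (hlocal : ∀ r : ℝ, r₀ ≤ r → ∀ s : ℝ, 0 < s → ∀ f : (D.killed V).dom,
      ∫ x in Metric.ball (0 : RSpace d) r, (f : LTwo d) x ^ 2
        ≤ s * (D.killed V).form f f + α r s * (∫ x, |(f : LTwo d) x| * φ x) ^ 2)
    (C₀ : ℝ) (hC₀ : 0 < C₀) (hφle : ∀ x, φ x ≤ C₀ * φ₁ x) :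
    let β : ℝ → ℝ := rateBeta V K r₀ C₀ α
    let γ : ℝ → ℝ := rateGamma V K r₀
    let s₀ : ℝ := 2 / potInf V K r₀
    let c₁ : ℝ := (eLpNorm φ₁ ∞ volume).toReal ^ 2
    -- the mixed type super Poincaré inequality
    (∀ s : ℝ, 0 < s → ∀ f : (D.killed V).dom, ∀ p : ℝ≥0∞, 2 < p →
      ENNReal.ofReal (∫ x, (f : LTwo d) x ^ 2)
        ≤ ENNReal.ofReal (s * (D.killed V).form f f)
          + ENNReal.ofReal (β (min s s₀) * (∫ x, |(f : LTwo d) x| * φ₁ x) ^ 2)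
          + ENNReal.ofReal (γ (min s s₀) ^ lpExponent p)
            * eLpNorm (f : LTwo d) p volume ^ 2) ∧
    -- (i)
    (Tendsto (fun x => (V x : ℝ)) (cocompact (RSpace d)) atTop →
      (∃ r₁ : ℝ, 0 < r₁ ∧
        SuperPoincare (D.killed V) φ₁ (fun s => ENNReal.ofReal (β s)) r₁) ∧
      (RateIntegrable (fun s => ENNReal.ofReal (β s)) →
        IntrinsicallyUltracontractive T φ₁ l₁)) ∧
    -- (ii)
    (∀ (p : ℝ≥0∞) (c₀ : ℝ), 2 < p → 0 < c₀ →
      (∀ f : (D.killed V).dom, (f : LTwo d) ∈ ccClass d ((⊤ : ℕ∞) : WithTop ℕ∞) →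
        eLpNorm (f : LTwo d) p volume ^ 2
          ≤ ENNReal.ofReal (c₀ * ((D.killed V).form f f + ∫ x, (f : LTwo d) x ^ 2))) →
      (∃ r₂ : ℝ, 0 < r₂ ∧
        SuperPoincare (D.killed V) φ₁
          (fun s => ENNReal.ofReal (rateBetaHat V K C₀ c₀ p α s)) r₂) ∧
      (RateIntegrable (fun s => ENNReal.ofReal (rateBetaHat V K C₀ c₀ p α s)) →
        IntrinsicallyUltracontractive T φ₁ l₁)) ∧
    -- (iii)
    (∀ δ : ℝ, 1 < δ →
      Summable (fun n : ℕ => γ (levelSeq β c₁ δ (n + 1)) * δ ^ (n + 1)) →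
      (∃ r₂ : ℝ, 0 < r₂ ∧
        SuperPoincare (D.killed V) φ₁ (rateBetaTilde β γ c₁ δ s₀) r₂) ∧
      (RateIntegrable (rateBetaTilde β γ c₁ δ s₀) →
        IntrinsicallyUltracontractive T φ₁ l₁)) := by
  intro β γ s₀ c₁
  have hE := D.isClosedForm_killed (V := V)
  have hC := D.contractionsOperate_killed hVmeas hVloc
  have hφL2 : MemLp φ₁ 2 volume := by
    obtain ⟨u, hu, -⟩ := hφ₁.eigen
    exact (LTwo.memLp u).ae_eq hu
  have hloc : LocalSuperPoincare D V φ₁ K r₀ C₀ α :=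
    { meas := hVmeas
      volume_lt_top := hA2
      K_pos := hK
      tendsto := hA4
      r₀_pos := hr₀
      α_nonneg := fun r s hr hs => (hαpos r s hr hs).le
      ineq := fun r hr s hs f => by
        have h1 : ∫ x, |(f : LTwo d) x| * φ x ≤ C₀ * ∫ x, |(f : LTwo d) x| * φ₁ x := by
          rw [← integral_const_mul]
          refine integral_mono_of_nonneg
            (ae_of_all _ fun x => mul_nonneg (abs_nonneg _) (hφnonneg x))
            (((LTwo.memLp (f : LTwo d)).abs.integrable_mul hφL2).const_mul _)
            (ae_of_all _ fun x => ?_)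
          have := mul_le_mul_of_nonneg_left (hφle x) (abs_nonneg ((f : LTwo d) x))
          linarith
        have h2 := pow_le_pow_left₀
          (integral_nonneg fun x => mul_nonneg (abs_nonneg _) (hφnonneg x)) h1 2
        have h3 := mul_le_mul_of_nonneg_left h2 (hαpos r s (hr₀.trans_le hr) hs).le
        refine (hlocal r hr s hs f).trans (add_le_add le_rfl (h3.trans (le_of_eq ?_)))
        ring }
  have hs₀ : 0 < s₀ := div_pos two_pos (hloc.potInf_pos r₀)
  have hIUC : ∀ b : ℝ → ℝ≥0∞, (∃ r : ℝ, 0 < r ∧ SuperPoincare (D.killed V) φ₁ b r) →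
      RateIntegrable b → IntrinsicallyUltracontractive T φ₁ l₁ := fun b ⟨r, hr, hSP⟩ hb =>
    hT.intrinsicallyUltracontractive hE hC.abs_mem hl₁ hφ₁ hr hSP hb
  refine ⟨fun s hs f p hp => hloc.mixed (lt_min hs hs₀) (min_le_left _ _) f hp, fun hVinf => ?_,
    fun p c₀ hp hc₀ hsob => ?_, fun δ hδ hsum => ?_⟩
  · have hSP := hloc.superPoincare_of_tendsto hVinf
    exact ⟨hSP, hIUC _ hSP⟩
  · have hSP := hloc.superPoincare_of_sobolev hc₀ hp
      (RegularDirichletForm.sobolev_of_smooth hVmeas hVloc hc₀ hsob)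
    exact ⟨hSP, hIUC _ hSP⟩
  · have hfin : eLpNorm φ₁ ∞ volume ≠ ∞ := by
      obtain ⟨B, hB⟩ := hφ₁.bounded
      have h1 : MemLp φ₁ ∞ volume := memLp_top_of_bound hφ₁.continuous.aestronglyMeasurable B
        (ae_of_all _ fun x => by
          rw [Real.norm_of_nonneg (hφ₁.pos x).le]
          exact hB x)
      exact h1.2.ne
    have hle : ∀ᵐ x, φ₁ x ≤ (eLpNorm φ₁ ∞ volume).toReal := by
      filter_upwards [enorm_ae_le_eLpNormEssSup φ₁ volume] with x hx
      rw [← eLpNorm_exponent_top, ← ENNReal.ofReal_toReal hfin, Real.enorm_eq_ofReal_abs,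
        ENNReal.ofReal_le_ofReal_iff ENNReal.toReal_nonneg] at hx
      exact (le_abs_self _).trans hx
    have hSP := hloc.superPoincare_of_summable hC hφL2 hφ₁.pos hle ENNReal.toReal_nonneg hδ hs₀
      hsum
    exact ⟨hSP, hIUC _ hSP⟩
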